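/- **Setting.** Let $d\ge 2$, $p=d(d+1)/2$, $p_u=d(d-1)/2$. For $i=1,2$ let $X_{ik}=\mu_i+\varepsilon_{ik}$, $k=1,2,\dots$, be random vectors in $\mathbb R^d$, where all $\varepsilon_{ik}$ are independent, $\varepsilon_{i1},\varepsilon_{i2},\dots$ are identically distributed, $\mathbb E\,\varepsilon_{i1}=0$, $\mathbb E\|\varepsilon_{i1}\|^4<\infty$, and $V_i=\operatorname{Cov}(\varepsilon_{i1})$ has a positive diagonal. Group $i$ is observed for $k\le n_i$; put $N=n_1+n_2$ and let $n_1,n_2\to\infty$ with $n_i/N\to\kappa_i\in(0,1]$. For a $d\times d$ matrix $W$, $\operatorname{vech}(W)\in\mathbb R^p$ lists the entries $W_{jk}$, $j\le k$, and $\operatorname{vech}^-(W)\in\mathbb R^{p_u}$ the entries with $j<k$; write $a_j$ for the position of the entry $(j,j)$ in $\operatorname{vech}$. Let $v_i=\operatorname{vech}(V_i)$, $R_i$ the correlation matrix of $V_i$, $r_i=\operatorname{vech}^-(R_i)$, $\Sigma_i=\operatorname{Cov}(\operatorname{vech}(\varepsilon_{i1}\varepsilon_{i1}^\top))$. Let $\widehat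 V_i$ be the empirical covariance matrix (with factor $1/(n_i-1)$), $\widehat R_i$ its correlation matrix, $\widehat v_i=\operatorname{vech}(\widehat V_i)$, $\widehat r_i=\operatorname{vech}^-(\widehat R_i)$. Let $L$ be the matrix with $L\operatorname{vech}(W)=\operatorname{vech}^-(W)$, $A=\sum_{j}e_je_{a_j}^\top\in\mathbb R^{d\times p}$; let $M_1\in\mathbb R^{p_u\times p}$ and $M_4\in\mathbb R^{p\times p}$ have the rows $(e_{a_j}+e_{a_k})^\top$ in position $(j,k)$ with $j<k$, respectively $j\le k$; $M_5=\operatorname{diag}(\operatorname{vech}(I_d))$. For $v=\operatorname{vech}(V)$ with correlation matrix $R$ and $r=\operatorname{vech}^-(R)$ put $$\Lambda(v)=\operatorname{diag}\big(\operatorname{vech}(ww^\top)\big)^{-1/2},\quad w=(V_{11},\dots,V_{dd})^\top,\qquad M(v,r)=\big[L-\tfrac12\operatorname{diag}(r)M_1\big]\Lambda(v),$$ and, with $u=\Lambda(v)x$, $$f_{v,R}(x)=\tfrac14L\operatorname{diag}(\operatorname{vech}(Auu^\top A^\top))\operatorname{vech}(R)-\tfrac12L\operatorname{diag}(u)M_4M_5u+\tfrac38\operatorname{diag}(r)M_1\operatorname{vech}((Au)(Au)^\top).$$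 Let $T=\sqrt N\big((\widehat V_{111},\dots,\widehat V_{1dd},\widehat r_1)-(\widehat V_{211},\dots,\widehat V_{2dd},\widehat r_2)\big)\in\mathbb R^p$ and $$\Gamma=\sum_{i=1}^2\kappa_i^{-1}\begin{pmatrix}A\\M(v_i,r_i)\end{pmatrix}\Sigma_i\begin{pmatrix}A\\M(v_i,r_i)\end{pmatrix}^\top .$$ Let $\widehat\Sigma_i$ be a measurable, positive semidefinite, consistent estimator of $\Sigma_i$ based on $X_{i1},\dots,X_{in_i}$. Given the data, let $Y_i^b$ ($i=1,2$, $b=1,2,\dots$) be independent with $Y_i^b\sim\mathcal N_p(0,\widehat\Sigma_i)$, and put $$Y_i^{b,Tay}=\begin{pmatrix}A\\M(\widehat v_i,\widehat r_i)\end{pmatrix}Y_i^b+\frac1{\sqrt{n_i}}\begin{pmatrix}0_d\\f_{\widehat v_i,\widehat R_i}(Y_i^b)\end{pmatrix},\qquad T^{b,Tay}=\sqrt N\big(n_1^{-1/2}Y_1^{b,Tay}-n_2^{-1/2}Y_2^{b,Tay}\big).$$ For $B$ replicates let $q_{\ell,\beta}$ be the empirical $(1-\beta)$-quantile of $T^{1,Tay}_\ell,\dots,T^{B,Tay}_\ell$,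 and let $\widetilde\beta$ be the largest $\beta\in\{0,\frac1B,\dots,\frac{B-1}B\}$ such that at most the fraction $\alpha$ of the replicates $b$ satisfies $T^{b,Tay}_\ell>q_{\ell,\beta}$ for at least one $\ell$. **Claim.** 1. Under $\mathcal H_0:V_1=V_2$, $T\xrightarrow{\mathcal D}\mathcal N_p(0,\Gamma)$. 2. The estimator $\widehat\Sigma_i=\frac1{n_i-1}\sum_{k}z_{ik}z_{ik}^\top$, with $z_{ik}=\operatorname{vech}\big(\widetilde X_{ik}\widetilde X_{ik}^\top-\frac1{n_i}\sum_\ell\widetilde X_{i\ell}\widetilde X_{i\ell}^\top\big)$ and $\widetilde X_{ik}=X_{ik}-\overline X_i$, is measurable, positive semidefinite and consistent for $\Sigma_i$. 3. For every $\widehat\Sigma_i$ as above and every $b$, $T^{b,Tay}\xrightarrow{\mathcal D}\mathcal N_p(0,\Gamma)$; moreover the conditional distribution of $T^{b,Tay}$ given the data converges weakly to $\mathcal N_p(0,\Gamma)$ in probability. 4. Suppose $\mathcal H_0$ holds and $\Gamma_{\ell\ell}>0$ for $\ell=1,\dots,p$. Then for every $\alpha\in(0,1)$, if $B\to\infty$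 together with the sample sizes (at any rate), the test that rejects iff $T_\ell>q_{\ell,\widetilde\beta}$ for at least one $\ell$ has rejection probability converging to $\alpha$. -/

import Mathlib

open MeasureTheory ProbabilityTheory Filter Matrix
open scoped Topology BoundedContinuousFunction

noncomputable section

namespace CombinedTest

/-- Index set of the half-vectorization of a `d × d` matrix (the pairs `j ≤ k`); it has
`p = d (d + 1) / 2` elements and labels the coordinates of `ℝ^p`. -/
abbrev HalfIdx (d : ℕ) : Type := {q : Fin d × Fin d // q.1 ≤ q.2}

/-- Index set of the upper-half-vectorization of a `d × d` matrix (the pairs `j < k`); it has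
`p_u = d (d - 1) / 2` elements and labels the coordinates of `ℝ^{p_u}`. -/
abbrev UpperIdx (d : ℕ) : Type := {q : Fin d × Fin d // q.1 < q.2}

/-- Index set of the stacked vector: `d` variances, then the `p_u` correlations
(`p` coordinates in total). -/
abbrev StackIdx (d : ℕ) : Type := Fin d ⊕ UpperIdx d

variable {d : ℕ}

/-! ### Vectorizations and auxiliary matrices -/

/-- Half-vectorization. -/
def vech (M : Matrix (Fin d) (Fin d) ℝ) : HalfIdx d → ℝ := fun l => M l.1.1 l.1.2

/-- Upper-half-vectorization, which leaves out the diagonal. -/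
def vechMinus (M : Matrix (Fin d) (Fin d) ℝ) : UpperIdx d → ℝ := fun l => M l.1.1 l.1.2

/-- The position `a_j` of the `j`-th diagonal entry in the half-vectorization. -/
def diagPos (j : Fin d) : HalfIdx d := ⟨(j, j), le_rfl⟩

/-- The position `b_l` of an off-diagonal entry in the half-vectorization. -/
def offPos (l : UpperIdx d) : HalfIdx d := ⟨l.1, l.2.le⟩

/-- The matrix with `L vech(M) = vechMinus(M)`. -/
def matL (d : ℕ) : Matrix (UpperIdx d) (HalfIdx d) ℝ :=
  Matrix.of fun l => Pi.single (offPos l) 1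

/-- The matrix `A = ∑_j e_j e_{a_j}ᵀ`, which selects the diagonal entries. -/
def matA (d : ℕ) : Matrix (Fin d) (HalfIdx d) ℝ :=
  Matrix.of fun j => Pi.single (diagPos j) 1

/-- The matrix `M₁`, whose row `(j, k)`, `j < k`, is `e_{a_k} + e_{a_j}`. -/
def matM1 (d : ℕ) : Matrix (UpperIdx d) (HalfIdx d) ℝ :=
  Matrix.of fun l => Pi.single (diagPos l.1.2) 1 + Pi.single (diagPos l.1.1) 1

/-- The matrix `M₄ = M₂ + M₃`, whose row `(j, k)`, `j ≤ k`, is `e_{a_j} + e_{a_k}`. -/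
def matM4 (d : ℕ) : Matrix (HalfIdx d) (HalfIdx d) ℝ :=
  Matrix.of fun l => Pi.single (diagPos l.1.1) 1 + Pi.single (diagPos l.1.2) 1

/-- The matrix `M₅ = diag(vech(I_d))`. -/
def matM5 (d : ℕ) : Matrix (HalfIdx d) (HalfIdx d) ℝ :=
  Matrix.diagonal (vech (1 : Matrix (Fin d) (Fin d) ℝ))

/-- `Λ(V) = diag(vech(w wᵀ))^{-1/2}` with `w = (V₁₁, …, V_dd)`. -/
def scaleMat (V : Matrix (Fin d) (Fin d) ℝ) : Matrix (HalfIdx d) (HalfIdx d) ℝ :=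
  Matrix.diagonal fun l => vech (Matrix.vecMulVec V.diag V.diag) l ^ (-(1 / 2) : ℝ)

/-- The correlation matrix that belongs to the covariance matrix `V`. -/
def corrMat (V : Matrix (Fin d) (Fin d) ℝ) : Matrix (Fin d) (Fin d) ℝ :=
  Matrix.of fun j k => V j k / (√(V j j) * √(V k k))

/-- The matrix `M(v, r) = [L - ½ diag(r) M₁] Λ` for `v = vech(V)` and `r` the vector of
correlations that belongs to `V`. -/
def matM (V : Matrix (Fin d) (Fin d) ℝ) : Matrix (UpperIdx d) (HalfIdx d) ℝ :=
  (matL d - (1 / 2 : ℝ) • (Matrix.diagonal (vechMinus (corrMat V)) * matM1 d)) * scaleMat V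

/-- The stacked matrix `(A; M(v, r))`. -/
def stackMat (V : Matrix (Fin d) (Fin d) ℝ) : Matrix (StackIdx d) (HalfIdx d) ℝ :=
  Matrix.fromRows (matA d) (matM V)

/-- The quadratic second-order Taylor term `f_{v, R}(x)`. -/
def taylorQuad (V : Matrix (Fin d) (Fin d) ℝ) (x : HalfIdx d → ℝ) : UpperIdx d → ℝ :=
  let u : HalfIdx d → ℝ := scaleMat V *ᵥ x
  let w : Fin d → ℝ := matA d *ᵥ u
  (1 / 4 : ℝ) • (matL d *ᵥ (Matrix.diagonal (vech (Matrix.vecMulVec w w)) *ᵥ vech (corrMat V)))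
    - (1 / 2 : ℝ) • (matL d *ᵥ (Matrix.diagonal u *ᵥ (matM4 d *ᵥ (matM5 d *ᵥ u))))
    + (3 / 8 : ℝ) •
      (Matrix.diagonal (vechMinus (corrMat V)) *ᵥ (matM1 d *ᵥ vech (Matrix.vecMulVec w w)))

/-- The stacked vector `(V₁₁, …, V_dd, r)` of variances and correlations. -/
def stackVec (V : Matrix (Fin d) (Fin d) ℝ) : EuclideanSpace ℝ (StackIdx d) :=
  WithLp.toLp 2 (Sum.elim (fun j => V j j) (vechMinus (corrMat V)))

/-! ### Population quantities -/

section Population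

variable {Ω : Type*} [MeasurableSpace Ω]

/-- The covariance matrix of a random vector. -/
def popCov (e : Ω → EuclideanSpace ℝ (Fin d)) (P : Measure Ω) : Matrix (Fin d) (Fin d) ℝ :=
  Matrix.of fun j k => cov[fun ω => e ω j, fun ω => e ω k; P]

/-- The covariance matrix of `vech(e eᵀ)`. -/
def popSigma (e : Ω → EuclideanSpace ℝ (Fin d)) (P : Measure Ω) :
    Matrix (HalfIdx d) (HalfIdx d) ℝ :=
  Matrix.of fun k l =>
    cov[fun ω => vech (Matrix.vecMulVec (e ω) (e ω)) k,
        fun ω => vech (Matrix.vecMulVec (e ω) (e ω)) l; P]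

/-- `Γ = ∑_i κ_i⁻¹ (A; M(v_i, r_i)) Σ_i (A; M(v_i, r_i))ᵀ`, where `e i` has the distribution of
the residuals of group `i`. -/
def limitCov (κ : Fin 2 → ℝ) (e : Fin 2 → Ω → EuclideanSpace ℝ (Fin d)) (P : Measure Ω) :
    Matrix (StackIdx d) (StackIdx d) ℝ :=
  ∑ i, (κ i)⁻¹ • (stackMat (popCov (e i) P) * popSigma (e i) P * (stackMat (popCov (e i) P))ᵀ)

end Population

/-! ### Empirical quantities -/

section Empirical

/-- The centred observations `x_k - x̄`. -/
def centred {m : ℕ} (x : Fin m → EuclideanSpace ℝ (Fin d)) (k : Fin m) :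
    EuclideanSpace ℝ (Fin d) :=
  x k - (m : ℝ)⁻¹ • ∑ l, x l

/-- The empirical covariance matrix of a sample. -/
def empCov {m : ℕ} (x : Fin m → EuclideanSpace ℝ (Fin d)) : Matrix (Fin d) (Fin d) ℝ :=
  ((m : ℝ) - 1)⁻¹ • ∑ k, Matrix.vecMulVec (centred x k) (centred x k)

/-- The estimator of `Cov(vech(e eᵀ))`: the empirical covariance matrix of the vectors
`vech((x_k - x̄) (x_k - x̄)ᵀ)`. -/
def empSigma (m : ℕ) (x : Fin m → EuclideanSpace ℝ (Fin d)) :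
    Matrix (HalfIdx d) (HalfIdx d) ℝ :=
  let z : Fin m → Matrix (Fin d) (Fin d) ℝ := fun k =>
    Matrix.vecMulVec (centred x k) (centred x k)
      - (m : ℝ)⁻¹ • ∑ l, Matrix.vecMulVec (centred x l) (centred x l)
  ((m : ℝ) - 1)⁻¹ • ∑ k, Matrix.vecMulVec (vech (z k)) (vech (z k))

/-- `Shat` (with `Shat m` applied to the first `m` observations of `X`) is a consistent
covariance matrix estimator of `S`. -/
structure IsConsistentCovEstimator {Ω : Type*} [MeasurableSpace Ω] (P : Measure Ω)
    (X : ℕ → Ω → EuclideanSpace ℝ (Fin d)) (S : Matrix (HalfIdx d) (HalfIdx d) ℝ)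
    (Shat : (m : ℕ) → (Fin m → EuclideanSpace ℝ (Fin d)) →
      Matrix (HalfIdx d) (HalfIdx d) ℝ) : Prop where
  measurable : ∀ m k l, Measurable fun x => Shat m x k l
  posSemidef : ∀ m x, (Shat m x).PosSemidef
  consistent : ∀ k l, TendstoInMeasure P
    (fun m ω => Shat m (fun j : Fin m => X j ω) k l) atTop (fun _ => S k l)

/-- The samples of both groups, with `n i` observations in group `i`. -/
abbrev Sample (d : ℕ) (n : Fin 2 → ℕ) : Type :=
  (i : Fin 2) → Fin (n i) → EuclideanSpace ℝ (Fin d)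

/-- The samples at sample sizes `n`, as a function on the probability space. -/
def sampleOf {Ω : Type*} (X : Fin 2 → ℕ → Ω → EuclideanSpace ℝ (Fin d)) (n : Fin 2 → ℕ) (ω : Ω) :
    Sample d n :=
  fun i k => X i k ω

/-- The statistic `T = √N ((V̂_{1jj}, r̂₁) - (V̂_{2jj}, r̂₂))`, `N = n₁ + n₂`. -/
def statT {n : Fin 2 → ℕ} (x : Sample d n) : EuclideanSpace ℝ (StackIdx d) :=
  √((n 0 + n 1 : ℕ) : ℝ) • (stackVec (empCov (x 0)) - stackVec (empCov (x 1)))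

/-- The transform
`Y^{Tay} = (A; M(v̂, r̂)) Y + m^{-1/2} (0; f_{v̂, R̂}(Y))` of a vector `Y ∈ ℝ^p`. -/
def taylorTransform {m : ℕ} (x : Fin m → EuclideanSpace ℝ (Fin d))
    (y : EuclideanSpace ℝ (HalfIdx d)) : EuclideanSpace ℝ (StackIdx d) :=
  WithLp.toLp 2 (stackMat (empCov x) *ᵥ y
    + (√(m : ℝ))⁻¹ • Sum.elim (0 : Fin d → ℝ) (taylorQuad (empCov x) y))

/-- The replicate `T^{Tay} = √N (n₁^{-1/2} Y₁^{Tay} - n₂^{-1/2} Y₂^{Tay})`. -/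
def taylorT {n : Fin 2 → ℕ} (x : Sample d n) (y : Fin 2 → EuclideanSpace ℝ (HalfIdx d)) :
    EuclideanSpace ℝ (StackIdx d) :=
  √((n 0 + n 1 : ℕ) : ℝ) •
    ((√(n 0 : ℝ))⁻¹ • taylorTransform (x 0) (y 0) - (√(n 1 : ℝ))⁻¹ • taylorTransform (x 1) (y 1))

end Empirical

/-! ### The multiple contrast test -/

section ContrastTest

variable {ι : Type*} {B : ℕ}

/-- The empirical `u`-quantile of `x₁, …, x_B`: the least `q` such that at least the fraction `u`
of the values is at most `q`. -/
def empQuantile (x : Fin B → ℝ) (u : ℝ) : ℝ :=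
  sInf {q : ℝ | u ≤ (Nat.card {b : Fin B // x b ≤ q} : ℝ) / B}

/-- `q_{ℓ, β}`: the empirical `(1 - β)`-quantile of the `ℓ`-th coordinates of the replicates. -/
def critValue (t : Fin B → EuclideanSpace ℝ ι) (β : ℝ) (l : ι) : ℝ :=
  empQuantile (fun b => t b l) (1 - β)

/-- The fraction of replicates that exceed `q_{ℓ, β}` in at least one coordinate `ℓ`. -/
def familywiseRate (t : Fin B → EuclideanSpace ℝ ι) (β : ℝ) : ℝ :=
  (Nat.card {b : Fin B // ∃ l, critValue t β l < t b l} : ℝ) / B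

/-- `β̃`: the largest `β` in `{0, 1/B, …, (B-1)/B}` with familywise rate at most `α`. -/
def localLevel (t : Fin B → EuclideanSpace ℝ ι) (α : ℝ) : ℝ :=
  sSup {β : ℝ | (∃ k : ℕ, k < B ∧ β = (k : ℝ) / B) ∧ familywiseRate t β ≤ α}

/-- The test at level `α` with statistic `s` and replicates `t` rejects. -/
def Rejects (t : Fin B → EuclideanSpace ℝ ι) (α : ℝ) (s : EuclideanSpace ℝ ι) : Prop :=
  ∃ l, critValue t (localLevel t α) l < s l

end ContrastTest

/-! ### Monte-Carlo vectors -/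

/-- Conditionally on the sample of sizes `n`, the vectors `Y b i` (replicate `b`, group `i`) are
independent, and `Y b i` has the distribution `N(0, Shat i)` with `Shat i` computed from the
sample of group `i`. -/
def IsMonteCarlo {Ω : Type*} [MeasurableSpace Ω] (P : Measure Ω) [IsFiniteMeasure P]
    (X : Fin 2 → ℕ → Ω → EuclideanSpace ℝ (Fin d)) (n : Fin 2 → ℕ)
    (Shat : Fin 2 → (m : ℕ) → (Fin m → EuclideanSpace ℝ (Fin d)) →
      Matrix (HalfIdx d) (HalfIdx d) ℝ)
    (Y : ℕ → Fin 2 → Ω → EuclideanSpace ℝ (HalfIdx d)) : Prop :=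
  (∀ b i, Measurable (Y b i)) ∧
  ∀ B : ℕ, ∀ᵐ ω ∂P,
    condDistrib (fun ω' (q : Fin B × Fin 2) => Y q.1 q.2 ω') (sampleOf X n) P (sampleOf X n ω) =
      Measure.pi fun q : Fin B × Fin 2 =>
        multivariateGaussian 0 (Shat q.2 (n q.2) (sampleOf X n ω q.2))

end CombinedTest

end

/-! The statistic and the replicates have the same Gaussian limit, and the critical values converge
in probability to constants determined by that limit. Hence neither the dependence between the
statistic and its critical values nor the rate of `B` matters.

Statistic. The scaled error of the empirical covariance matrix is an exact continuous function of
normalized sums of `ε` and `vech(ε εᵀ)` (`sqrt_smul_vech_empCov_sub`). The central limit theorem,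
Slutsky's lemma and the delta method with derivative `(A; M(v, r))` (`hasFDerivAt_stackFun`) give
the limit for one group. The groups are independent, so characteristic functions multiply to that of
`N(0, Γ)` (`charFun_limitCov`). The null hypothesis serves only to cancel the two centrings.

Replicates. Given the data, a replicate has the law `replicateLaw θ` at a finite-dimensional
parameter `θ` that is computed from the data and converges in probability. The law is continuous in
`θ` on the positive semidefinite parameters (`tendsto_replicateLaw`). In the limit the quadratic
Taylor term has weight `0`, and what remains is linear with law `N(0, Γ)`. Continuous mapping yields
the conditional convergence, and integrating it the unconditional one.

Test. Given the data, the replicates are independent and identically distributed, so the fraction of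
them in a fixed set has a mean squared error of at most `1/B` plus a squared bias that depends on
the data alone (`integral_sq_freq_sub_le`). It therefore converges to the Gaussian mass of the set.
Let `s₀` solve `P(∃ l, Z_l > √Γ_ll s₀) = α` for `Z ∼ N(0, Γ)`. The deterministic bounds
`critValue_localLevel_le` and `le_critValue_localLevel` trap the critical values between `√Γ_ll s₂`
and `√Γ_ll s₁` for all `s₂ < s₀ < s₁`. The crossing at `s₀` is strict even for singular `Γ`
(`cdf_maxRatio_lt`), and the rejection probability is squeezed to `α`. -/

namespace CombinedTest

/-! ### Convergence in measure to a constant. -/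

section ConvergenceInMeasure

variable {Ω ι : Type*} [MeasurableSpace Ω] {P : Measure Ω} {l : Filter ι}

/-- Continuous mapping for convergence in measure to a constant, relative to a set. -/
theorem tendstoInMeasure_comp_of_tendsto_nhdsWithin {E F : Type*} [PseudoEMetricSpace E]
    [PseudoEMetricSpace F] {X : ι → Ω → E} {c : E} {K : Set E} {f : E → F} {y : F}
    (hX : TendstoInMeasure P X l (fun _ => c)) (hK : ∀ i ω, X i ω ∈ K)
    (hf : Tendsto f (𝓝[K] c) (𝓝 y)) :
    TendstoInMeasure P (fun i ω => f (X i ω)) l (fun _ => y) := by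
  intro ε hε
  have h1 : f ⁻¹' Metric.eball y ε ∈ 𝓝[K] c := hf (Metric.eball_mem_nhds y hε)
  obtain ⟨δ, hδ, hsub⟩ := EMetric.mem_nhdsWithin_iff.1 h1
  refine tendsto_of_tendsto_of_tendsto_of_le_of_le tendsto_const_nhds (hX δ hδ)
    (fun _ => zero_le) fun i => measure_mono fun ω hω => ?_
  rw [Set.mem_ofPred_eq] at hω ⊢
  by_contra hlt
  have : f (X i ω) ∈ Metric.eball y ε :=
    hsub ⟨Metric.mem_eball.2 (not_le.1 hlt), hK i ω⟩
  exact (not_lt.2 hω) (Metric.mem_eball.1 this)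

theorem tendstoInMeasure_comp_of_continuousAt {E F : Type*} [PseudoEMetricSpace E]
    [PseudoEMetricSpace F] {X : ι → Ω → E} {c : E} {f : E → F}
    (hX : TendstoInMeasure P X l (fun _ => c)) (hf : ContinuousAt f c) :
    TendstoInMeasure P (fun i ω => f (X i ω)) l (fun _ => f c) :=
  tendstoInMeasure_comp_of_tendsto_nhdsWithin (K := Set.univ) hX (fun _ _ => Set.mem_univ _)
    (by rwa [nhdsWithin_univ])

theorem tendstoInMeasure_pi {κ : Type*} [Fintype κ] {E : κ → Type*}
    [∀ k, PseudoEMetricSpace (E k)] {X : ι → Ω → ∀ k, E k} {c : Ω → ∀ k, E k}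
    (h : ∀ k, TendstoInMeasure P (fun i ω => X i ω k) l (fun ω => c ω k)) :
    TendstoInMeasure P X l c := by
  intro ε hε
  have h0 : Tendsto (fun i => ∑ k, P {ω | ε ≤ edist (X i ω k) (c ω k)}) l (𝓝 0) := by
    simpa using tendsto_finsetSum Finset.univ fun k _ => h k ε hε
  refine tendsto_of_tendsto_of_tendsto_of_le_of_le tendsto_const_nhds h0
    (fun _ => zero_le) fun i => ?_
  refine (measure_mono fun ω hω => ?_).trans (measure_iUnion_fintype_le P _)
  by_contra hcon
  simp only [Set.mem_iUnion, Set.mem_ofPred_eq, not_exists, not_le] at hcon hω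
  refine (not_lt.2 hω) ?_
  rw [edist_pi_def]
  exact (Finset.sup_lt_iff hε).2 fun k _ => hcon k

theorem tendstoInMeasure_prodMk {E F : Type*} [PseudoEMetricSpace E] [PseudoEMetricSpace F]
    {X : ι → Ω → E} {Y : ι → Ω → F} {x : Ω → E} {y : Ω → F}
    (hX : TendstoInMeasure P X l x) (hY : TendstoInMeasure P Y l y) :
    TendstoInMeasure P (fun i ω => (X i ω, Y i ω)) l (fun ω => (x ω, y ω)) := by
  intro ε hε
  have h0 := (hX ε hε).add (hY ε hε)
  rw [add_zero] at h0
  refine tendsto_of_tendsto_of_tendsto_of_le_of_le tendsto_const_nhds h0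
    (fun _ => zero_le) fun i => ?_
  refine (measure_mono fun ω hω => ?_).trans (measure_union_le _ _)
  rcases le_max_iff.1 (show ε ≤ max _ _ from hω) with h | h
  exacts [Or.inl h, Or.inr h]

theorem tendstoInMeasure_of_tendsto {E : Type*} [PseudoEMetricSpace E] {a : ι → E} {c : E}
    (h : Tendsto a l (𝓝 c)) :
    TendstoInMeasure P (fun i _ => a i) l (fun _ => c) := by
  intro ε hε
  refine tendsto_const_nhds.congr' ?_
  filter_upwards [h (Metric.eball_mem_nhds c hε)] with i hi
  have : {ω : Ω | ε ≤ edist (a i) c} = ∅ := by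
    ext ω
    simpa using hi
  simp [this]

/-- Every subsequence has a further subsequence that converges almost everywhere, and dominated
convergence applies to it. -/
theorem tendsto_integral_of_tendstoInMeasure_of_bounded [IsProbabilityMeasure P]
    {X : ℕ → Ω → ℝ} {c C : ℝ} (hm : ∀ t, AEStronglyMeasurable (X t) P)
    (hb : ∀ t ω, |X t ω| ≤ C) (h : TendstoInMeasure P X atTop (fun _ => c)) :
    Tendsto (fun t => ∫ ω, X t ω ∂P) atTop (𝓝 c) := by
  refine tendsto_of_subseq_tendsto fun ns hns => ?_
  obtain ⟨ms, _, hms⟩ := (h.comp hns).exists_seq_tendsto_ae'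
  refine ⟨ms, ?_⟩
  have := tendsto_integral_of_dominated_convergence (μ := P) (F := fun i => X (ns (ms i)))
    (f := fun _ => c) (fun _ => C) (fun i => hm _) (integrable_const C)
    (fun i => ae_of_all _ fun ω => by simpa using hb _ ω) hms
  simpa using this

end ConvergenceInMeasure

/-! ### Matrix square roots and linear images of Gaussian vectors. -/

section GaussianGeneral

variable {ι : Type*} [Fintype ι] [DecidableEq ι]

open scoped MatrixOrder Matrix.Norms.L2Operator in
/-- The square root is continuous on positive semidefinite matrices. -/
theorem tendsto_matrix_sqrt {α : Type*} {l : Filter α} {S : α → Matrix ι ι ℝ}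
    {S₀ : Matrix ι ι ℝ} (h : Tendsto S l (𝓝 S₀)) (hS : ∀ᶠ a in l, (S a).PosSemidef)
    (hS₀ : S₀.PosSemidef) :
    Tendsto (fun a => CFC.sqrt (S a)) l (𝓝 (CFC.sqrt S₀)) := by
  have key : ∀ A : Matrix ι ι ℝ, A.PosSemidef → CFC.sqrt A = cfc Real.sqrt A := fun A hA => by
    rw [CFC.sqrt_eq_real_sqrt A hA.nonneg, cfcₙ_eq_cfc]
  -- Continuity of the functional calculus needs one compact set that contains the spectra of all
  -- matrices close to `S₀`.
  have hbound : ∀ A : Matrix ι ι ℝ, A.PosSemidef → ‖A‖ ≤ ‖S₀‖ + 1 →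
      spectrum ℝ A ⊆ Set.Icc 0 (‖S₀‖ + 1) := fun A hA hle x hx => by
    refine ⟨spectrum_nonneg_of_nonneg hA.nonneg hx, ?_⟩
    rcases isEmpty_or_nonempty ι with hι | hι
    · have : spectrum ℝ A = ∅ := spectrum.of_subsingleton A
      rw [this] at hx; simp at hx
    · exact (le_abs_self x).trans ((spectrum.norm_le_norm_of_mem hx).trans hle)
  have hev : ∀ᶠ a in l, ‖S a‖ ≤ ‖S₀‖ + 1 :=
    (h.norm.eventually_lt_const (lt_add_one _)).mono fun _ ha => ha.le
  have := Filter.Tendsto.cfc (s := Set.Icc 0 (‖S₀‖ + 1)) isCompact_Icc Real.sqrt h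
    ((hS.and hev).mono fun a ha => hbound _ ha.1 ha.2)
    (hS.mono fun a ha => ha.isHermitian.isSelfAdjoint) (hbound S₀ hS₀ (by linarith))
    hS₀.isHermitian.isSelfAdjoint Real.continuous_sqrt.continuousOn
  rw [key S₀ hS₀]
  exact this.congr' (hS.mono fun a ha => (key _ ha).symm)

/-- Since `⟨t, M y⟩ = ⟨Mᵀ t, y⟩`, the matrix moves into the argument of the characteristic function.
`M` may be rectangular and of any rank. -/
theorem charFun_map_mulVec_multivariateGaussian {κ : Type*} [Fintype κ] {S : Matrix ι ι ℝ}
    (hS : S.PosSemidef) (M : Matrix κ ι ℝ) (t : EuclideanSpace ℝ κ) :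
    charFun ((multivariateGaussian 0 S).map
      (fun y : EuclideanSpace ℝ ι => (WithLp.toLp 2 (M *ᵥ y) : EuclideanSpace ℝ κ))) t
      = Complex.exp (-((t.ofLp ⬝ᵥ (M * S * Mᵀ) *ᵥ t.ofLp : ℝ) : ℂ) / 2) := by
  have hm : Continuous fun y : EuclideanSpace ℝ ι =>
      (WithLp.toLp 2 (M *ᵥ y) : EuclideanSpace ℝ κ) := by
    refine (PiLp.continuous_toLp 2 _).comp ?_
    exact Continuous.matrix_mulVec continuous_const (PiLp.continuous_ofLp 2 _)
  have h1 : charFun ((multivariateGaussian 0 S).map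
      (fun y : EuclideanSpace ℝ ι => (WithLp.toLp 2 (M *ᵥ y) : EuclideanSpace ℝ κ))) t
      = charFun (multivariateGaussian 0 S) (WithLp.toLp 2 (Mᵀ *ᵥ t.ofLp)) := by
    rw [charFun_apply, charFun_apply, integral_map hm.aemeasurable (by fun_prop)]
    congr 1
    ext y
    congr 3
    simp only [EuclideanSpace.inner_eq_star_dotProduct, star_trivial]
    rw [Matrix.dotProduct_mulVec, ← Matrix.mulVec_transpose]
  rw [h1, charFun_multivariateGaussian hS]
  congr 1
  rw [inner_zero_right, ← Matrix.mulVec_mulVec, ← Matrix.mulVec_mulVec,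
    Matrix.dotProduct_mulVec _ M,
    ← Matrix.mulVec_transpose]
  push_cast
  ring

end GaussianGeneral

/-! ### The multivariate central limit theorem. -/

section CLT

variable {Ω ι : Type*} [MeasurableSpace Ω] {P : Measure Ω} [IsProbabilityMeasure P]
  [Fintype ι]

/-- By bilinearity of the covariance the quadratic form at `t` is the variance of a linear
combination, which cannot be negative. -/
theorem posSemidef_of_eq_cov {W : Ω → ι → ℝ} (hWj : ∀ j, MemLp (fun ω => W ω j) 2 P)
    {C : Matrix ι ι ℝ}
    (hC : ∀ j k, C j k = cov[fun ω => W ω j, fun ω => W ω k; P]) :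
    C.PosSemidef ∧ ∀ t : ι → ℝ, t ⬝ᵥ C *ᵥ t = Var[fun ω => ∑ j, t j * W ω j; P] := by
  have hvar : ∀ t : ι → ℝ, t ⬝ᵥ C *ᵥ t = Var[fun ω => ∑ j, t j * W ω j; P] := fun t => by
    rw [← covariance_self (Finset.aemeasurable_fun_sum _ fun j _ =>
      ((hWj j).aestronglyMeasurable.aemeasurable.const_mul _)),
      covariance_fun_sum_fun_sum (fun j => (hWj j).const_mul _) (fun j => (hWj j).const_mul _)]
    simp only [dotProduct, mulVec, covariance_const_mul_left, covariance_const_mul_right, hC,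
      Finset.mul_sum]
    exact Finset.sum_congr rfl fun j _ => Finset.sum_congr rfl fun k _ => by ring
  refine ⟨?_, hvar⟩
  refine Matrix.PosSemidef.of_dotProduct_mulVec_nonneg ?_ fun t => ?_
  · ext j k
    simp [hC, covariance_comm]
  · rw [star_trivial, hvar]
    exact variance_nonneg _ _

/-- The multivariate central limit theorem. -/
theorem tendstoInDistribution_clt_euclidean [DecidableEq ι] {W : ℕ → Ω → EuclideanSpace ℝ ι}
    (hWj : ∀ j, MemLp (fun ω => W 0 ω j) 2 P) (hindep : iIndepFun W P)
    (hident : ∀ k, IdentDistrib (W k) (W 0) P P)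
    {C : Matrix ι ι ℝ} (hC : ∀ j k, C j k = cov[fun ω => W 0 ω j, fun ω => W 0 ω k; P])
    {w : EuclideanSpace ℝ ι} (hw : ∀ j, w j = ∫ ω, W 0 ω j ∂P) :
    TendstoInDistribution
      (fun (n : ℕ) ω => (√n)⁻¹ • ∑ k ∈ Finset.range n, (W k ω - w)) atTop
      (id : EuclideanSpace ℝ ι → _) (fun _ => P) (multivariateGaussian 0 C) := by
  obtain ⟨hpsd, hvar⟩ := posSemidef_of_eq_cov hWj hC
  have hWm : ∀ k, AEMeasurable (W k) P := fun k => (hident k).aemeasurable_fst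
  have hSm : ∀ n : ℕ, AEMeasurable
      (fun ω => (√n)⁻¹ • ∑ k ∈ Finset.range n, (W k ω - w)) P := fun n =>
    (Finset.aemeasurable_fun_sum (Finset.range n) fun k _ =>
      (hWm k).sub_const w).const_smul ((√n)⁻¹)
  refine ⟨hSm, aemeasurable_id, ?_⟩
  refine ProbabilityMeasure.tendsto_iff_tendsto_charFun.2 fun t => ?_
  -- Cramér–Wold: the characteristic function of a vector at `t` is that of its projection `u` at
  -- `1`, so the one-dimensional theorem suffices.
  set u : EuclideanSpace ℝ ι → ℝ := fun x => ∑ j, t j * x j with hu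
  have hum : Measurable u := by fun_prop
  have huW : MemLp (fun ω => u (W 0 ω)) 2 P :=
    memLp_finsetSum _ fun j _ => (hWj j).const_mul (t j)
  have hclt := tendstoInDistribution_inv_sqrt_mul_sum_sub (P := P)
    (P' := gaussianReal 0 Var[fun ω => u (W 0 ω); P].toNNReal) (Y := id)
    (X := fun k ω => u (W k ω)) HasLaw.id huW (hindep.comp (fun _ => u) fun _ => hum)
    (fun k => (hident k).comp hum)
  have hch := ProbabilityMeasure.tendsto_iff_tendsto_charFun.1 hclt.tendsto 1
  have hlim : charFun ((multivariateGaussian 0 C).map id) t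
      = charFun ((gaussianReal 0 Var[fun ω => u (W 0 ω); P].toNNReal).map id) 1 := by
    rw [Measure.map_id, Measure.map_id, charFun_multivariateGaussian hpsd, charFun_gaussianReal,
      hvar t.ofLp, Real.coe_toNNReal _ (variance_nonneg _ _)]
    simp [hu]
  have hmean : P[fun ω => u (W 0 ω)] = u w := by
    simp only [hu]
    rw [integral_finsetSum _ fun j _ => ((hWj j).integrable (by norm_num)).const_mul (t j)]
    simp [integral_const_mul, hw]
  have hseq : ∀ n : ℕ, charFun (P.map fun ω =>
        (√n)⁻¹ • ∑ k ∈ Finset.range n, (W k ω - w)) t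
      = charFun (P.map fun ω => (√n)⁻¹ * (∑ k ∈ Finset.range n, u (W k ω)
        - n * P[fun ω => u (W 0 ω)])) 1 := fun n => by
    rw [charFun_apply, charFun_apply, integral_map (hSm n) (by fun_prop),
      integral_map (hclt.forall_aemeasurable n) (by fun_prop)]
    congr 1
    ext ω
    congr 3
    rw [hmean]
    simp only [EuclideanSpace.inner_eq_star_dotProduct, star_trivial]
    simp [hu, dotProduct, Finset.mul_sum, Finset.sum_apply, mul_sub]
    rw [Finset.sum_comm]
    congr 1
    · exact Finset.sum_congr rfl fun k _ => Finset.sum_congr rfl fun j _ => by ring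
    · exact Finset.sum_congr rfl fun j _ => by ring
  simp only [ProbabilityMeasure.coe_mk] at hch ⊢
  rw [hlim]
  simp_rw [hseq]
  exact hch

end CLT

end CombinedTest

namespace CombinedTest

/-! ### Coordinate formulas, continuity, measurability and the derivative of the correlation map. -/

section MatrixFormulas

variable {d : ℕ}

theorem scaleMat_mulVec (V : Matrix (Fin d) (Fin d) ℝ) (x : HalfIdx d → ℝ) (l : HalfIdx d) :
    (scaleMat V *ᵥ x) l = (V l.1.1 l.1.1 * V l.1.2 l.1.2) ^ (-(1 / 2) : ℝ) * x l := by
  simp [scaleMat, Matrix.mulVec_diagonal, vech, Matrix.vecMulVec_apply]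

theorem matA_mulVec (x : HalfIdx d → ℝ) (j : Fin d) : (matA d *ᵥ x) j = x (diagPos j) := by
  simp [matA, Matrix.mulVec]

theorem matL_mulVec (x : HalfIdx d → ℝ) (l : UpperIdx d) : (matL d *ᵥ x) l = x (offPos l) := by
  simp [matL, Matrix.mulVec]

theorem matM1_mulVec (x : HalfIdx d → ℝ) (l : UpperIdx d) :
    (matM1 d *ᵥ x) l = x (diagPos l.1.2) + x (diagPos l.1.1) := by
  change (Pi.single _ 1 + Pi.single _ 1) ⬝ᵥ x = _
  simp [add_dotProduct]

theorem matM4_mulVec (x : HalfIdx d → ℝ) (l : HalfIdx d) :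
    (matM4 d *ᵥ x) l = x (diagPos l.1.1) + x (diagPos l.1.2) := by
  change (Pi.single _ 1 + Pi.single _ 1) ⬝ᵥ x = _
  simp [add_dotProduct]

theorem matM5_mulVec_diagPos (x : HalfIdx d → ℝ) (j : Fin d) :
    (matM5 d *ᵥ x) (diagPos j) = x (diagPos j) := by
  simp [matM5, Matrix.mulVec_diagonal, vech, diagPos]

theorem matM_mulVec (V : Matrix (Fin d) (Fin d) ℝ) (x : HalfIdx d → ℝ) (l : UpperIdx d) :
    (matM V *ᵥ x) l = (scaleMat V *ᵥ x) (offPos l) - 1 / 2 * (corrMat V l.1.1 l.1.2 *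
      ((scaleMat V *ᵥ x) (diagPos l.1.2) + (scaleMat V *ᵥ x) (diagPos l.1.1))) := by
  rw [matM, ← Matrix.mulVec_mulVec, Matrix.sub_mulVec, Matrix.smul_mulVec, ← Matrix.mulVec_mulVec,
    Pi.sub_apply, Pi.smul_apply, matL_mulVec, Matrix.mulVec_diagonal, matM1_mulVec, smul_eq_mul,
    vechMinus]

theorem stackMat_mulVec_inl (V : Matrix (Fin d) (Fin d) ℝ) (x : HalfIdx d → ℝ) (j : Fin d) :
    (stackMat V *ᵥ x) (Sum.inl j) = x (diagPos j) := by
  rw [stackMat, Matrix.fromRows_mulVec, Sum.elim_inl, matA_mulVec]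

theorem stackMat_mulVec_inr (V : Matrix (Fin d) (Fin d) ℝ) (x : HalfIdx d → ℝ) (l : UpperIdx d) :
    (stackMat V *ᵥ x) (Sum.inr l) = (matM V *ᵥ x) l := by
  rw [stackMat, Matrix.fromRows_mulVec, Sum.elim_inr]

theorem taylorQuad_apply (V : Matrix (Fin d) (Fin d) ℝ) (x : HalfIdx d → ℝ) (l : UpperIdx d) :
    taylorQuad V x l =
      1 / 4 * ((scaleMat V *ᵥ x) (diagPos l.1.1) * (scaleMat V *ᵥ x) (diagPos l.1.2) *
          corrMat V l.1.1 l.1.2)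
        - 1 / 2 * ((scaleMat V *ᵥ x) (offPos l) *
          ((scaleMat V *ᵥ x) (diagPos l.1.1) + (scaleMat V *ᵥ x) (diagPos l.1.2)))
        + 3 / 8 * (corrMat V l.1.1 l.1.2 *
          ((scaleMat V *ᵥ x) (diagPos l.1.2) * (scaleMat V *ᵥ x) (diagPos l.1.2) +
            (scaleMat V *ᵥ x) (diagPos l.1.1) * (scaleMat V *ᵥ x) (diagPos l.1.1))) := by
  simp only [taylorQuad, Pi.add_apply, Pi.sub_apply, Pi.smul_apply, smul_eq_mul, matL_mulVec,
    Matrix.mulVec_diagonal, matM1_mulVec, matM4_mulVec, matM5_mulVec_diagPos, vech, vechMinus,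
    Matrix.vecMulVec_apply, matA_mulVec]
  rfl

/-- The second-order transform of a vector `y`, as a function of the covariance matrix `V` and of
the weight `c` of the quadratic term. -/
noncomputable def taylorMap (V : Matrix (Fin d) (Fin d) ℝ) (c : ℝ) (y : HalfIdx d → ℝ) :
    EuclideanSpace ℝ (StackIdx d) :=
  WithLp.toLp 2 (stackMat V *ᵥ y + c • Sum.elim (0 : Fin d → ℝ) (taylorQuad V y))

theorem taylorMap_zero (V : Matrix (Fin d) (Fin d) ℝ) (y : HalfIdx d → ℝ) :
    taylorMap V 0 y = WithLp.toLp 2 (stackMat V *ᵥ y) := by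
  simp [taylorMap]

theorem tendsto_corrMat {α : Type*} {f : Filter α} {V : α → Matrix (Fin d) (Fin d) ℝ}
    {V₀ : Matrix (Fin d) (Fin d) ℝ} (hV : Tendsto V f (𝓝 V₀)) (hpos : ∀ j, 0 < V₀ j j)
    (j k : Fin d) : Tendsto (fun a => corrMat (V a) j k) f (𝓝 (corrMat V₀ j k)) := by
  have hjk : ∀ j k, Tendsto (fun a => V a j k) f (𝓝 (V₀ j k)) := fun j k =>
    tendsto_pi_nhds.1 (tendsto_pi_nhds.1 hV j) k
  refine (hjk j k).div ((hjk j j).sqrt.mul (hjk k k).sqrt) ?_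
  exact (mul_pos (Real.sqrt_pos.2 (hpos j)) (Real.sqrt_pos.2 (hpos k))).ne'

theorem tendsto_scaleMat_mulVec {α : Type*} {f : Filter α} {V : α → Matrix (Fin d) (Fin d) ℝ}
    {V₀ : Matrix (Fin d) (Fin d) ℝ} (hV : Tendsto V f (𝓝 V₀)) (hpos : ∀ j, 0 < V₀ j j)
    {y : α → HalfIdx d → ℝ} {y₀ : HalfIdx d → ℝ} (hy : Tendsto y f (𝓝 y₀)) (l : HalfIdx d) :
    Tendsto (fun a => (scaleMat (V a) *ᵥ y a) l) f (𝓝 ((scaleMat V₀ *ᵥ y₀) l)) := by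
  have hjk : ∀ j k, Tendsto (fun a => V a j k) f (𝓝 (V₀ j k)) := fun j k =>
    tendsto_pi_nhds.1 (tendsto_pi_nhds.1 hV j) k
  simp only [scaleMat_mulVec]
  exact (((hjk _ _).mul (hjk _ _)).rpow_const
    (Or.inl (mul_pos (hpos _) (hpos _)).ne')).mul (tendsto_pi_nhds.1 hy l)

/-- Each coordinate is built from standardized entries and correlations, which are continuous where
the diagonal is positive. With `c₀ = 0` this removes the quadratic term in the limit. -/
theorem tendsto_taylorMap {α : Type*} {f : Filter α} {V : α → Matrix (Fin d) (Fin d) ℝ}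
    {V₀ : Matrix (Fin d) (Fin d) ℝ} (hV : Tendsto V f (𝓝 V₀)) (hpos : ∀ j, 0 < V₀ j j)
    {c : α → ℝ} {c₀ : ℝ} (hc : Tendsto c f (𝓝 c₀))
    {y : α → HalfIdx d → ℝ} {y₀ : HalfIdx d → ℝ} (hy : Tendsto y f (𝓝 y₀)) :
    Tendsto (fun a => taylorMap (V a) (c a) (y a)) f (𝓝 (taylorMap V₀ c₀ y₀)) := by
  refine ((PiLp.continuous_toLp 2 _).tendsto _).comp (tendsto_pi_nhds.2 fun r => ?_)
  have hs := tendsto_scaleMat_mulVec hV hpos hy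
  have hr := tendsto_corrMat hV hpos
  rcases r with j | l
  · simp only [Pi.add_apply, Pi.smul_apply, stackMat_mulVec_inl, Sum.elim_inl, Pi.zero_apply,
      smul_zero, add_zero]
    exact tendsto_pi_nhds.1 hy _
  · simp only [Pi.add_apply, Pi.smul_apply, stackMat_mulVec_inr, matM_mulVec, Sum.elim_inr,
      smul_eq_mul, taylorQuad_apply]
    exact ((hs _).sub (((hr _ _).mul ((hs _).add (hs _))).const_mul _)).add
      (hc.mul ((((((hs _).mul (hs _)).mul (hr _ _)).const_mul _).sub
        (((hs _).mul ((hs _).add (hs _))).const_mul _)).add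
        (((hr _ _).mul (((hs _).mul (hs _)).add ((hs _).mul (hs _)))).const_mul _)))

theorem measurable_taylorMap {α : Type*} [MeasurableSpace α] {V : α → Matrix (Fin d) (Fin d) ℝ}
    (hV : ∀ j k, Measurable fun a => V a j k) (c : ℝ)
    {y : α → HalfIdx d → ℝ} (hy : Measurable y) :
    Measurable fun a => taylorMap (V a) c (y a) := by
  have hs : ∀ l, Measurable fun a => (scaleMat (V a) *ᵥ y a) l := fun l => by
    simp only [scaleMat_mulVec]
    exact (((hV _ _).mul (hV _ _)).pow_const _).mul (hy.eval)
  have hr : ∀ j k, Measurable fun a => corrMat (V a) j k := fun j k =>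
    (hV j k).div ((hV j j).sqrt.mul (hV k k).sqrt)
  refine (WithLp.measurable_toLp 2 _).comp (measurable_pi_iff.2 fun r => ?_)
  rcases r with j | l
  · simp only [Pi.add_apply, Pi.smul_apply, stackMat_mulVec_inl, Sum.elim_inl, Pi.zero_apply,
      smul_zero, add_zero]
    exact hy.eval
  · simp only [Pi.add_apply, Pi.smul_apply, stackMat_mulVec_inr, matM_mulVec, Sum.elim_inr,
      smul_eq_mul, taylorQuad_apply]
    fun_prop

theorem measurable_stackVec {α : Type*} [MeasurableSpace α] {V : α → Matrix (Fin d) (Fin d) ℝ}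
    (hV : ∀ j k, Measurable fun a => V a j k) : Measurable fun a => stackVec (V a) := by
  refine (WithLp.measurable_toLp 2 _).comp (measurable_pi_iff.2 fun r => ?_)
  rcases r with j | l
  · exact hV j j
  · exact (hV _ _).div ((hV _ _).sqrt.mul (hV _ _).sqrt)

theorem measurable_centred {m : ℕ} (k : Fin m) :
    Measurable fun x : Fin m → EuclideanSpace ℝ (Fin d) => centred x k := by
  unfold centred
  fun_prop

theorem measurable_centred_apply {m : ℕ} (k : Fin m) (j : Fin d) :
    Measurable fun x : Fin m → EuclideanSpace ℝ (Fin d) => centred x k j :=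
  (measurable_pi_apply j).comp ((WithLp.measurable_ofLp 2 _).comp (measurable_centred k))

theorem empCov_apply {m : ℕ} (x : Fin m → EuclideanSpace ℝ (Fin d)) (j k : Fin d) :
    empCov x j k = ((m : ℝ) - 1)⁻¹ * ∑ i, centred x i j * centred x i k := by
  simp [empCov, Matrix.sum_apply, Matrix.vecMulVec_apply]

theorem empSigma_apply {m : ℕ} (x : Fin m → EuclideanSpace ℝ (Fin d)) (p q : HalfIdx d) :
    empSigma m x p q = ((m : ℝ) - 1)⁻¹ * ∑ i,
      (centred x i p.1.1 * centred x i p.1.2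
        - (m : ℝ)⁻¹ * ∑ l, centred x l p.1.1 * centred x l p.1.2) *
      (centred x i q.1.1 * centred x i q.1.2
        - (m : ℝ)⁻¹ * ∑ l, centred x l q.1.1 * centred x l q.1.2) := by
  simp [empSigma, vech, Matrix.sum_apply, Matrix.vecMulVec_apply]

theorem measurable_empCov {m : ℕ} (j k : Fin d) :
    Measurable fun x : Fin m → EuclideanSpace ℝ (Fin d) => empCov x j k := by
  simp only [empCov_apply]
  exact (Finset.measurable_fun_sum _ fun i _ =>
    (measurable_centred_apply i j).mul (measurable_centred_apply i k)).const_mul _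

theorem measurable_empSigma (m : ℕ) (p q : HalfIdx d) :
    Measurable fun x : Fin m → EuclideanSpace ℝ (Fin d) => empSigma m x p q := by
  have h : ∀ (i : Fin m) (p : HalfIdx d), Measurable fun x : Fin m → EuclideanSpace ℝ (Fin d) =>
      centred x i p.1.1 * centred x i p.1.2 := fun i p =>
    (measurable_centred_apply i _).mul (measurable_centred_apply i _)
  have h' : ∀ (i : Fin m) (p : HalfIdx d), Measurable fun x : Fin m → EuclideanSpace ℝ (Fin d) =>
      centred x i p.1.1 * centred x i p.1.2
        - (m : ℝ)⁻¹ * ∑ l, centred x l p.1.1 * centred x l p.1.2 := fun i p =>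
    (h i p).sub ((Finset.measurable_fun_sum _ fun l _ => h l p).const_mul _)
  simp only [empSigma_apply]
  exact (Finset.measurable_fun_sum _ fun i _ => (h' i p).mul (h' i q)).const_mul _

theorem posSemidef_empSigma (m : ℕ) (x : Fin m → EuclideanSpace ℝ (Fin d)) :
    (empSigma m x).PosSemidef := by
  unfold empSigma
  -- For `m = 0` the factor `(m - 1)⁻¹` equals `-1`, but the sum is empty. For `m = 1` the factor is
  -- `0⁻¹ = 0`.
  rcases Nat.eq_zero_or_pos m with rfl | hm
  · simpa using Matrix.PosSemidef.zero
  · refine Matrix.PosSemidef.smul (Matrix.posSemidef_sum _ fun k _ => ?_) ?_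
    · have := Matrix.posSemidef_vecMulVec_self_star (R := ℝ)
        (vech (vecMulVec (centred x k) (centred x k) -
          (m : ℝ)⁻¹ • ∑ l, vecMulVec (centred x l) (centred x l)))
      rwa [star_trivial] at this
    · have : (1 : ℝ) ≤ m := by exact_mod_cast hm
      exact inv_nonneg.2 (by linarith)

/-- The stacked vector of variances and correlations as a function of the half-vectorization. -/
noncomputable def stackFun (v : EuclideanSpace ℝ (HalfIdx d)) : EuclideanSpace ℝ (StackIdx d) :=
  WithLp.toLp 2 (Sum.elim (fun j => v (diagPos j))
    (fun l => v (offPos l) / (√(v (diagPos l.1.1)) * √(v (diagPos l.1.2)))))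

/-- The linear map given by the stacked matrix `(A; M(v, r))`. -/
noncomputable def stackCLM (V : Matrix (Fin d) (Fin d) ℝ) :
    EuclideanSpace ℝ (HalfIdx d) →L[ℝ] EuclideanSpace ℝ (StackIdx d) :=
  LinearMap.toContinuousLinearMap (Matrix.toEuclideanLin (stackMat V))

theorem stackCLM_apply (V : Matrix (Fin d) (Fin d) ℝ) (y : EuclideanSpace ℝ (HalfIdx d)) :
    stackCLM V y = WithLp.toLp 2 (stackMat V *ᵥ y.ofLp) := rfl

/-- With standardized increments `u = Λ y`, differentiating `v_jk / (√v_jj √v_kk)` gives `u_jk - ½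
r_jk (u_jj + u_kk)`, which is the row `(j, k)` of `M(v, r)` applied to `y`. A positive diagonal
keeps the square roots differentiable. -/
theorem hasFDerivAt_stackFun {V : Matrix (Fin d) (Fin d) ℝ} (hpos : ∀ j, 0 < V j j) :
    HasFDerivAt stackFun (stackCLM V) (WithLp.toLp 2 (vech V)) := by
  have hproj : ∀ p : HalfIdx d, HasStrictFDerivAt (fun v : EuclideanSpace ℝ (HalfIdx d) => v p)
      (EuclideanSpace.proj (𝕜 := ℝ) p) (WithLp.toLp 2 (vech V)) := fun p =>
    (EuclideanSpace.proj (𝕜 := ℝ) p).hasStrictFDerivAt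
  refine (hasStrictFDerivAt_euclidean.2 fun r => ?_).hasFDerivAt
  rcases r with j | l
  · refine (hproj (diagPos j)).congr_fderiv ?_
    ext y
    exact (stackMat_mulVec_inl V _ j).symm
  · have ha := hpos l.1.1
    have hb := hpos l.1.2
    have hsa := Real.sqrt_pos.2 ha
    have hsb := Real.sqrt_pos.2 hb
    have h1 := (hproj (offPos l)).mul ((hasStrictDerivAt_inv (mul_pos hsa hsb).ne')
      |>.comp_hasStrictFDerivAt (WithLp.toLp 2 (vech V))
      (((hproj (diagPos l.1.1)).sqrt ha.ne').mul ((hproj (diagPos l.1.2)).sqrt hb.ne')))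
    refine h1.congr_fderiv ?_
    ext y
    have hpow : ∀ a b : ℝ, 0 < a → 0 < b → (a * b) ^ (-(1 / 2) : ℝ) = (√a * √b)⁻¹ :=
      fun a b ha hb => by
        rw [Real.rpow_neg (mul_pos ha hb).le, ← Real.sqrt_eq_rpow, Real.sqrt_mul ha.le]
    change _ = (stackMat V *ᵥ y.ofLp) (Sum.inr l)
    rw [stackMat_mulVec_inr, matM_mulVec]
    simp only [scaleMat_mulVec]
    simp only [diagPos, offPos, hpow _ _ ha hb, hpow _ _ ha ha, hpow _ _ hb hb, corrMat,
      Matrix.of_apply, vech]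
    simp [vech]
    field_simp
    ring

end MatrixFormulas

end CombinedTest

namespace CombinedTest

/-! ### Empirical moments of centred observations, as deterministic identities and limits. -/

section Moments

variable {d : ℕ}

/-- The average of the first `m` terms of a sequence. -/
noncomputable def avg (m : ℕ) (a : ℕ → ℝ) : ℝ := (m : ℝ)⁻¹ * ∑ i : Fin m, a i

theorem avg_sub (m : ℕ) (a b : ℕ → ℝ) : avg m (fun i => a i - b i) = avg m a - avg m b := by
  simp [avg, Finset.sum_sub_distrib, mul_sub]

theorem avg_const_mul (m : ℕ) (c : ℝ) (a : ℕ → ℝ) : avg m (fun i => c * a i) = c * avg m a := by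
  simp only [avg, ← Finset.mul_sum]
  ring

theorem avg_sub_mul_sub {m : ℕ} (hm : m ≠ 0) (a b : ℕ → ℝ) :
    avg m (fun i => (a i - avg m a) * (b i - avg m b))
      = avg m (fun i => a i * b i) - avg m a * avg m b := by
  have h : ∀ i, (a i - avg m a) * (b i - avg m b)
      = (a i * b i - avg m b * a i) - (avg m a * b i - avg m a * avg m b) := fun i => by ring
  have hc : ∀ c : ℝ, avg m (fun _ => c) = c := fun c => by
    have : (m : ℝ) ≠ 0 := Nat.cast_ne_zero.2 hm
    simp [avg, this]
  simp only [h]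
  rw [avg_sub, avg_sub, avg_sub, avg_const_mul, avg_const_mul, hc]
  ring

/-- Empirical moments of centred observations have the same limits as raw empirical moments if the
sample mean tends to `0`. -/
theorem tendsto_avg_centred_prod {x : ℕ → Fin d → ℝ} {M : List (Fin d) → ℝ} {N : ℕ}
    (hM : ∀ L : List (Fin d), L.length ≤ N →
      Tendsto (fun m => avg m fun i => (L.map (x i)).prod) atTop (𝓝 (M L)))
    (h0 : ∀ j, Tendsto (fun m => avg m fun i => x i j) atTop (𝓝 0)) :
    ∀ L₁ L₂ : List (Fin d), L₁.length + L₂.length ≤ N →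
      Tendsto (fun m => avg m fun i => (L₁.map fun j => x i j - avg m fun i' => x i' j).prod *
        (L₂.map (x i)).prod) atTop (𝓝 (M (L₁.reverse ++ L₂))) := by
  intro L₁
  induction L₁ with
  | nil =>
    intro L₂ h
    simpa using hM L₂ (by simpa using h)
  | cons j L₁ ih =>
    intro L₂ h
    rw [List.length_cons] at h
    -- Expand one centred factor `x_j - x̄_j`. The part with `x_j` moves to the raw list, which is
    -- why the centred list ends up reversed; the part with `x̄_j` is a null sequence times a
    -- convergent one.
    have h1 := ih (j :: L₂) (by rw [List.length_cons]; omega)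
    have h2 := ih L₂ (by omega)
    have h3 := h1.sub ((h0 j).mul h2)
    rw [zero_mul, sub_zero] at h3
    rw [List.reverse_cons, List.append_assoc, List.singleton_append]
    refine h3.congr fun m => ?_
    rw [← avg_const_mul, ← avg_sub]
    congr 1
    ext i
    simp only [List.map_cons, List.prod_cons]
    ring

theorem tendsto_div_sub_one :
    Tendsto (fun m : ℕ => (m : ℝ) / ((m : ℝ) - 1)) atTop (𝓝 1) := by
  have h : Tendsto (fun m : ℕ => 1 + ((m : ℝ) - 1)⁻¹) atTop (𝓝 (1 + 0)) :=
    tendsto_const_nhds.add (tendsto_inv_atTop_zero.comp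
      (tendsto_atTop_add_const_right _ _ tendsto_natCast_atTop_atTop))
  rw [add_zero] at h
  refine h.congr' ?_
  filter_upwards [eventually_ge_atTop 2] with m hm
  have : (2 : ℝ) ≤ m := by exact_mod_cast hm
  have : (m : ℝ) - 1 ≠ 0 := by linarith
  field_simp
  ring

theorem sub_one_inv_mul_sum {m : ℕ} (a : ℕ → ℝ) :
    ((m : ℝ) - 1)⁻¹ * ∑ i : Fin m, a i = (m : ℝ) / ((m : ℝ) - 1) * avg m a := by
  rcases Nat.eq_zero_or_pos m with rfl | hm
  · simp
  · have : (m : ℝ) ≠ 0 := by positivity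
    rw [avg, div_mul_eq_mul_div, ← mul_assoc, mul_inv_cancel₀ this, one_mul, inv_mul_eq_div]

theorem centred_add_apply {m : ℕ} (hm : m ≠ 0) (c : EuclideanSpace ℝ (Fin d))
    (e : ℕ → EuclideanSpace ℝ (Fin d)) (k : Fin m) (j : Fin d) :
    centred (fun i : Fin m => c + e i) k j = e k j - avg m fun i => e i j := by
  have hm' : (m : ℝ) ≠ 0 := Nat.cast_ne_zero.2 hm
  simp only [centred, avg, PiLp.sub_apply, PiLp.add_apply, PiLp.smul_apply, smul_eq_mul,
    Finset.sum_add_distrib, Finset.sum_const, Finset.card_univ, Fintype.card_fin, nsmul_eq_mul]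
  simp
  field_simp
  ring

theorem empCov_add_eq {m : ℕ} (hm : m ≠ 0) (c : EuclideanSpace ℝ (Fin d))
    (e : ℕ → EuclideanSpace ℝ (Fin d)) (j k : Fin d) :
    empCov (fun i : Fin m => c + e i) j k = (m : ℝ) / ((m : ℝ) - 1) *
      (avg m (fun i => e i j * e i k) - avg m (fun i => e i j) * avg m (fun i => e i k)) := by
  rw [empCov_apply, ← avg_sub_mul_sub hm, ← sub_one_inv_mul_sum]
  simp only [centred_add_apply hm]

theorem empSigma_add_eq {m : ℕ} (hm : m ≠ 0) (c : EuclideanSpace ℝ (Fin d))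
    (e : ℕ → EuclideanSpace ℝ (Fin d)) (p q : HalfIdx d) :
    empSigma m (fun i : Fin m => c + e i) p q = (m : ℝ) / ((m : ℝ) - 1) *
      (avg m (fun i => (e i p.1.1 - avg m fun i' => e i' p.1.1) *
          (e i p.1.2 - avg m fun i' => e i' p.1.2) *
          ((e i q.1.1 - avg m fun i' => e i' q.1.1) * (e i q.1.2 - avg m fun i' => e i' q.1.2)))
        - avg m (fun i => (e i p.1.1 - avg m fun i' => e i' p.1.1) *
          (e i p.1.2 - avg m fun i' => e i' p.1.2)) *
          avg m (fun i => (e i q.1.1 - avg m fun i' => e i' q.1.1) *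
            (e i q.1.2 - avg m fun i' => e i' q.1.2))) := by
  rw [empSigma_apply, ← avg_sub_mul_sub hm, ← sub_one_inv_mul_sum]
  simp only [centred_add_apply hm]
  rfl

end Moments

/-! ### Strong consistency of the empirical covariance matrix and of `empSigma`. -/

section LawOfLargeNumbers

variable {d : ℕ} {Ω : Type*} [MeasurableSpace Ω] {P : Measure Ω}

theorem abs_list_prod_le (x : EuclideanSpace ℝ (Fin d)) (L : List (Fin d)) :
    |(L.map x).prod| ≤ ‖x‖ ^ L.length := by
  induction L with
  | nil => simp
  | cons j L ih =>
    rw [List.map_cons, List.prod_cons, abs_mul, List.length_cons, pow_succ']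
    exact mul_le_mul (by simpa using PiLp.norm_apply_le x j) ih (abs_nonneg _) (norm_nonneg _)

theorem measurable_list_prod (L : List (Fin d)) :
    Measurable fun x : EuclideanSpace ℝ (Fin d) => (L.map x).prod := by
  induction L with
  | nil => simp
  | cons j L ih =>
    simp only [List.map_cons, List.prod_cons]
    exact (by fun_prop : Measurable fun x : EuclideanSpace ℝ (Fin d) => x j).mul ih

/-- A product of coordinates is bounded by a power of the norm. Thus the fourth moment makes
products of up to four coordinates integrable and products of up to two square integrable. -/
theorem memLp_list_prod [IsProbabilityMeasure P] {e : Ω → EuclideanSpace ℝ (Fin d)}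
    (he : MemLp e 4 P) (q : ℕ) (hq : q ≠ 0)
    (L : List (Fin d)) (hL : q * L.length ≤ 4) :
    MemLp (fun ω => (L.map (e ω)).prod) q P := by
  have hm : AEStronglyMeasurable (fun ω => (L.map (e ω)).prod) P :=
    ((measurable_list_prod L).comp_aemeasurable he.1.aemeasurable).aestronglyMeasurable
  rw [← integrable_norm_rpow_iff hm (by exact_mod_cast hq) (by simp)]
  have h1 : MemLp e ((q * L.length : ℕ) : ENNReal) P :=
    he.mono_exponent (by exact_mod_cast hL)
  refine (h1.integrable_norm_pow').mono
    (hm.norm.aemeasurable.pow_const _).aestronglyMeasurable (ae_of_all _ fun ω => ?_)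
  simp only [ENNReal.toReal_natCast, Real.rpow_natCast, Real.norm_eq_abs, abs_pow, abs_abs,
    abs_norm]
  rw [mul_comm q, pow_mul]
  exact pow_le_pow_left₀ (abs_nonneg _) (abs_list_prod_le _ _) _

theorem ae_tendsto_avg {E : Type*} [MeasurableSpace E] {e : ℕ → Ω → E} (hindep : iIndepFun e P)
    (hident : ∀ k, IdentDistrib (e k) (e 0) P P) {f : E → ℝ} (hf : Measurable f)
    (hint : Integrable (fun ω => f (e 0 ω)) P) :
    ∀ᵐ ω ∂P, Tendsto (fun m => avg m fun i => f (e i ω)) atTop (𝓝 (∫ ω, f (e 0 ω) ∂P)) := by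
  have h := strong_law_ae_real (μ := P) (fun k ω => f (e k ω)) hint
    (fun i j hij => (hindep.indepFun hij).comp hf hf) (fun k => (hident k).comp hf)
  filter_upwards [h] with ω hω
  refine hω.congr fun m => ?_
  rw [avg, Finset.sum_range, div_eq_inv_mul]

variable [IsProbabilityMeasure P] {e : ℕ → Ω → EuclideanSpace ℝ (Fin d)}

/-- There are countably many lists, so the strong law holds for all raw moments outside one null
set. There the deterministic `tendsto_avg_centred_prod` replaces raw by centred factors. -/
theorem ae_tendsto_avg_centred_prod (hindep : iIndepFun e P)
    (hident : ∀ k, IdentDistrib (e k) (e 0) P P) (hmean : ∫ ω, e 0 ω ∂P = 0)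
    (hfour : MemLp (e 0) 4 P) :
    ∀ᵐ ω ∂P, ∀ L : List (Fin d), L.length ≤ 4 →
      Tendsto (fun m => avg m fun i => (L.map fun j => e i ω j - avg m fun i' => e i' ω j).prod)
        atTop (𝓝 (∫ ω, (L.reverse.map (e 0 ω)).prod ∂P)) := by
  have hall : ∀ᵐ ω ∂P, ∀ L : List (Fin d), L.length ≤ 4 →
      Tendsto (fun m => avg m fun i => (L.map (e i ω)).prod)
        atTop (𝓝 (∫ ω, (L.map (e 0 ω)).prod ∂P)) := by
    refine ae_all_iff.2 fun L => ?_
    by_cases hL : L.length ≤ 4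
    · have hint := memLp_one_iff_integrable.1
        (by simpa using memLp_list_prod hfour 1 one_ne_zero L (by simpa using hL))
      filter_upwards [ae_tendsto_avg hindep hident (measurable_list_prod L) hint] with ω hω _
      exact hω
    · exact ae_of_all _ fun ω h => absurd h hL
  have hzero : ∀ j, ∫ ω, e 0 ω j ∂P = 0 := fun j => by
    have hi : Integrable (e 0) P := hfour.integrable (by norm_num)
    have := (EuclideanSpace.proj (𝕜 := ℝ) j).integral_comp_comm hi
    rw [hmean] at this
    simpa using this
  filter_upwards [hall] with ω hω L hL
  have := tendsto_avg_centred_prod (x := fun i => e i ω)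
    (M := fun L => ∫ ω, (L.map (e 0 ω)).prod ∂P) (N := 4) hω (fun j => by
      simpa [hzero] using hω [j] (by simp)) L [] (by simpa using hL)
  simpa using this

theorem popCov_eq (hmean : ∫ ω, e 0 ω ∂P = 0) (hfour : MemLp (e 0) 4 P) (j k : Fin d) :
    popCov (e 0) P j k = ∫ ω, e 0 ω j * e 0 ω k ∂P := by
  have hmem : ∀ j, MemLp (fun ω => e 0 ω j) 2 P := fun j => by
    simpa using memLp_list_prod hfour 2 two_ne_zero [j] (by simp)
  have hzero : ∀ j, ∫ ω, e 0 ω j ∂P = 0 := fun j => by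
    have hi : Integrable (e 0) P := hfour.integrable (by norm_num)
    have := (EuclideanSpace.proj (𝕜 := ℝ) j).integral_comp_comm hi
    rw [hmean] at this
    simpa using this
  rw [popCov, Matrix.of_apply, covariance_eq_sub (hmem j) (hmem k), hzero]
  simp

theorem ae_tendsto_empCov (hindep : iIndepFun e P)
    (hident : ∀ k, IdentDistrib (e k) (e 0) P P) (hmean : ∫ ω, e 0 ω ∂P = 0)
    (hfour : MemLp (e 0) 4 P) (c : EuclideanSpace ℝ (Fin d)) :
    ∀ᵐ ω ∂P, ∀ j k, Tendsto (fun m => empCov (fun i : Fin m => c + e i ω) j k) atTop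
      (𝓝 (popCov (e 0) P j k)) := by
  filter_upwards [ae_tendsto_avg_centred_prod hindep hident hmean hfour] with ω hω j k
  have h := tendsto_div_sub_one.mul (hω [k, j] (by simp))
  rw [one_mul] at h
  simp only [List.reverse_cons, List.reverse_nil, List.nil_append, List.singleton_append,
    List.map_cons, List.map_nil, List.prod_cons, List.prod_nil, mul_one] at h
  rw [popCov_eq hmean hfour]
  refine h.congr' ?_
  filter_upwards [eventually_ne_atTop 0] with m hm
  rw [empCov_add_eq hm c (fun i => e i ω), ← avg_sub_mul_sub hm]
  simp only [mul_comm]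

/-- Up to the factor `m / (m - 1)`, an entry is an empirical centred fourth moment minus a product
of two second moments. The limits combine to `E[ab] - E[a] E[b]`, the population covariance. -/
theorem ae_tendsto_empSigma (hindep : iIndepFun e P)
    (hident : ∀ k, IdentDistrib (e k) (e 0) P P) (hmean : ∫ ω, e 0 ω ∂P = 0)
    (hfour : MemLp (e 0) 4 P) (c : EuclideanSpace ℝ (Fin d)) :
    ∀ᵐ ω ∂P, ∀ p q, Tendsto (fun m => empSigma m (fun i : Fin m => c + e i ω) p q) atTop
      (𝓝 (popSigma (e 0) P p q)) := by
  have hmem : ∀ p : HalfIdx d, MemLp (fun ω => e 0 ω p.1.1 * e 0 ω p.1.2) 2 P := fun p => by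
    simpa using memLp_list_prod hfour 2 two_ne_zero [p.1.1, p.1.2] (by simp)
  filter_upwards [ae_tendsto_avg_centred_prod hindep hident hmean hfour] with ω hω p q
  have h4 := hω [q.1.2, q.1.1, p.1.2, p.1.1] (by simp)
  have hp := hω [p.1.2, p.1.1] (by simp)
  have hq := hω [q.1.2, q.1.1] (by simp)
  have h := tendsto_div_sub_one.mul (h4.sub (hp.mul hq))
  rw [one_mul] at h
  have hlim : popSigma (e 0) P p q
      = ∫ ω, (e 0 ω p.1.1 * e 0 ω p.1.2) * (e 0 ω q.1.1 * e 0 ω q.1.2) ∂P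
        - (∫ ω, e 0 ω p.1.1 * e 0 ω p.1.2 ∂P) * ∫ ω, e 0 ω q.1.1 * e 0 ω q.1.2 ∂P := by
    rw [popSigma, Matrix.of_apply]
    exact covariance_eq_sub (hmem p) (hmem q)
  rw [hlim]
  simp only [List.reverse_cons, List.reverse_nil, List.nil_append, List.cons_append,
    List.map_cons, List.map_nil, List.prod_cons, List.prod_nil, mul_one] at h
  convert h.congr' ?_ using 4
  · ext ω; ring
  filter_upwards [eventually_ne_atTop 0] with m hm
  rw [empSigma_add_eq hm c (fun i => e i ω)]
  congr 2
  · congr 1; ext i; ring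
  · congr 2 <;> (ext i; ring)

theorem tendstoInMeasure_empCov (hm : ∀ k, Measurable (e k)) (hindep : iIndepFun e P)
    (hident : ∀ k, IdentDistrib (e k) (e 0) P P) (hmean : ∫ ω, e 0 ω ∂P = 0)
    (hfour : MemLp (e 0) 4 P) (c : EuclideanSpace ℝ (Fin d)) (j k : Fin d) :
    TendstoInMeasure P (fun m ω => empCov (fun i : Fin m => c + e i ω) j k) atTop
      (fun _ => popCov (e 0) P j k) := by
  refine tendstoInMeasure_of_tendsto_ae (fun m => ?_)
    ((ae_tendsto_empCov hindep hident hmean hfour c).mono fun ω hω => hω j k)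
  exact ((measurable_empCov j k).comp (measurable_pi_iff.2 fun i =>
    (hm i).const_add c)).aestronglyMeasurable

theorem isConsistentCovEstimator_empSigma (hm : ∀ k, Measurable (e k)) (hindep : iIndepFun e P)
    (hident : ∀ k, IdentDistrib (e k) (e 0) P P) (hmean : ∫ ω, e 0 ω ∂P = 0)
    (hfour : MemLp (e 0) 4 P) (c : EuclideanSpace ℝ (Fin d)) :
    IsConsistentCovEstimator P (fun k ω => c + e k ω) (popSigma (e 0) P) empSigma where
  measurable := measurable_empSigma
  posSemidef := posSemidef_empSigma
  consistent p q := by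
    refine tendstoInMeasure_of_tendsto_ae (fun m => ?_)
      ((ae_tendsto_empSigma hindep hident hmean hfour c).mono fun ω hω => hω p q)
    exact ((measurable_empSigma m p q).comp (measurable_pi_iff.2 fun i =>
      (hm i).const_add c)).aestronglyMeasurable

end LawOfLargeNumbers

end CombinedTest

namespace CombinedTest

/-! ### The limit covariance `Γ` and its characteristic function. -/

section LimitCovariance

variable {d : ℕ} {Ω : Type*} [MeasurableSpace Ω] {P : Measure Ω} [IsProbabilityMeasure P]

theorem memLp_vech {e : Ω → EuclideanSpace ℝ (Fin d)} (he : MemLp e 4 P) (p : HalfIdx d) :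
    MemLp (fun ω => vech (Matrix.vecMulVec (e ω) (e ω)) p) 2 P := by
  simpa [vech, Matrix.vecMulVec_apply] using
    memLp_list_prod he 2 two_ne_zero [p.1.1, p.1.2] (by simp)

theorem posSemidef_popSigma {e : Ω → EuclideanSpace ℝ (Fin d)} (he : MemLp e 4 P) :
    (popSigma e P).PosSemidef :=
  (posSemidef_of_eq_cov (W := fun ω => vech (Matrix.vecMulVec (e ω) (e ω)))
    (memLp_vech he) (fun _ _ => rfl)).1

theorem posSemidef_limitCov {e : Fin 2 → Ω → EuclideanSpace ℝ (Fin d)}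
    (he : ∀ i, MemLp (e i) 4 P) {κ : Fin 2 → ℝ} (hκ : ∀ i, 0 < κ i) :
    (limitCov κ e P).PosSemidef := by
  refine Matrix.posSemidef_sum _ fun i _ => Matrix.PosSemidef.smul ?_ (inv_nonneg.2 (hκ i).le)
  have := (posSemidef_popSigma (he i)).mul_mul_conjTranspose_same (stackMat (popCov (e i) P))
  rwa [Matrix.conjTranspose_eq_transpose_of_trivial] at this

theorem charFun_map_smul_stackMat {V : Matrix (Fin d) (Fin d) ℝ}
    {S : Matrix (HalfIdx d) (HalfIdx d) ℝ} (hS : S.PosSemidef) (a : ℝ)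
    (t : EuclideanSpace ℝ (StackIdx d)) :
    charFun ((multivariateGaussian 0 S).map (fun y => a • stackCLM V y)) t
      = Complex.exp (-((a ^ 2 * (t.ofLp ⬝ᵥ (stackMat V * S * (stackMat V)ᵀ) *ᵥ t.ofLp) : ℝ) : ℂ)
        / 2) := by
  rw [charFun_map_smul_comp (by fun_prop)]
  change charFun (Measure.map (fun y : EuclideanSpace ℝ (HalfIdx d) =>
    WithLp.toLp 2 (stackMat V *ᵥ y.ofLp)) _) _ = _
  rw [charFun_map_mulVec_multivariateGaussian hS]
  congr 4
  simp only [WithLp.ofLp_smul, Matrix.mulVec_smul, dotProduct_smul, smul_dotProduct, smul_eq_mul]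
  ring

/-- The product of the characteristic functions of the two independent Gaussian parts is the
characteristic function of `N(0, Γ)`. -/
theorem charFun_limitCov {e : Fin 2 → Ω → EuclideanSpace ℝ (Fin d)}
    (he : ∀ i, MemLp (e i) 4 P) {κ : Fin 2 → ℝ} (hκ : ∀ i, 0 < κ i)
    (t : EuclideanSpace ℝ (StackIdx d)) :
    charFun ((multivariateGaussian 0 (popSigma (e 0) P)).map
        (fun y => √((κ 0)⁻¹) • stackCLM (popCov (e 0) P) y)) t *
      charFun ((multivariateGaussian 0 (popSigma (e 1) P)).map
        (fun y => (-√((κ 1)⁻¹)) • stackCLM (popCov (e 1) P) y)) t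
      = charFun (multivariateGaussian 0 (limitCov κ e P)) t := by
  rw [charFun_map_smul_stackMat (posSemidef_popSigma (he 0)),
    charFun_map_smul_stackMat (posSemidef_popSigma (he 1)),
    charFun_multivariateGaussian (posSemidef_limitCov he hκ), ← Complex.exp_add]
  congr 1
  rw [neg_sq, Real.sq_sqrt (inv_nonneg.2 (hκ 0).le), Real.sq_sqrt (inv_nonneg.2 (hκ 1).le)]
  simp only [limitCov, Fin.sum_univ_two, Matrix.add_mulVec, Matrix.smul_mulVec, dotProduct_add,
    dotProduct_smul, smul_eq_mul, inner_zero_right]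
  push_cast
  ring

end LimitCovariance

/-! ### Asymptotic normality for one group. -/

section OneSample

variable {d : ℕ} {Ω : Type*} [MeasurableSpace Ω] {P : Measure Ω} [IsProbabilityMeasure P]

theorem tendsto_inv_sqrt_natCast : Tendsto (fun m : ℕ => (√(m : ℝ))⁻¹) atTop (𝓝 0) :=
  tendsto_inv_atTop_zero.comp (Real.tendsto_sqrt_atTop.comp tendsto_natCast_atTop_atTop)

/-- The expression is `√m / (m - 1)`: normalizing by `m - 1` instead of `m` is negligible even on
the scale `√m`. -/
theorem tendsto_sqrt_mul_div_sub_one :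
    Tendsto (fun m : ℕ => √(m : ℝ) * ((m : ℝ) / ((m : ℝ) - 1) - 1)) atTop (𝓝 0) := by
  have h := tendsto_inv_sqrt_natCast.mul tendsto_div_sub_one
  rw [zero_mul] at h
  refine h.congr' ?_
  filter_upwards [eventually_ge_atTop 2] with m hm
  have h2 : (2 : ℝ) ≤ m := by exact_mod_cast hm
  have h3 : (m : ℝ) - 1 ≠ 0 := by linarith
  have h4 : √(m : ℝ) ≠ 0 := (Real.sqrt_pos.2 (by linarith)).ne'
  field_simp
  rw [Real.sq_sqrt (by linarith)]
  ring

/-- A vector together with the half-vectorization of its outer product. -/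
noncomputable def momentVec (x : EuclideanSpace ℝ (Fin d)) :
    EuclideanSpace ℝ (Fin d ⊕ HalfIdx d) :=
  WithLp.toLp 2 (Sum.elim x (vech (Matrix.vecMulVec x x)))

theorem measurable_momentVec : Measurable (momentVec (d := d)) := by
  refine (WithLp.measurable_toLp 2 _).comp (measurable_pi_iff.2 fun r => ?_)
  rcases r with j | p
  · exact (by fun_prop : Measurable fun x : EuclideanSpace ℝ (Fin d) => x j)
  · exact (by fun_prop : Measurable fun x : EuclideanSpace ℝ (Fin d) => x p.1.1 * x p.1.2)

/-- The empirical covariance in terms of the normalized sums of `momentVec`. -/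
noncomputable def covFromMoments (V : Matrix (Fin d) (Fin d) ℝ)
    (q : EuclideanSpace ℝ (Fin d ⊕ HalfIdx d) × ℝ × ℝ × ℝ) : EuclideanSpace ℝ (HalfIdx d) :=
  WithLp.toLp 2 fun p => q.2.1 * (q.1 (Sum.inr p)
    - q.2.2.1 * (q.1 (Sum.inl p.1.1) * q.1 (Sum.inl p.1.2))) + q.2.2.2 * vech V p

theorem continuous_covFromMoments (V : Matrix (Fin d) (Fin d) ℝ) :
    Continuous (covFromMoments V) := by
  refine (PiLp.continuous_toLp 2 _).comp (continuous_pi fun p => ?_)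
  fun_prop

/-- With `r = m / (m - 1)` and normalized sums `S`, the entry `(j, k)` is exactly `r (S_jk -
m^{-1/2} S_j S_k) + √m (r - 1) V_jk`. The three deterministic coefficients tend to `1`, `0`, `0`, so
Slutsky's lemma leaves `S_jk`: estimating the mean has no effect in the limit. -/
theorem sqrt_smul_vech_empCov_sub (V : Matrix (Fin d) (Fin d) ℝ) (c : EuclideanSpace ℝ (Fin d))
    (e : ℕ → EuclideanSpace ℝ (Fin d)) (m : ℕ) :
    √(m : ℝ) • ((WithLp.toLp 2 (vech (empCov fun i : Fin m => c + e i)) :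
        EuclideanSpace ℝ (HalfIdx d)) - WithLp.toLp 2 (vech V))
      = covFromMoments V ((√(m : ℝ))⁻¹ • ∑ k ∈ Finset.range m, (momentVec (e k)
          - WithLp.toLp 2 (Sum.elim (0 : Fin d → ℝ) (vech V))),
        (m : ℝ) / ((m : ℝ) - 1), (√(m : ℝ))⁻¹,
        √(m : ℝ) * ((m : ℝ) / ((m : ℝ) - 1) - 1)) := by
  ext p
  rcases Nat.eq_zero_or_pos m with rfl | hm
  · simp [covFromMoments]
  have hm0 : (0 : ℝ) < m := by exact_mod_cast hm
  have hs : 0 < √(m : ℝ) := Real.sqrt_pos.2 hm0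
  have hss : √(m : ℝ) * √(m : ℝ) = m := Real.mul_self_sqrt hm0.le
  have havg : ∀ a : ℕ → ℝ, ∑ i ∈ Finset.range m, a i = √(m : ℝ) * √(m : ℝ) * avg m a :=
    fun a => by
      rw [hss, avg, Finset.sum_range, ← mul_assoc, mul_inv_cancel₀ hm0.ne', one_mul]
  simp only [covFromMoments, momentVec, PiLp.smul_apply, PiLp.sub_apply, smul_eq_mul,
    WithLp.ofLp_sum, Finset.sum_apply, Sum.elim_inl, Sum.elim_inr,
    Finset.sum_sub_distrib, Finset.sum_const, Finset.card_range, nsmul_eq_mul, havg, Pi.zero_apply,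
    sub_zero, mul_zero]
  have hv : vech (empCov fun i : Fin m => c + e i) p = (m : ℝ) / ((m : ℝ) - 1) *
      (avg m (fun i => e i p.1.1 * e i p.1.2) - avg m (fun i => e i p.1.1) *
        avg m (fun i => e i p.1.2)) := empCov_add_eq hm.ne' c e _ _
  rw [hv]
  have hvm : ∀ i, vech (vecMulVec (e i) (e i)) p = e i p.1.1 * e i p.1.2 := fun i => rfl
  simp only [hvm]
  generalize (m : ℝ) / ((m : ℝ) - 1) = r
  generalize √(m : ℝ) = s at hs hss ⊢
  rw [← hss]
  field_simp
  ring

variable {e : ℕ → Ω → EuclideanSpace ℝ (Fin d)}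

/-- The covariance matrix of `momentVec`. -/
noncomputable def momentCov (e : Ω → EuclideanSpace ℝ (Fin d)) (P : Measure Ω) :
    Matrix (Fin d ⊕ HalfIdx d) (Fin d ⊕ HalfIdx d) ℝ :=
  Matrix.of fun a b => cov[fun ω => momentVec (e ω) a, fun ω => momentVec (e ω) b; P]

theorem memLp_momentVec (he : MemLp (e 0) 4 P) (a : Fin d ⊕ HalfIdx d) :
    MemLp (fun ω => momentVec (e 0 ω) a) 2 P := by
  rcases a with j | p
  · simpa [momentVec] using memLp_list_prod he 2 two_ne_zero [j] (by simp)
  · exact memLp_vech he p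

/-- Delta method for the stacked vector of variances and correlations of one sample. -/
theorem tendstoInDistribution_stackVec_empCov (hm : ∀ k, Measurable (e k))
    (hindep : iIndepFun e P) (hident : ∀ k, IdentDistrib (e k) (e 0) P P)
    (hmean : ∫ ω, e 0 ω ∂P = 0) (hfour : MemLp (e 0) 4 P)
    (hpos : ∀ j, 0 < popCov (e 0) P j j) (c : EuclideanSpace ℝ (Fin d)) :
    TendstoInDistribution
      (fun (m : ℕ) ω => √(m : ℝ) • (stackVec (empCov fun i : Fin m => c + e i ω)
        - stackVec (popCov (e 0) P))) atTop
      (fun s : EuclideanSpace ℝ (Fin d ⊕ HalfIdx d) =>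
        stackCLM (popCov (e 0) P) (WithLp.toLp 2 fun p => s (Sum.inr p)))
      (fun _ => P) (multivariateGaussian 0 (momentCov (e 0) P)) := by
  set V := popCov (e 0) P with hV
  set v : EuclideanSpace ℝ (HalfIdx d) := WithLp.toLp 2 (vech V) with hv
  set Vh : ℕ → Ω → EuclideanSpace ℝ (HalfIdx d) := fun m ω =>
    WithLp.toLp 2 (vech (empCov fun i : Fin m => c + e i ω)) with hVh
  have hVhm : ∀ m, Measurable (Vh m) := fun m => by
    refine (WithLp.measurable_toLp 2 _).comp (measurable_pi_iff.2 fun p => ?_)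
    exact (measurable_empCov p.1.1 p.1.2).comp (measurable_pi_iff.2 fun i =>
      (hm i).const_add c)
  have hclt := tendstoInDistribution_clt_euclidean (P := P) (W := fun k ω => momentVec (e k ω))
    (memLp_momentVec hfour) (hindep.comp (fun _ => momentVec) fun _ => measurable_momentVec)
    (fun k => (hident k).comp measurable_momentVec) (C := momentCov (e 0) P) (fun _ _ => rfl)
    (w := WithLp.toLp 2 (Sum.elim (0 : Fin d → ℝ) (vech V))) (fun r => by
      rcases r with j | p
      · have hi : Integrable (e 0) P := hfour.integrable (by norm_num)
        have := (EuclideanSpace.proj (𝕜 := ℝ) j).integral_comp_comm hi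
        rw [hmean] at this
        simpa [momentVec] using this.symm
      · exact popCov_eq hmean hfour _ _)
  have hpar : TendstoInMeasure P (fun (m : ℕ) (_ : Ω) => ((m : ℝ) / ((m : ℝ) - 1),
      (√(m : ℝ))⁻¹, √(m : ℝ) * ((m : ℝ) / ((m : ℝ) - 1) - 1))) atTop
      (fun _ => ((1 : ℝ), (0 : ℝ), (0 : ℝ))) :=
    tendstoInMeasure_of_tendsto (tendsto_div_sub_one.prodMk_nhds
      (tendsto_inv_sqrt_natCast.prodMk_nhds tendsto_sqrt_mul_div_sub_one))
  have hU := hclt.continuous_comp_prodMk_of_tendstoInMeasure_const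
    (continuous_covFromMoments V) hpar (fun _ => aemeasurable_const)
  have hVlim : TendstoInMeasure P Vh atTop (fun _ => v) := by
    refine tendstoInMeasure_of_tendsto_ae (fun m => (hVhm m).aestronglyMeasurable) ?_
    filter_upwards [ae_tendsto_empCov hindep hident hmean hfour c] with ω hω
    exact ((PiLp.continuous_toLp 2 _).tendsto _).comp
      (tendsto_pi_nhds.2 fun p => hω p.1.1 p.1.2)
  -- The difference quotient of the remainder. It is `0` at `v` because `0⁻¹ = 0`, and
  -- differentiability makes it continuous there. With `U = √m (V̂ - v)` the scaled increment equals
  -- `D U + ‖U‖ ρ(V̂)`, where `D` is the derivative, so the second term vanishes by Slutsky's lemma.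
  set ρ : EuclideanSpace ℝ (HalfIdx d) → EuclideanSpace ℝ (StackIdx d) := fun x =>
    ‖x - v‖⁻¹ • (stackFun x - stackFun v - stackCLM V (x - v)) with hρ
  have hρm : Measurable ρ := by
    have : Measurable (stackFun (d := d)) := by
      refine (WithLp.measurable_toLp 2 _).comp (measurable_pi_iff.2 fun r => ?_)
      rcases r with j | l
      · exact (by fun_prop : Measurable fun x : EuclideanSpace ℝ (HalfIdx d) => x (diagPos j))
      · exact (by fun_prop : Measurable fun x : EuclideanSpace ℝ (HalfIdx d) =>
          x (offPos l) / (√(x (diagPos l.1.1)) * √(x (diagPos l.1.2))))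
    fun_prop
  have hρ0 : ρ v = 0 := by simp [hρ]
  have hρc : ContinuousAt ρ v := by
    rw [ContinuousAt, hρ0, tendsto_zero_iff_norm_tendsto_zero]
    refine (hasFDerivAt_iff_tendsto.1 (hasFDerivAt_stackFun hpos)).congr fun x => ?_
    simp [hρ, norm_smul, hv]
  have hρlim : TendstoInMeasure P (fun m ω => ρ (Vh m ω)) atTop (fun _ => 0) := by
    have := tendstoInMeasure_comp_of_continuousAt hVlim hρc
    rwa [hρ0] at this
  have hD := hU.continuous_comp_prodMk_of_tendstoInMeasure_const
    (g := fun q : EuclideanSpace ℝ (HalfIdx d) × EuclideanSpace ℝ (StackIdx d) =>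
      stackCLM V q.1 + ‖q.1‖ • q.2) (by fun_prop) hρlim
    (fun m => (hρm.comp (hVhm m)).aemeasurable)
  refine hD.congr (fun m => ae_of_all _ fun ω => ?_) (ae_of_all _ fun s => ?_)
  · have h1 := sqrt_smul_vech_empCov_sub V c (fun k => e k ω) m
    simp only
    rw [← h1]
    change stackCLM V (√(m : ℝ) • (Vh m ω - v)) + ‖√(m : ℝ) • (Vh m ω - v)‖ • ρ (Vh m ω)
      = √(m : ℝ) • (stackFun (Vh m ω) - stackFun v)
    have h2 : ‖Vh m ω - v‖ • ρ (Vh m ω)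
        = stackFun (Vh m ω) - stackFun v - stackCLM V (Vh m ω - v) := by
      by_cases h0 : ‖Vh m ω - v‖ = 0
      · have : Vh m ω = v := sub_eq_zero.1 (norm_eq_zero.1 h0)
        simp [this]
      · rw [hρ, smul_smul, mul_inv_cancel₀ h0, one_smul]
    rw [map_smul, norm_smul, Real.norm_of_nonneg (Real.sqrt_nonneg _), mul_smul, h2, ← smul_add]
    congr 1
    abel
  · simp [covFromMoments]

/-- The map has the block matrix `(0 | stackMat V)`, so only the lower right block of `momentCov`,
which is `popSigma`, survives. -/
theorem charFun_map_momentCov (hfour : MemLp (e 0) 4 P) (V : Matrix (Fin d) (Fin d) ℝ) (a : ℝ)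
    (t : EuclideanSpace ℝ (StackIdx d)) :
    charFun ((multivariateGaussian 0 (momentCov (e 0) P)).map
      (fun s => a • stackCLM V (WithLp.toLp 2 fun p => s (Sum.inr p)))) t
      = charFun ((multivariateGaussian 0 (popSigma (e 0) P)).map
        (fun y => a • stackCLM V y)) t := by
  have hpsd : (momentCov (e 0) P).PosSemidef :=
    (posSemidef_of_eq_cov (W := fun ω => (momentVec (e 0 ω)).ofLp) (memLp_momentVec hfour)
      (fun _ _ => rfl)).1
  have hC : momentCov (e 0) P = Matrix.fromBlocks (momentCov (e 0) P).toBlocks₁₁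
      (momentCov (e 0) P).toBlocks₁₂ (momentCov (e 0) P).toBlocks₂₁ (popSigma (e 0) P) :=
    (Matrix.fromBlocks_toBlocks _).symm
  have hM : ∀ s : EuclideanSpace ℝ (Fin d ⊕ HalfIdx d),
      stackCLM V (WithLp.toLp 2 fun p => s (Sum.inr p))
        = WithLp.toLp 2 (Matrix.fromCols (0 : Matrix (StackIdx d) (Fin d) ℝ) (stackMat V) *ᵥ
          s.ofLp) := fun s => by
    rw [stackCLM_apply, Matrix.fromCols_mulVec, Matrix.zero_mulVec, zero_add]
    rfl
  rw [charFun_map_smul_comp (by fun_prop), charFun_map_smul_comp (by fun_prop)]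
  simp only [hM]
  change _ = charFun (Measure.map (fun y : EuclideanSpace ℝ (HalfIdx d) =>
    WithLp.toLp 2 (stackMat V *ᵥ y.ofLp)) _) _
  rw [charFun_map_mulVec_multivariateGaussian hpsd,
    charFun_map_mulVec_multivariateGaussian (posSemidef_popSigma hfour), hC,
    Matrix.fromCols_mul_fromBlocks, Matrix.transpose_fromCols, Matrix.fromCols_mul_fromRows]
  simp

end OneSample

end CombinedTest

namespace CombinedTest

/-! ### The two-sample statistic under the null hypothesis. -/

section TwoSample

variable {d : ℕ} {Ω : Type*} [MeasurableSpace Ω] {P : Measure Ω}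

theorem measurable_sampleOf {X : Fin 2 → ℕ → Ω → EuclideanSpace ℝ (Fin d)}
    (hX : ∀ i k, Measurable (X i k)) (n : Fin 2 → ℕ) : Measurable (sampleOf X n) :=
  measurable_pi_iff.2 fun i => measurable_pi_iff.2 fun k => hX i k

theorem measurable_statT (n : Fin 2 → ℕ) : Measurable (statT (d := d) (n := n)) := by
  have h : ∀ i : Fin 2, Measurable fun x : Sample d n => stackVec (empCov (x i)) := fun i =>
    measurable_stackVec fun j k => (measurable_empCov j k).comp (measurable_pi_apply i)
  exact ((h 0).sub (h 1)).const_smul √((n 0 + n 1 : ℕ) : ℝ)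

theorem tendsto_sqrt_mul_inv_sqrt {n : ℕ → Fin 2 → ℕ} {κ : ℝ} {i : Fin 2} (hκ : 0 < κ)
    (h : Tendsto (fun t => (n t i : ℝ) / ((n t 0 + n t 1 : ℕ) : ℝ)) atTop (𝓝 κ)) :
    Tendsto (fun t => √((n t 0 + n t 1 : ℕ) : ℝ) * (√(n t i : ℝ))⁻¹) atTop (𝓝 √(κ⁻¹)) := by
  refine (h.inv₀ hκ.ne').sqrt.congr fun t => ?_
  rw [inv_div, Real.sqrt_div (Nat.cast_nonneg _), div_eq_mul_inv]

variable [IsProbabilityMeasure P]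

/-- Asymptotic normality of the statistic under the null hypothesis. -/
theorem tendstoInDistribution_statT {μ : Fin 2 → EuclideanSpace ℝ (Fin d)}
    {ε : Fin 2 → ℕ → Ω → EuclideanSpace ℝ (Fin d)}
    (hm : ∀ i k, Measurable (ε i k))
    (hindep : iIndepFun (fun q : Fin 2 × ℕ => ε q.1 q.2) P)
    (hident : ∀ i k, IdentDistrib (ε i k) (ε i 0) P P)
    (hmean : ∀ i, ∫ ω, ε i 0 ω ∂P = 0)
    (hfour : ∀ i, MemLp (ε i 0) 4 P)
    (hpos : ∀ i j, 0 < popCov (ε i 0) P j j)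
    {n : ℕ → Fin 2 → ℕ} {κ : Fin 2 → ℝ} (hn : ∀ i, Tendsto (fun t => n t i) atTop atTop)
    (hκ : ∀ i, 0 < κ i)
    (hnκ : ∀ i, Tendsto (fun t => (n t i : ℝ) / ((n t 0 + n t 1 : ℕ) : ℝ)) atTop (𝓝 (κ i)))
    (hV : popCov (ε 0 0) P = popCov (ε 1 0) P) :
    TendstoInDistribution
      (fun t ω => statT (sampleOf (fun i k ω => μ i + ε i k ω) (n t) ω)) atTop
      (id : EuclideanSpace ℝ (StackIdx d) → _) (fun _ => P)
      (multivariateGaussian 0 (limitCov κ (fun i => ε i 0) P)) := by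
  have hXm : ∀ i k, Measurable fun ω => μ i + ε i k ω := fun i k => (hm i k).const_add _
  have hindep' : ∀ i, iIndepFun (ε i) P := fun i =>
    hindep.precomp (g := fun k : ℕ => ((i, k) : Fin 2 × ℕ)) fun a b h => (Prod.ext_iff.1 h).2
  have hcomp : ∀ t i, Measurable fun ω => stackVec
      (empCov fun k : Fin (n t i) => μ i + ε i k ω) := fun t i =>
    measurable_stackVec fun j k =>
      (measurable_empCov j k).comp (measurable_pi_iff.2 fun l => hXm i l)
  set D : Fin 2 → ℕ → Ω → EuclideanSpace ℝ (StackIdx d) := fun i t ω =>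
    √(n t i : ℝ) • (stackVec (empCov fun k : Fin (n t i) => μ i + ε i k ω)
      - stackVec (popCov (ε i 0) P)) with hD
  have hDm : ∀ i t, Measurable (D i t) := fun i t =>
    ((hcomp t i).sub_const (stackVec (popCov (ε i 0) P))).const_smul √(n t i : ℝ)
  have hDlim : ∀ i (a : ℕ → ℝ) (b : ℝ), Tendsto a atTop (𝓝 b) → ∀ s,
      Tendsto (fun t => charFun (P.map fun ω => a t • D i t ω) s) atTop
        (𝓝 (charFun ((multivariateGaussian 0 (popSigma (ε i 0) P)).map
          (fun y => b • stackCLM (popCov (ε i 0) P) y)) s)) := fun i a b hab s => by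
    have h0 := tendstoInDistribution_stackVec_empCov (hm i) (hindep' i) (hident i) (hmean i)
      (hfour i) (hpos i) (μ i)
    have h1 : TendstoInDistribution (D i) atTop
        (fun s : EuclideanSpace ℝ (Fin d ⊕ HalfIdx d) =>
          stackCLM (popCov (ε i 0) P) (WithLp.toLp 2 fun p => s (Sum.inr p)))
        (fun _ => P) (multivariateGaussian 0 (momentCov (ε i 0) P)) :=
      ⟨fun t => (hDm i t).aemeasurable, h0.aemeasurable_limit, h0.tendsto.comp (hn i)⟩
    have h2 := h1.continuous_comp_prodMk_of_tendstoInMeasure_const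
      (g := fun q : EuclideanSpace ℝ (StackIdx d) × ℝ => q.2 • q.1) (by fun_prop)
      (tendstoInMeasure_of_tendsto (P := P) hab) (fun _ => aemeasurable_const)
    have h3 := ProbabilityMeasure.tendsto_iff_tendsto_charFun.1 h2.tendsto s
    simp only [ProbabilityMeasure.coe_mk] at h3
    rwa [charFun_map_momentCov (hfour i)] at h3
  refine ⟨fun t => ((measurable_statT (n t)).comp
    (measurable_sampleOf hXm (n t))).aemeasurable, aemeasurable_id, ?_⟩
  refine ProbabilityMeasure.tendsto_iff_tendsto_charFun.2 fun s => ?_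
  simp only [ProbabilityMeasure.coe_mk, Measure.map_id]
  rw [← charFun_limitCov hfour hκ]
  have hprod := (hDlim 0 _ _ (tendsto_sqrt_mul_inv_sqrt (hκ 0) (hnκ 0)) s).mul
    (hDlim 1 _ _ (tendsto_sqrt_mul_inv_sqrt (hκ 1) (hnκ 1)).neg s)
  refine hprod.congr' ?_
  filter_upwards [(hn 0).eventually_ne_atTop 0, (hn 1).eventually_ne_atTop 0] with t h0 h1
  set a : Fin 2 → ℝ := fun i => √((n t 0 + n t 1 : ℕ) : ℝ) * (√(n t i : ℝ))⁻¹ with ha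
  -- The two terms depend on disjoint finite families of errors.
  have hind : IndepFun (fun ω => a 0 • D 0 t ω) (fun ω => (-a 1) • D 1 t ω) P := by
    let S : Fin 2 → Finset (Fin 2 × ℕ) := fun i => {i} ×ˢ Finset.range (n t i)
    have hST : Disjoint (S 0) (S 1) := by
      rw [Finset.disjoint_left]
      rintro ⟨i, k⟩ h h'
      simp only [S, Finset.mem_product, Finset.mem_singleton] at h h'
      exact absurd (h.1.symm.trans h'.1) (by decide)
    have hbase := hindep.indepFun_finset (S 0) (S 1) hST fun q => hm q.1 q.2
    have hmem : ∀ (i : Fin 2) (k : Fin (n t i)), ((i, (k : ℕ)) : Fin 2 × ℕ) ∈ S i := fun i k => by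
      simp [S]
    have hφ : ∀ (i : Fin 2) (b : ℝ), Measurable fun z : (q : S i) → EuclideanSpace ℝ (Fin d) =>
        b • √(n t i : ℝ) • (stackVec (empCov fun k : Fin (n t i) => μ i + z ⟨(i, k), hmem i k⟩)
          - stackVec (popCov (ε i 0) P)) := fun i b => by
      have h1 : Measurable fun (z : (q : S i) → EuclideanSpace ℝ (Fin d)) (k : Fin (n t i)) =>
          μ i + z ⟨(i, k), hmem i k⟩ :=
        measurable_pi_iff.2 fun k => (measurable_pi_apply _).const_add _
      have h2 := measurable_stackVec fun j k => (measurable_empCov j k).comp h1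
      exact ((h2.sub_const (stackVec (popCov (ε i 0) P))).const_smul √(n t i : ℝ)).const_smul b
    exact hbase.comp (hφ 0 (a 0)) (hφ 1 (-a 1))
  have hsum := congrFun (hind.charFun_map_add_eq_mul
    ((hDm 0 t).const_smul (a 0)).aemeasurable ((hDm 1 t).const_smul (-a 1)).aemeasurable) s
  rw [Pi.mul_apply] at hsum
  refine hsum.symm.trans ?_
  congr 2
  ext1 ω
  have hne : ∀ i, n t i ≠ 0 → √(n t i : ℝ) ≠ 0 := fun i hi =>
    (Real.sqrt_pos.2 (by exact_mod_cast Nat.pos_of_ne_zero hi)).ne'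
  simp only [Pi.add_apply, Pi.smul_apply, hD, ha, statT]
  -- Here `hV` makes the two population centrings equal, so that they cancel in the difference.
  rw [smul_smul, smul_smul, neg_mul, mul_assoc, mul_assoc, inv_mul_cancel₀ (hne 0 h0),
    inv_mul_cancel₀ (hne 1 h1), mul_one, hV, neg_smul, ← sub_eq_add_neg, ← smul_sub]
  congr 1
  abel

end TwoSample

end CombinedTest

namespace CombinedTest

/-! ### Conditional distributions and product measures. -/

section ConditionalLaw

theorem integral_eq_integral_condDistrib {Ω E F : Type*} [MeasurableSpace Ω] {P : Measure Ω}
    [IsProbabilityMeasure P] [MeasurableSpace E] [MeasurableSpace F] [StandardBorelSpace F]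
    [Nonempty F] {X : Ω → E} {Y : Ω → F} (hX : Measurable X) (hY : Measurable Y)
    {f : E × F → ℝ} (hf : Measurable f) {C : ℝ} (hC : ∀ q, |f q| ≤ C) :
    ∫ ω, f (X ω, Y ω) ∂P = ∫ ω, ∫ y, f (X ω, y) ∂(condDistrib Y X P (X ω)) ∂P := by
  have hint : Integrable (fun ω => f (X ω, Y ω)) P :=
    Integrable.of_bound (hf.comp (hX.prodMk hY)).aestronglyMeasurable C
      (ae_of_all _ fun ω => by simpa using hC _)
  rw [← integral_condExp (μ := P) (m := MeasurableSpace.comap X inferInstance) hX.comap_le]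
  exact integral_congr_ae
    (condExp_prod_ae_eq_integral_condDistrib hX hY.aemeasurable hf.stronglyMeasurable hint)

/-- The conditional law of a function of the data and of a further variable. -/
theorem integral_condDistrib_comp_ae_eq {Ω E F G : Type*} [MeasurableSpace Ω] {P : Measure Ω}
    [IsProbabilityMeasure P] [MeasurableSpace E] [MeasurableSpace F] [StandardBorelSpace F]
    [Nonempty F] [MeasurableSpace G] [StandardBorelSpace G] [Nonempty G]
    {X : Ω → E} {Y : Ω → F} (hX : Measurable X) (hY : Measurable Y)
    {φ : E → F → G} (hφ : Measurable (Function.uncurry φ)) {g : G → ℝ} (hg : Measurable g)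
    {C : ℝ} (hC : ∀ z, |g z| ≤ C) :
    (fun ω => ∫ z, g z ∂(condDistrib (fun ω => φ (X ω) (Y ω)) X P (X ω))) =ᵐ[P]
      fun ω => ∫ y, g (φ (X ω) y) ∂(condDistrib Y X P (X ω)) := by
  have hT : Measurable fun ω => φ (X ω) (Y ω) := hφ.comp (hX.prodMk hY)
  have hint : Integrable (fun ω => g (φ (X ω) (Y ω))) P :=
    Integrable.of_bound (hg.comp hT).aestronglyMeasurable C
      (ae_of_all _ fun ω => by simpa using hC _)
  exact (condExp_ae_eq_integral_condDistrib hX hT.aemeasurable hg.stronglyMeasurable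
    hint).symm.trans (condExp_prod_ae_eq_integral_condDistrib (f := fun q : E × F => g (φ q.1 q.2))
      hX
      hY.aemeasurable (hg.comp hφ).stronglyMeasurable hint)

/-- Grouping the coordinates of a product measure into blocks. -/
theorem map_blocks_pi {β ι F : Type*} [Fintype β] [Fintype ι] [MeasurableSpace F]
    (ν : ι → Measure F) [∀ i, IsProbabilityMeasure (ν i)] :
    (Measure.pi fun q : β × ι => ν q.2).map (fun y b i => y (b, i))
      = Measure.pi fun _ : β => Measure.pi ν := by
  have h := Measure.infinitePi_map_curry (ι := β) (κ := ι) (fun _ i => ν i)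
  simp only [Measure.infinitePi_eq_pi] at h
  exact h

end ConditionalLaw

/-! ### The law of a replicate as a continuous function of its parameters. -/

section ReplicateLaw

variable {d : ℕ}

/-- The parameters of the law of a replicate: covariance matrices of the observations and of the
Gaussian vectors, the weights of the groups and of the quadratic terms. -/
abbrev ReplicateParam (d : ℕ) : Type :=
  (Fin 2 → Fin d → Fin d → ℝ) × (Fin 2 → HalfIdx d → HalfIdx d → ℝ) × (Fin 2 → ℝ) × (Fin 2 → ℝ)

/-- A replicate as a function of the parameters and the Gaussian vectors. -/
noncomputable def replicateMap (θ : ReplicateParam d)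
    (y : Fin 2 → EuclideanSpace ℝ (HalfIdx d)) : EuclideanSpace ℝ (StackIdx d) :=
  θ.2.2.1 0 • taylorMap (Matrix.of (θ.1 0)) (θ.2.2.2 0) (y 0).ofLp
    - θ.2.2.1 1 • taylorMap (Matrix.of (θ.1 1)) (θ.2.2.2 1) (y 1).ofLp

/-- The law of a replicate. -/
noncomputable def replicateLaw (θ : ReplicateParam d) : Measure (EuclideanSpace ℝ (StackIdx d)) :=
  (Measure.pi fun i => multivariateGaussian 0 (Matrix.of (θ.2.1 i))).map (replicateMap θ)

theorem measurable_replicateMap (θ : ReplicateParam d) : Measurable (replicateMap θ) := by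
  have h : ∀ i, Measurable fun y : Fin 2 → EuclideanSpace ℝ (HalfIdx d) =>
      taylorMap (Matrix.of (θ.1 i)) (θ.2.2.2 i) (y i).ofLp := fun i =>
    measurable_taylorMap (V := fun _ => Matrix.of (θ.1 i)) (fun j k => measurable_const) _
      ((WithLp.measurable_ofLp 2 _).comp (measurable_pi_apply i))
  exact ((h 0).const_smul (θ.2.2.1 0)).sub ((h 1).const_smul (θ.2.2.1 1))

instance (θ : ReplicateParam d) : IsProbabilityMeasure (replicateLaw θ) :=
  Measure.isProbabilityMeasure_map (measurable_replicateMap θ).aemeasurable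

/-- The parameters with positive semidefinite covariance matrices of the Gaussian vectors. -/
def admissibleParams (d : ℕ) : Set (ReplicateParam d) :=
  {θ | ∀ i, (Matrix.of (θ.2.1 i)).PosSemidef}

theorem tendsto_replicateMap {α : Type*} {f : Filter α} {θ : α → ReplicateParam d}
    {θ₀ : ReplicateParam d} (hθ : Tendsto θ f (𝓝 θ₀)) (hpos : ∀ i j, 0 < θ₀.1 i j j)
    {y : α → Fin 2 → EuclideanSpace ℝ (HalfIdx d)} {y₀ : Fin 2 → EuclideanSpace ℝ (HalfIdx d)}
    (hy : Tendsto y f (𝓝 y₀)) :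
    Tendsto (fun a => replicateMap (θ a) (y a)) f (𝓝 (replicateMap θ₀ y₀)) := by
  have hV : ∀ i, Tendsto (fun a => (θ a).1 i) f (𝓝 (θ₀.1 i)) := fun i =>
    ((continuous_apply i).comp continuous_fst).continuousAt.tendsto.comp hθ
  have ha : ∀ i, Tendsto (fun a => (θ a).2.2.1 i) f (𝓝 (θ₀.2.2.1 i)) := fun i =>
    (((continuous_apply i).comp continuous_fst).comp
      (continuous_snd.comp continuous_snd)).continuousAt.tendsto.comp hθ
  have hc : ∀ i, Tendsto (fun a => (θ a).2.2.2 i) f (𝓝 (θ₀.2.2.2 i)) := fun i =>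
    (((continuous_apply i).comp continuous_snd).comp
      (continuous_snd.comp continuous_snd)).continuousAt.tendsto.comp hθ
  have hT : ∀ i, Tendsto (fun a => taylorMap (Matrix.of ((θ a).1 i)) ((θ a).2.2.2 i)
      (y a i).ofLp) f (𝓝 (taylorMap (Matrix.of (θ₀.1 i)) (θ₀.2.2.2 i) (y₀ i).ofLp)) := fun i =>
    tendsto_taylorMap (V := fun a => Matrix.of ((θ a).1 i)) (hV i) (hpos i) (hc i)
      (((PiLp.continuous_ofLp 2 _).tendsto _).comp (tendsto_pi_nhds.1 hy i))
  exact ((ha 0).smul (hT 0)).sub ((ha 1).smul (hT 1))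

open scoped MatrixOrder in
-- A coupling: with each Gaussian written as a square root applied to a standard Gaussian, the laws
-- for all parameters are images of a single measure.
theorem replicateLaw_eq_map (θ : ReplicateParam d) :
    replicateLaw θ = (Measure.pi fun _ : Fin 2 => stdGaussian (EuclideanSpace ℝ (HalfIdx d))).map
      (fun x => replicateMap θ fun i =>
        0 + toEuclideanCLM (𝕜 := ℝ) (CFC.sqrt (Matrix.of (θ.2.1 i))) (x i)) := by
  have hm : ∀ i, Measurable fun x : EuclideanSpace ℝ (HalfIdx d) =>
      0 + toEuclideanCLM (𝕜 := ℝ) (CFC.sqrt (Matrix.of (θ.2.1 i))) x := fun i => by fun_prop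
  have hinst : ∀ i, SigmaFinite ((stdGaussian (EuclideanSpace ℝ (HalfIdx d))).map fun x =>
      0 + toEuclideanCLM (𝕜 := ℝ) (CFC.sqrt (Matrix.of (θ.2.1 i))) x) := fun i =>
    have := Measure.isProbabilityMeasure_map (μ := stdGaussian (EuclideanSpace ℝ (HalfIdx d)))
      (hm i).aemeasurable
    inferInstance
  have h := Measure.pi_map_pi (μ := fun _ : Fin 2 => stdGaussian (EuclideanSpace ℝ (HalfIdx d)))
    (f := fun i x => 0 + toEuclideanCLM (𝕜 := ℝ) (CFC.sqrt (Matrix.of (θ.2.1 i))) x)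
    (fun i => (hm i).aemeasurable)
  rw [replicateLaw]
  simp only [multivariateGaussian]
  have hmeas : Measurable fun (x : Fin 2 → EuclideanSpace ℝ (HalfIdx d)) i =>
      0 + toEuclideanCLM (𝕜 := ℝ) (CFC.sqrt (Matrix.of (θ.2.1 i))) (x i) :=
    measurable_pi_iff.2 fun i => (hm i).comp (measurable_pi_apply i)
  rw [← h, Measure.map_map (measurable_replicateMap θ) hmeas]
  rfl

open scoped MatrixOrder in
/-- The law of a replicate depends continuously on the parameters. -/
theorem tendsto_replicateLaw {θ₀ : ReplicateParam d} (hpos : ∀ i j, 0 < θ₀.1 i j j)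
    (hθ₀ : θ₀ ∈ admissibleParams d) :
    Tendsto (β := ProbabilityMeasure (EuclideanSpace ℝ (StackIdx d)))
      (fun θ => ⟨replicateLaw θ, inferInstance⟩) (𝓝[admissibleParams d] θ₀)
      (𝓝 ⟨replicateLaw θ₀, inferInstance⟩) := by
  let Z : ReplicateParam d → (Fin 2 → EuclideanSpace ℝ (HalfIdx d)) →
      EuclideanSpace ℝ (StackIdx d) := fun θ x => replicateMap θ fun i =>
        0 + toEuclideanCLM (𝕜 := ℝ) (CFC.sqrt (Matrix.of (θ.2.1 i))) (x i)
  have hZ : ∀ θ, Measurable (Z θ) := fun θ =>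
    (measurable_replicateMap θ).comp (measurable_pi_iff.2 fun i => by fun_prop)
  have hid : Tendsto (fun θ : ReplicateParam d => θ) (𝓝[admissibleParams d] θ₀) (𝓝 θ₀) :=
    tendsto_id'.2 nhdsWithin_le_nhds
  have hS : ∀ i, Tendsto (fun θ : ReplicateParam d => Matrix.of (θ.2.1 i))
      (𝓝[admissibleParams d] θ₀) (𝓝 (Matrix.of (θ₀.2.1 i))) := fun i =>
    (((continuous_apply i).comp continuous_fst).comp continuous_snd).continuousAt.tendsto.comp hid
  have hlim : ∀ x, Tendsto (fun θ => Z θ x) (𝓝[admissibleParams d] θ₀) (𝓝 (Z θ₀ x)) := fun x => by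
    refine tendsto_replicateMap hid hpos (tendsto_pi_nhds.2 fun i => ?_)
    refine tendsto_const_nhds.add ?_
    have hsq := tendsto_matrix_sqrt (hS i)
      (eventually_mem_nhdsWithin.mono fun θ hθ => hθ i) (hθ₀ i)
    have : Continuous fun A : Matrix (HalfIdx d) (HalfIdx d) ℝ =>
        toEuclideanCLM (𝕜 := ℝ) A (x i) := by
      have h : (fun A : Matrix (HalfIdx d) (HalfIdx d) ℝ => toEuclideanCLM (𝕜 := ℝ) A (x i))
          = fun A => WithLp.toLp 2 (A *ᵥ (x i).ofLp) := rfl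
      rw [h]
      exact (PiLp.continuous_toLp 2 _).comp (continuous_id.matrix_mulVec continuous_const)
    exact this.continuousAt.tendsto.comp hsq
  -- On the common probability space of the coupling the replicates converge at every point, hence
  -- in distribution.
  have h := (tendstoInDistribution_of_ae_tendsto
    (μ' := Measure.pi fun _ : Fin 2 => stdGaussian (EuclideanSpace ℝ (HalfIdx d)))
    (fun θ => (hZ θ).aemeasurable) (hZ θ₀).aemeasurable (ae_of_all _ hlim)).tendsto
  have heq : ∀ θ, (⟨replicateLaw θ, inferInstance⟩ : ProbabilityMeasure _)
      = ⟨_, Measure.isProbabilityMeasure_map (hZ θ).aemeasurable⟩ := fun θ =>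
    Subtype.ext (replicateLaw_eq_map θ)
  rw [heq θ₀]
  exact h.congr fun θ => (heq θ).symm

end ReplicateLaw

/-! ### The law at the limit parameter. -/

section LimitLaw

variable {d : ℕ} {Ω : Type*} [MeasurableSpace Ω] {P : Measure Ω} [IsProbabilityMeasure P]

/-- The parameters in the limit. -/
noncomputable def limitParam (κ : Fin 2 → ℝ) (e : Fin 2 → Ω → EuclideanSpace ℝ (Fin d))
    (P : Measure Ω) : ReplicateParam d :=
  (fun i j k => popCov (e i) P j k, fun i j k => popSigma (e i) P j k, fun i => √((κ i)⁻¹),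
    fun _ => 0)

/-- At quadratic weight `0` a replicate is a difference of linear images of two independent Gaussian
vectors, so its characteristic function is the product in `charFun_limitCov`. -/
theorem replicateLaw_limitParam {e : Fin 2 → Ω → EuclideanSpace ℝ (Fin d)}
    (he : ∀ i, MemLp (e i) 4 P) {κ : Fin 2 → ℝ} (hκ : ∀ i, 0 < κ i) :
    replicateLaw (limitParam κ e P) = multivariateGaussian 0 (limitCov κ e P) := by
  refine Measure.ext_of_charFun (funext fun t => ?_)
  rw [← charFun_limitCov he hκ]
  set G : Fin 2 → Measure (EuclideanSpace ℝ (HalfIdx d)) := fun i =>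
    multivariateGaussian 0 (popSigma (e i) P) with hG
  let W : Fin 2 → EuclideanSpace ℝ (HalfIdx d) → EuclideanSpace ℝ (StackIdx d) := fun i y =>
    (if i = 0 then √((κ 0)⁻¹) else -√((κ 1)⁻¹)) • stackCLM (popCov (e i) P) y
  have hW : ∀ i, Measurable (W i) := fun i => by fun_prop
  have hind : iIndepFun (fun i (y : Fin 2 → EuclideanSpace ℝ (HalfIdx d)) => W i (y i))
      (Measure.pi G) := iIndepFun_pi fun i => (hW i).aemeasurable
  have h01 := hind.indepFun (show (0 : Fin 2) ≠ 1 by decide)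
  have hsum : charFun ((Measure.pi G).map fun y => W 0 (y 0) + W 1 (y 1)) t
      = (charFun ((Measure.pi G).map fun y => W 0 (y 0))
        * charFun ((Measure.pi G).map fun y => W 1 (y 1))) t := congrFun (h01.charFun_map_add_eq_mul
    ((hW 0).comp (measurable_pi_apply 0)).aemeasurable
    ((hW 1).comp (measurable_pi_apply 1)).aemeasurable) t
  have hmap : ∀ i, (Measure.pi G).map (fun y => W i (y i)) = (G i).map (W i) := fun i => by
    rw [← (measurePreserving_eval G i).map_eq, Measure.map_map (hW i) (measurable_pi_apply i)]
    rfl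
  rw [Pi.mul_apply, hmap 0, hmap 1] at hsum
  refine Eq.trans ?_ (hsum.trans ?_)
  · rw [replicateLaw]
    congr 2
    ext1 y
    simp only [replicateMap, limitParam, taylorMap_zero, W, if_true, if_false,
      one_ne_zero, neg_smul, ← sub_eq_add_neg, stackCLM_apply]
    rfl
  · simp [W, hG]

end LimitLaw

/-! ### The data-dependent parameter and its consistency. -/

section Replicates

variable {d : ℕ} {n : Fin 2 → ℕ}

/-- The parameters of the law of a replicate given the sample. -/
noncomputable def sampleParam (Shat : Fin 2 → (m : ℕ) → (Fin m → EuclideanSpace ℝ (Fin d)) →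
    Matrix (HalfIdx d) (HalfIdx d) ℝ) (x : Sample d n) : ReplicateParam d :=
  (fun i j k => empCov (x i) j k, fun i j k => Shat i (n i) (x i) j k,
    fun i => √((n 0 + n 1 : ℕ) : ℝ) * (√(n i : ℝ))⁻¹, fun i => (√(n i : ℝ))⁻¹)

theorem taylorT_eq_replicateMap (Shat : Fin 2 → (m : ℕ) →
    (Fin m → EuclideanSpace ℝ (Fin d)) → Matrix (HalfIdx d) (HalfIdx d) ℝ) (x : Sample d n)
    (y : Fin 2 → EuclideanSpace ℝ (HalfIdx d)) :
    taylorT x y = replicateMap (sampleParam Shat x) y := by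
  simp only [taylorT, replicateMap, sampleParam, smul_sub, smul_smul]
  rfl

theorem measurable_taylorT : Measurable fun q : Sample d n ×
    (Fin 2 → EuclideanSpace ℝ (HalfIdx d)) => taylorT q.1 q.2 := by
  have h : ∀ i : Fin 2, Measurable fun q : Sample d n ×
      (Fin 2 → EuclideanSpace ℝ (HalfIdx d)) =>
      taylorMap (empCov (q.1 i)) (√(n i : ℝ))⁻¹ (q.2 i).ofLp := fun i =>
    measurable_taylorMap (fun j k => (measurable_empCov j k).comp
      ((measurable_pi_apply i).comp measurable_fst)) _
      ((WithLp.measurable_ofLp 2 _).comp ((measurable_pi_apply i).comp measurable_snd))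
  exact (((h 0).const_smul (√(n 0 : ℝ))⁻¹).sub ((h 1).const_smul (√(n 1 : ℝ))⁻¹)).const_smul
    √((n 0 + n 1 : ℕ) : ℝ)

end Replicates

section Consistency

variable {d : ℕ} {Ω : Type*} [MeasurableSpace Ω] {P : Measure Ω}

theorem tendstoInMeasure_sampleParam {e : Fin 2 → Ω → EuclideanSpace ℝ (Fin d)}
    {X : Fin 2 → ℕ → Ω → EuclideanSpace ℝ (Fin d)}
    {Shat : Fin 2 → (m : ℕ) → (Fin m → EuclideanSpace ℝ (Fin d)) →
      Matrix (HalfIdx d) (HalfIdx d) ℝ}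
    (hV : ∀ i j k, TendstoInMeasure P
      (fun m ω => empCov (fun l : Fin m => X i l ω) j k) atTop (fun _ => popCov (e i) P j k))
    (hS : ∀ i, IsConsistentCovEstimator P (X i) (popSigma (e i) P) (Shat i))
    {n : ℕ → Fin 2 → ℕ} {κ : Fin 2 → ℝ} (hn : ∀ i, Tendsto (fun t => n t i) atTop atTop)
    (hκ : ∀ i, 0 < κ i)
    (hnκ : ∀ i, Tendsto (fun t => (n t i : ℝ) / ((n t 0 + n t 1 : ℕ) : ℝ)) atTop (𝓝 (κ i))) :
    TendstoInMeasure P (fun t ω => sampleParam Shat (sampleOf X (n t) ω)) atTop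
      (fun _ => limitParam κ e P) := by
  refine tendstoInMeasure_prodMk ?_ (tendstoInMeasure_prodMk ?_ (tendstoInMeasure_prodMk ?_ ?_))
  · exact tendstoInMeasure_pi fun i => tendstoInMeasure_pi fun j => tendstoInMeasure_pi fun k =>
      (hV i j k).comp (hn i)
  · exact tendstoInMeasure_pi fun i => tendstoInMeasure_pi fun j => tendstoInMeasure_pi fun k =>
      ((hS i).consistent j k).comp (hn i)
  · exact tendstoInMeasure_pi fun i => tendstoInMeasure_of_tendsto
      (tendsto_sqrt_mul_inv_sqrt (hκ i) (hnκ i))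
  · exact tendstoInMeasure_pi fun i => tendstoInMeasure_of_tendsto
      (tendsto_inv_sqrt_natCast.comp (hn i))

end Consistency

end CombinedTest

namespace CombinedTest

/-! ### Replicates given the data. -/

section MonteCarlo

theorem measurable_taylorT_blocks {d : ℕ} {n : Fin 2 → ℕ} (B : ℕ) : Measurable
    fun (q : Sample d n × (Fin B × Fin 2 → EuclideanSpace ℝ (HalfIdx d))) (b : Fin B) =>
      taylorT q.1 fun i => q.2 (b, i) := by
  refine measurable_pi_iff.2 fun b => ?_
  have h : Measurable fun q : Sample d n × (Fin B × Fin 2 → EuclideanSpace ℝ (HalfIdx d)) =>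
      (q.1, fun i => q.2 (b, i)) :=
    measurable_fst.prodMk (measurable_pi_iff.2 fun i =>
      (measurable_pi_apply (b, i)).comp measurable_snd)
  simpa only [Function.comp_def] using (measurable_taylorT (d := d) (n := n)).comp h

theorem measurable_replicate {d : ℕ} {Ω : Type*} [MeasurableSpace Ω]
    {X : Fin 2 → ℕ → Ω → EuclideanSpace ℝ (Fin d)} (hX : ∀ i k, Measurable (X i k)) (n : Fin 2 → ℕ)
    {Y : Fin 2 → Ω → EuclideanSpace ℝ (HalfIdx d)} (hY : ∀ i, Measurable (Y i)) :
    Measurable fun ω => taylorT (sampleOf X n ω) fun i => Y i ω := by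
  have h : Measurable fun ω => (sampleOf X n ω, fun i => Y i ω) :=
    (measurable_sampleOf hX n).prodMk (measurable_pi_iff.2 hY)
  simpa only [Function.comp_def] using (measurable_taylorT (d := d) (n := n)).comp h

variable {d : ℕ} {Ω : Type*} [MeasurableSpace Ω] {P : Measure Ω} [IsProbabilityMeasure P]
  {X : Fin 2 → ℕ → Ω → EuclideanSpace ℝ (Fin d)} {n : Fin 2 → ℕ}
  {Shat : Fin 2 → (m : ℕ) → (Fin m → EuclideanSpace ℝ (Fin d)) →
    Matrix (HalfIdx d) (HalfIdx d) ℝ}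
  {Y : ℕ → Fin 2 → Ω → EuclideanSpace ℝ (HalfIdx d)}

/-- Given the sample, the replicates are independent with law `replicateLaw`. -/
theorem map_condDistrib_replicates (hY : IsMonteCarlo P X n Shat Y) (B : ℕ) :
    ∀ᵐ ω ∂P, (condDistrib (fun ω' (q : Fin B × Fin 2) => Y q.1 q.2 ω') (sampleOf X n) P
        (sampleOf X n ω)).map (fun y b => taylorT (sampleOf X n ω) fun i => y (b, i)) =
      Measure.pi fun _ : Fin B => replicateLaw (sampleParam Shat (sampleOf X n ω)) := by
  filter_upwards [hY.2 B] with ω hω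
  rw [hω]
  set θ := sampleParam Shat (sampleOf X n ω) with hθ
  have h := map_blocks_pi (β := Fin B) fun i =>
    multivariateGaussian 0 (Shat i (n i) (sampleOf X n ω i))
  have h2 := Measure.pi_map_pi (μ := fun _ : Fin B => Measure.pi fun i =>
    multivariateGaussian 0 (Matrix.of (θ.2.1 i))) (f := fun _ => replicateMap θ)
    (hμ := fun _ => inferInstanceAs (SigmaFinite (replicateLaw θ)))
    (fun _ => (measurable_replicateMap θ).aemeasurable)
  refine Eq.trans ?_ h2
  have h' : (Measure.pi fun _ : Fin B => Measure.pi fun i =>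
      multivariateGaussian 0 (Matrix.of (θ.2.1 i))) = _ := h.symm
  have hm : Measurable fun (z : Fin B → Fin 2 → EuclideanSpace ℝ (HalfIdx d)) b =>
      replicateMap θ (z b) :=
    measurable_pi_iff.2 fun b => (measurable_replicateMap θ).comp (measurable_pi_apply b)
  rw [h', Measure.map_map hm (by fun_prop)]
  congr 1
  ext1 y
  exact funext fun b => taylorT_eq_replicateMap Shat _ _

theorem integral_condDistrib_replicates (hY : IsMonteCarlo P X n Shat Y) (B : ℕ)
    {f : (Fin B → EuclideanSpace ℝ (StackIdx d)) → ℝ} (hf : Measurable f) :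
    (fun ω => ∫ y, f (fun b => taylorT (sampleOf X n ω) fun i => y (b, i))
        ∂(condDistrib (fun ω' (q : Fin B × Fin 2) => Y q.1 q.2 ω') (sampleOf X n) P
          (sampleOf X n ω))) =ᵐ[P]
      fun ω => ∫ z, f z ∂(Measure.pi fun _ : Fin B =>
        replicateLaw (sampleParam Shat (sampleOf X n ω))) := by
  filter_upwards [map_condDistrib_replicates hY B] with ω hω
  rw [← hω, integral_map _ hf.aestronglyMeasurable]
  have h := (measurable_taylorT_blocks B).comp (measurable_prodMk_left (x := sampleOf X n ω))
  simp only [Function.comp_def] at h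
  exact h.aemeasurable

/-- Measurability is inherited from the kernel `condDistrib`, with which the integrals agree almost
everywhere; measurability of `replicateLaw` in its parameter is not needed. -/
theorem aestronglyMeasurable_integral_replicateLaw (hX : ∀ i k, Measurable (X i k))
    (hY : IsMonteCarlo P X n Shat Y) (B : ℕ)
    {f : (Fin B → EuclideanSpace ℝ (StackIdx d)) → ℝ} (hf : Measurable f) :
    AEStronglyMeasurable (fun ω => ∫ z, f z ∂(Measure.pi fun _ : Fin B =>
      replicateLaw (sampleParam Shat (sampleOf X n ω)))) P := by
  refine AEStronglyMeasurable.congr ?_ (integral_condDistrib_replicates hY B hf)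
  exact AEStronglyMeasurable.integral_condDistrib
    (f := fun q : Sample d n × (Fin B × Fin 2 → EuclideanSpace ℝ (HalfIdx d)) =>
      f fun b => taylorT q.1 fun i => q.2 (b, i))
    (measurable_sampleOf hX n).aemeasurable
    (measurable_pi_iff.2 fun q : Fin B × Fin 2 => hY.1 q.1 q.2).aemeasurable
    (hf.comp (measurable_taylorT_blocks B)).aestronglyMeasurable

theorem integral_replicates (hX : ∀ i k, Measurable (X i k))
    (hY : IsMonteCarlo P X n Shat Y) (B : ℕ)
    {f : (Fin B → EuclideanSpace ℝ (StackIdx d)) → ℝ} (hf : Measurable f) {C : ℝ}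
    (hC : ∀ z, |f z| ≤ C) :
    ∫ ω, f (fun b => taylorT (sampleOf X n ω) fun i => Y b i ω) ∂P
      = ∫ ω, ∫ z, f z ∂(Measure.pi fun _ : Fin B =>
        replicateLaw (sampleParam Shat (sampleOf X n ω))) ∂P := by
  rw [← integral_congr_ae (integral_condDistrib_replicates hY B hf)]
  exact integral_eq_integral_condDistrib (measurable_sampleOf hX n)
    (measurable_pi_iff.2 fun q : Fin B × Fin 2 => hY.1 q.1 q.2)
    (f := fun q => f fun b => taylorT q.1 fun i => q.2 (b, i))
    (hf.comp (measurable_taylorT_blocks B)) (fun q => hC _)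

theorem integral_pi_eval {E : Type*} [MeasurableSpace E] {B : ℕ} (ρ : Measure E)
    [IsProbabilityMeasure ρ] (b : Fin B) {g : E → ℝ} (hg : Measurable g) :
    ∫ z, g (z b) ∂(Measure.pi fun _ : Fin B => ρ) = ∫ z, g z ∂ρ := by
  have h := (measurePreserving_eval (fun _ : Fin B => ρ) b).map_eq
  conv_rhs => rw [← h]
  rw [integral_map (measurable_pi_apply b).aemeasurable hg.aestronglyMeasurable]

theorem aestronglyMeasurable_integral_replicateLaw_single (hX : ∀ i k, Measurable (X i k))
    (hY : IsMonteCarlo P X n Shat Y)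
    {g : EuclideanSpace ℝ (StackIdx d) → ℝ} (hg : Measurable g) :
    AEStronglyMeasurable (fun ω => ∫ z, g z
      ∂(replicateLaw (sampleParam Shat (sampleOf X n ω)))) P := by
  have h := aestronglyMeasurable_integral_replicateLaw hX hY 1 (f := fun z => g (z 0))
    (hg.comp (measurable_pi_apply 0))
  simpa only [integral_pi_eval _ (0 : Fin 1) hg] using h

theorem integral_replicate (hX : ∀ i k, Measurable (X i k))
    (hY : IsMonteCarlo P X n Shat Y) (b : ℕ)
    {g : EuclideanSpace ℝ (StackIdx d) → ℝ} (hg : Measurable g) {C : ℝ} (hC : ∀ z, |g z| ≤ C) :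
    ∫ ω, g (taylorT (sampleOf X n ω) fun i => Y b i ω) ∂P
      = ∫ ω, ∫ z, g z ∂(replicateLaw (sampleParam Shat (sampleOf X n ω))) ∂P := by
  -- Replicate `b` is the last of the first `b + 1` replicates.
  have h := integral_replicates hX hY (b + 1) (f := fun z => g (z (Fin.last b)))
    (hg.comp (measurable_pi_apply _)) (fun z => hC _)
  simpa only [integral_pi_eval _ (Fin.last b) hg, Fin.val_last] using h

theorem integral_condDistrib_replicate (hX : ∀ i k, Measurable (X i k))
    (hY : IsMonteCarlo P X n Shat Y) (b : ℕ)
    {g : EuclideanSpace ℝ (StackIdx d) → ℝ} (hg : Measurable g) {C : ℝ} (hC : ∀ z, |g z| ≤ C) :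
    (fun ω => ∫ z, g z ∂(condDistrib (fun ω => taylorT (sampleOf X n ω) fun i => Y b i ω)
        (sampleOf X n) P (sampleOf X n ω))) =ᵐ[P]
      fun ω => ∫ z, g z ∂(replicateLaw (sampleParam Shat (sampleOf X n ω))) := by
  have h1 := integral_condDistrib_comp_ae_eq (P := P) (measurable_sampleOf hX n)
    (measurable_pi_iff.2 fun q : Fin (b + 1) × Fin 2 => hY.1 q.1 q.2)
    (φ := fun x y => taylorT x fun i => y (Fin.last b, i))
    ((measurable_pi_apply (Fin.last b)).comp (measurable_taylorT_blocks (b + 1))) hg hC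
  have h2 := integral_condDistrib_replicates hY (b + 1) (f := fun z => g (z (Fin.last b)))
    (hg.comp (measurable_pi_apply _))
  refine (h1.trans h2).trans (ae_of_all _ fun ω => ?_)
  exact integral_pi_eval _ _ hg

end MonteCarlo

/-! ### Weak convergence of the replicates, given the data and unconditionally. -/

section WeakConvergence

variable {d : ℕ} {Ω : Type*} [MeasurableSpace Ω] {P : Measure Ω}
  {X : Fin 2 → ℕ → Ω → EuclideanSpace ℝ (Fin d)} {n : ℕ → Fin 2 → ℕ}
  {Shat : Fin 2 → (m : ℕ) → (Fin m → EuclideanSpace ℝ (Fin d)) →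
    Matrix (HalfIdx d) (HalfIdx d) ℝ}
  {Y : ℕ → ℕ → Fin 2 → Ω → EuclideanSpace ℝ (HalfIdx d)} {θ₀ : ReplicateParam d}

theorem sampleParam_mem_admissibleParams (hS : ∀ i m x, (Shat i m x).PosSemidef)
    {n : Fin 2 → ℕ} (x : Sample d n) : sampleParam Shat x ∈ admissibleParams d :=
  fun i => hS i (n i) (x i)

/-- The conditional laws of the replicates converge weakly in probability. -/
theorem tendstoInMeasure_integral_replicateLaw (hpos : ∀ i j, 0 < θ₀.1 i j j)
    (hθ₀ : θ₀ ∈ admissibleParams d) (hS : ∀ i m x, (Shat i m x).PosSemidef)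
    (hθ : TendstoInMeasure P (fun t ω => sampleParam Shat (sampleOf X (n t) ω)) atTop
      (fun _ => θ₀)) (g : EuclideanSpace ℝ (StackIdx d) →ᵇ ℝ) :
    TendstoInMeasure P (fun t ω => ∫ z, g z
      ∂(replicateLaw (sampleParam Shat (sampleOf X (n t) ω)))) atTop
      (fun _ => ∫ z, g z ∂(replicateLaw θ₀)) :=
  tendstoInMeasure_comp_of_tendsto_nhdsWithin (f := fun θ => ∫ z, g z ∂(replicateLaw θ)) hθ
    (fun _ _ => sampleParam_mem_admissibleParams hS _)
    (ProbabilityMeasure.tendsto_iff_forall_integral_tendsto.1 (tendsto_replicateLaw hpos hθ₀) g)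

/-- The portmanteau theorem makes `θ ↦ replicateLaw θ A` continuous at `θ₀` within the admissible
parameters; then continuous mapping applies. -/
theorem tendstoInMeasure_replicateLaw_real (hpos : ∀ i j, 0 < θ₀.1 i j j)
    (hθ₀ : θ₀ ∈ admissibleParams d) (hS : ∀ i m x, (Shat i m x).PosSemidef)
    (hθ : TendstoInMeasure P (fun t ω => sampleParam Shat (sampleOf X (n t) ω)) atTop
      (fun _ => θ₀)) {A : Set (EuclideanSpace ℝ (StackIdx d))}
    (hA : replicateLaw θ₀ (frontier A) = 0) :
    TendstoInMeasure P (fun t ω =>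
      (replicateLaw (sampleParam Shat (sampleOf X (n t) ω))).real A) atTop
      (fun _ => (replicateLaw θ₀).real A) :=
  tendstoInMeasure_comp_of_tendsto_nhdsWithin (f := fun θ => (replicateLaw θ).real A) hθ
    (fun _ _ => sampleParam_mem_admissibleParams hS _)
    ((ENNReal.tendsto_toReal (measure_ne_top _ _)).comp
      (ProbabilityMeasure.tendsto_measure_of_null_frontier_of_tendsto'
        (tendsto_replicateLaw hpos hθ₀) hA))

variable [IsProbabilityMeasure P]

theorem tendstoInMeasure_integral_condDistrib_replicate (hX : ∀ i k, Measurable (X i k))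
    (hpos : ∀ i j, 0 < θ₀.1 i j j)
    (hθ₀ : θ₀ ∈ admissibleParams d) (hS : ∀ i m x, (Shat i m x).PosSemidef)
    (hθ : TendstoInMeasure P (fun t ω => sampleParam Shat (sampleOf X (n t) ω)) atTop
      (fun _ => θ₀)) (hY : ∀ t, IsMonteCarlo P X (n t) Shat (Y t)) (b : ℕ)
    (g : EuclideanSpace ℝ (StackIdx d) →ᵇ ℝ) :
    TendstoInMeasure P (fun t ω => ∫ z, g z
      ∂(condDistrib (fun ω => taylorT (sampleOf X (n t) ω) fun i => Y t b i ω)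
        (sampleOf X (n t)) P (sampleOf X (n t) ω))) atTop
      (fun _ => ∫ z, g z ∂(replicateLaw θ₀)) :=
  (tendstoInMeasure_integral_replicateLaw hpos hθ₀ hS hθ g).congr_left fun t =>
    (integral_condDistrib_replicate hX (hY t) b g.continuous.measurable
      (fun z => g.norm_coe_le_norm z)).symm

/-- The conditional expectations of a bounded continuous function converge in probability and are
bounded, so their expectations converge. -/
theorem tendstoInDistribution_replicate (hX : ∀ i k, Measurable (X i k))
    (hpos : ∀ i j, 0 < θ₀.1 i j j)
    (hθ₀ : θ₀ ∈ admissibleParams d) (hS : ∀ i m x, (Shat i m x).PosSemidef)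
    (hθ : TendstoInMeasure P (fun t ω => sampleParam Shat (sampleOf X (n t) ω)) atTop
      (fun _ => θ₀)) (hY : ∀ t, IsMonteCarlo P X (n t) Shat (Y t)) (b : ℕ) :
    TendstoInDistribution (fun t ω => taylorT (sampleOf X (n t) ω) fun i => Y t b i ω) atTop
      (id : EuclideanSpace ℝ (StackIdx d) → _) (fun _ => P) (replicateLaw θ₀) := by
  have hm : ∀ t, Measurable fun ω => taylorT (sampleOf X (n t) ω) fun i => Y t b i ω := fun t =>
    measurable_replicate hX (n t) ((hY t).1 b)
  refine ⟨fun t => (hm t).aemeasurable, aemeasurable_id, ?_⟩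
  refine ProbabilityMeasure.tendsto_iff_forall_integral_tendsto.2 fun g => ?_
  simp only [ProbabilityMeasure.coe_mk, Measure.map_id]
  have h := tendsto_integral_of_tendstoInMeasure_of_bounded
    (fun t => aestronglyMeasurable_integral_replicateLaw_single hX (hY t) g.continuous.measurable)
    (C := ‖g‖) (fun t ω => ?_) (tendstoInMeasure_integral_replicateLaw hpos hθ₀ hS hθ g)
  · refine h.congr fun t => ?_
    rw [integral_map (hm t).aemeasurable g.continuous.measurable.aestronglyMeasurable]
    exact (integral_replicate hX (hY t) b g.continuous.measurable
      (fun z => g.norm_coe_le_norm z)).symm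
  · exact (BoundedContinuousFunction.norm_integral_le_norm _ g)

end WeakConvergence

end CombinedTest

namespace CombinedTest

/-! ### Fractions of values in a set and their mean squared error. -/

section Frequency

/-- The fraction of the values `x₁, …, x_B` that satisfy `p`. -/
noncomputable def freq {E : Type*} {B : ℕ} (x : Fin B → E) (p : E → Prop) : ℝ :=
  (Nat.card {b : Fin B // p (x b)} : ℝ) / B

theorem freq_nonneg {E : Type*} {B : ℕ} (x : Fin B → E) (p : E → Prop) : 0 ≤ freq x p := by
  unfold freq
  positivity

theorem freq_mono {E : Type*} {B : ℕ} {x : Fin B → E} {p q : E → Prop}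
    (h : ∀ b, p (x b) → q (x b)) : freq x p ≤ freq x q := by
  unfold freq
  gcongr
  exact Nat.card_le_card_of_injective (Subtype.map id h) (Subtype.map_injective _ fun _ _ h => h)

theorem freq_le_one {E : Type*} {B : ℕ} (x : Fin B → E) (p : E → Prop) : freq x p ≤ 1 := by
  refine div_le_one_of_le₀ ?_ (Nat.cast_nonneg _)
  have := Nat.card_le_card_of_injective (Subtype.val : {b : Fin B // p (x b)} → Fin B)
    Subtype.val_injective
  rw [Nat.card_fin] at this
  exact_mod_cast this

theorem freq_of_forall {E : Type*} {B : ℕ} (hB : 0 < B) {x : Fin B → E} {p : E → Prop}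
    (h : ∀ b, p (x b)) : freq x p = 1 := by
  have : Nat.card {b : Fin B // p (x b)} = B := by
    simp [h]
  rw [freq, this, div_self (by exact_mod_cast hB.ne')]

theorem freq_of_forall_not {E : Type*} {B : ℕ} {x : Fin B → E} {p : E → Prop}
    (h : ∀ b, ¬ p (x b)) : freq x p = 0 := by
  have : IsEmpty {b : Fin B // p (x b)} := ⟨fun b => h b.1 b.2⟩
  simp [freq]

theorem exists_of_freq_pos {E : Type*} {B : ℕ} {x : Fin B → E} {p : E → Prop}
    (h : 0 < freq x p) : ∃ b, p (x b) := by
  by_contra! hcon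
  exact h.ne' (freq_of_forall_not hcon)

theorem forall_of_one_le_freq {E : Type*} {B : ℕ} (hB : 0 < B) {x : Fin B → E} {p : E → Prop}
    (h : 1 ≤ freq x p) (b : Fin B) : p (x b) := by
  classical
  by_contra hb
  have h1 : Nat.card {b : Fin B // p (x b)} < B := by
    rw [Nat.card_eq_fintype_card]
    conv_rhs => rw [← Fintype.card_fin B]
    exact Fintype.card_subtype_lt hb
  have h2 : freq x p < 1 := (div_lt_one (by exact_mod_cast hB)).2 (by exact_mod_cast h1)
  linarith

theorem freq_eq_sum_indicator {E : Type*} {B : ℕ} (x : Fin B → E) (S : Set E) :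
    freq x (· ∈ S) = (B : ℝ)⁻¹ * ∑ b, S.indicator (1 : E → ℝ) (x b) := by
  classical
  rw [freq, Nat.card_eq_fintype_card, Fintype.card_subtype, div_eq_inv_mul]
  congr 1
  simp only [Set.indicator_apply, Pi.one_apply]
  rw [Finset.sum_boole]

variable {E : Type*} [MeasurableSpace E]

theorem measurable_freq {B : ℕ} {S : Set E} (hS : MeasurableSet S) :
    Measurable fun x : Fin B → E => freq x (· ∈ S) := by
  simp only [freq_eq_sum_indicator]
  exact (Finset.measurable_sum _ fun b _ =>
    (measurable_one.indicator hS).comp (measurable_pi_apply b)).const_mul _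

/-- The mean squared deviation of the fraction of independent values in a set. -/
theorem integral_sq_freq_sub_le (ρ : Measure E) [IsProbabilityMeasure ρ] {S : Set E}
    (hS : MeasurableSet S) (p : ℝ) {B : ℕ} (hB : 0 < B) :
    ∫ x, (freq x (· ∈ S) - p) ^ 2 ∂(Measure.pi fun _ : Fin B => ρ)
      ≤ (B : ℝ)⁻¹ + (ρ.real S - p) ^ 2 := by
  have hB0 : (0 : ℝ) < B := by exact_mod_cast hB
  set I : E → ℝ := S.indicator 1 with hI
  have hIm : Measurable I := measurable_one.indicator hS
  have hI01 : ∀ z, I z ∈ Set.Icc (0 : ℝ) 1 := fun z => by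
    by_cases hz : z ∈ S <;> simp [hI, hz]
  have hI2 : MemLp I 2 ρ := MemLp.of_bound hIm.aestronglyMeasurable 1 (ae_of_all _ fun z => by
    rw [Real.norm_of_nonneg (hI01 z).1]; exact (hI01 z).2)
  have hIint : ∫ z, I z ∂ρ = ρ.real S := by
    rw [hI, integral_indicator_one hS]
  set π := Measure.pi fun _ : Fin B => ρ
  set F : (Fin B → E) → ℝ := ∑ b : Fin B, fun x => I (x b) with hF
  have hFL : MemLp F 2 π := memLp_finsetSum' _ fun b _ =>
    hI2.comp_measurePreserving (measurePreserving_eval _ b)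
  have hvar : Var[F; π] ≤ B := by
    rw [hF, variance_sum_pi fun _ => hI2]
    have h1 : Var[I; ρ] ≤ 1 := by
      refine (variance_le_sub_mul_sub (ae_of_all _ hI01) hIm.aemeasurable).trans ?_
      rw [hIint]
      nlinarith [measureReal_nonneg (μ := ρ) (s := S), measureReal_le_one (μ := ρ) (s := S)]
    calc ∑ _b : Fin B, Var[I; ρ] ≤ ∑ _b : Fin B, (1 : ℝ) := Finset.sum_le_sum fun _ _ => h1
      _ = B := by simp
  have hmean : ∫ x, F x ∂π = B * ρ.real S := by
    simp only [hF, Finset.sum_apply]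
    have hIb : ∀ b : Fin B, Integrable (fun x => I (x b)) π := fun b =>
      (hI2.comp_measurePreserving (measurePreserving_eval _ b)).integrable one_le_two
    rw [integral_finsetSum _ fun b _ => hIb b]
    simp [π, integral_pi_eval ρ _ hIm, hIint]
  have hfreq : ∀ x : Fin B → E, freq x (· ∈ S) = (B : ℝ)⁻¹ * F x := fun x => by
    rw [freq_eq_sum_indicator, hF, Finset.sum_apply]
  have hG : MemLp (fun x => (B : ℝ)⁻¹ * F x) 2 π := hFL.const_mul _
  have hGp : MemLp (fun x => (B : ℝ)⁻¹ * F x - p) 2 π := hG.sub (memLp_const p)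
  have hvG : Var[fun x => (B : ℝ)⁻¹ * F x - p; π] = ((B : ℝ)⁻¹) ^ 2 * Var[F; π] := by
    rw [variance_sub_const hG.aestronglyMeasurable, variance_const_mul]
  -- Bias and variance: `p` need not be the mass of `S`, because the law of the replicates varies
  -- with the data while `p` is the limiting mass.
  have hdec := variance_eq_sub hGp
  have hmG : ∫ x, ((B : ℝ)⁻¹ * F x - p) ∂π = ρ.real S - p := by
    rw [integral_sub (hG.integrable one_le_two) (integrable_const p), integral_const_mul, hmean,
      inv_mul_cancel_left₀ hB0.ne']
    simp
  rw [hvG, hmG] at hdec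
  simp only [Pi.pow_apply] at hdec
  simp only [hfreq]
  have hle : ((B : ℝ)⁻¹) ^ 2 * Var[F; π] ≤ (B : ℝ)⁻¹ := by
    calc ((B : ℝ)⁻¹) ^ 2 * Var[F; π] ≤ ((B : ℝ)⁻¹) ^ 2 * B := by gcongr
      _ = (B : ℝ)⁻¹ := by field_simp
  linarith

theorem tendstoInMeasure_of_tendsto_integral_sq {Ω : Type*} [MeasurableSpace Ω] {P : Measure Ω}
    {X : ℕ → Ω → ℝ} {c : ℝ} (hint : ∀ t, Integrable (fun ω => (X t ω - c) ^ 2) P)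
    (h : Tendsto (fun t => ∫ ω, (X t ω - c) ^ 2 ∂P) atTop (𝓝 0)) :
    TendstoInMeasure P X atTop (fun _ => c) := by
  rw [tendstoInMeasure_iff_norm]
  intro ε hε
  have hε2 : 0 < ε ^ 2 := by positivity
  have hb : ∀ t, P {ω | ε ≤ ‖X t ω - c‖} ≤
      ENNReal.ofReal (∫ ω, (X t ω - c) ^ 2 ∂P) / ENNReal.ofReal (ε ^ 2) := fun t => by
    rw [ofReal_integral_eq_lintegral_ofReal (hint t) (ae_of_all _ fun ω => sq_nonneg _)]
    refine (measure_mono fun ω hω => ?_).trans (meas_ge_le_lintegral_div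
      (hint t).aestronglyMeasurable.aemeasurable.ennreal_ofReal
      (ENNReal.ofReal_pos.2 hε2).ne' ENNReal.ofReal_ne_top)
    rw [Set.mem_ofPred_eq] at hω ⊢
    refine ENNReal.ofReal_le_ofReal ?_
    rw [← sq_abs (X t ω - c)]
    exact pow_le_pow_left₀ hε.le hω 2
  refine tendsto_of_tendsto_of_tendsto_of_le_of_le tendsto_const_nhds ?_ (fun _ => zero_le) hb
  have h1 := ENNReal.Tendsto.div_const (ENNReal.tendsto_ofReal h)
    (Or.inr (ENNReal.ofReal_pos.2 hε2).ne')
  simpa using h1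

end Frequency

/-! ### Law of large numbers for the replicates. -/

section ReplicateFrequency

variable {d : ℕ} {Ω : Type*} [MeasurableSpace Ω] {P : Measure Ω} [IsProbabilityMeasure P]
  {X : Fin 2 → ℕ → Ω → EuclideanSpace ℝ (Fin d)} {n : ℕ → Fin 2 → ℕ}
  {Shat : Fin 2 → (m : ℕ) → (Fin m → EuclideanSpace ℝ (Fin d)) →
    Matrix (HalfIdx d) (HalfIdx d) ℝ}
  {Y : ℕ → ℕ → Fin 2 → Ω → EuclideanSpace ℝ (HalfIdx d)} {θ₀ : ReplicateParam d}

/-- The fraction of replicates in a set converges in probability to its mass under the limit law. -/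
theorem tendstoInMeasure_freq_replicates (hX : ∀ i k, Measurable (X i k))
    (hpos : ∀ i j, 0 < θ₀.1 i j j)
    (hθ₀ : θ₀ ∈ admissibleParams d) (hS : ∀ i m x, (Shat i m x).PosSemidef)
    (hθ : TendstoInMeasure P (fun t ω => sampleParam Shat (sampleOf X (n t) ω)) atTop
      (fun _ => θ₀)) (hY : ∀ t, IsMonteCarlo P X (n t) Shat (Y t)) {B : ℕ → ℕ}
    (hB : Tendsto B atTop atTop) {A : Set (EuclideanSpace ℝ (StackIdx d))}
    (hAm : MeasurableSet A) (hA : replicateLaw θ₀ (frontier A) = 0) :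
    TendstoInMeasure P (fun t ω => freq (fun b : Fin (B t) =>
      taylorT (sampleOf X (n t) ω) fun i => Y t b i ω) (· ∈ A)) atTop
      (fun _ => (replicateLaw θ₀).real A) := by
  set p := (replicateLaw θ₀).real A with hp
  have hp0 : 0 ≤ p := measureReal_nonneg
  have hp1 : p ≤ 1 := measureReal_le_one
  have hsq1 : ∀ u : ℝ, 0 ≤ u → u ≤ 1 → |(u - p) ^ 2| ≤ 1 := fun u h0 h1 => by
    rw [abs_of_nonneg (sq_nonneg _)]
    nlinarith [mul_nonneg h0 hp0, mul_nonneg (sub_nonneg.2 h1) (sub_nonneg.2 hp1),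
      mul_nonneg h0 (sub_nonneg.2 h1), mul_nonneg hp0 (sub_nonneg.2 hp1)]
  have hfm : ∀ t, Measurable fun x : Fin (B t) → EuclideanSpace ℝ (StackIdx d) =>
      (freq x (· ∈ A) - p) ^ 2 := fun t => ((measurable_freq hAm).sub_const p).pow_const 2
  have hfb : ∀ t (x : Fin (B t) → EuclideanSpace ℝ (StackIdx d)),
      |(freq x (· ∈ A) - p) ^ 2| ≤ 1 := fun t x => hsq1 _ (freq_nonneg _ _) (freq_le_one _ _)
  set H : ℕ → Ω → ℝ := fun t ω =>
    (replicateLaw (sampleParam Shat (sampleOf X (n t) ω))).real A with hH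
  have hHm : ∀ t, AEStronglyMeasurable (H t) P := fun t => by
    have h := aestronglyMeasurable_integral_replicateLaw_single hX (hY t)
      (g := A.indicator 1) (measurable_one.indicator hAm)
    simpa only [integral_indicator_one hAm] using h
  have hHsm : ∀ t, AEStronglyMeasurable (fun ω => (H t ω - p) ^ 2) P := fun t =>
    ((hHm t).sub aestronglyMeasurable_const).pow 2
  have hHsb : ∀ t ω, |(H t ω - p) ^ 2| ≤ 1 := fun t ω =>
    hsq1 _ measureReal_nonneg measureReal_le_one
  have hHs : Tendsto (fun t => ∫ ω, (H t ω - p) ^ 2 ∂P) atTop (𝓝 0) := by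
    refine tendsto_integral_of_tendstoInMeasure_of_bounded hHsm hHsb ?_
    have h := tendstoInMeasure_comp_of_continuousAt (f := fun u : ℝ => (u - p) ^ 2)
      (tendstoInMeasure_replicateLaw_real hpos hθ₀ hS hθ hA) (by fun_prop)
    simpa [← hp] using h
  refine tendstoInMeasure_of_tendsto_integral_sq (fun t => ?_) ?_
  · refine Integrable.of_bound ((hfm t).comp (measurable_pi_iff.2 fun b =>
      measurable_replicate hX (n t) ((hY t).1 b))).aestronglyMeasurable 1 (ae_of_all _ fun ω => ?_)
    exact hfb t _
  -- The variance bound `1/B` is uniform in the data and the bias does not involve `B`, so `B` may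
  -- grow at any rate.
  have hbound : ∀ᶠ t in atTop, ∫ ω, (freq (fun b : Fin (B t) =>
      taylorT (sampleOf X (n t) ω) fun i => Y t b i ω) (· ∈ A) - p) ^ 2 ∂P
        ≤ (B t : ℝ)⁻¹ + ∫ ω, (H t ω - p) ^ 2 ∂P := by
    filter_upwards [hB.eventually_gt_atTop 0] with t ht
    have hint : Integrable (fun ω => (H t ω - p) ^ 2) P :=
      Integrable.of_bound (hHsm t) 1 (ae_of_all _ fun ω => hHsb t ω)
    rw [integral_replicates hX (hY t) (B t)
      (f := fun x => (freq x (· ∈ A) - p) ^ 2) (hfm t) (hfb t)]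
    calc _ ≤ ∫ ω, ((B t : ℝ)⁻¹ + (H t ω - p) ^ 2) ∂P := by
          refine integral_mono_of_nonneg (ae_of_all _ fun ω =>
            integral_nonneg fun x => sq_nonneg _) ((integrable_const _).add hint)
            (ae_of_all _ fun ω => integral_sq_freq_sub_le _ hAm p ht)
      _ = _ := by
          rw [integral_add (integrable_const _) hint]
          simp
  refine tendsto_of_tendsto_of_tendsto_of_le_of_le' tendsto_const_nhds ?_
    (Eventually.of_forall fun t => integral_nonneg fun ω => sq_nonneg _) hbound
  simpa using ((tendsto_inv_atTop_zero.comp tendsto_natCast_atTop_atTop).comp hB).add hHs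

end ReplicateFrequency

/-! ### Deterministic bounds for empirical quantiles and the local level. -/

section Quantile

variable {ι : Type*} {B : ℕ} {t : Fin B → EuclideanSpace ℝ ι} {α β : ℝ}

/-- For `β < 1` every candidate `q` lies above some replicate, so the candidates are bounded below
and their infimum is meaningful. -/
theorem critValue_le (hβ : β < 1) {l : ι} {c : ℝ} (h : 1 - β ≤ freq t fun z => z l ≤ c) :
    critValue t β l ≤ c := by
  refine csInf_le ?_ h
  obtain ⟨m, hm⟩ := (Set.finite_range fun b => t b l).bddBelow
  refine ⟨m, fun q hq => ?_⟩
  have hq' : 1 - β ≤ freq t fun z => z l ≤ q := hq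
  obtain ⟨b, hb⟩ := exists_of_freq_pos (lt_of_lt_of_le (sub_pos.2 hβ) hq')
  exact (hm ⟨b, rfl⟩).trans hb

/-- For `β ≥ 0` the maximum of the replicates is a candidate, so the infimum is not over the empty
set. -/
theorem le_critValue (hB : 0 < B) (hβ : 0 ≤ β) {l : ι} {c : ℝ}
    (h : (freq t fun z => z l ≤ c) < 1 - β) : c ≤ critValue t β l := by
  refine le_csInf ?_ fun q hq => ?_
  · obtain ⟨m, hm⟩ := (Set.finite_range fun b => t b l).bddAbove
    refine ⟨m, ?_⟩
    have h1 : (freq t fun z => z l ≤ m) = 1 := freq_of_forall hB fun b => hm ⟨b, rfl⟩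
    change 1 - β ≤ freq t fun z => z l ≤ m
    linarith
  · have hq' : 1 - β ≤ freq t fun z => z l ≤ q := hq
    by_contra! hcq
    exact absurd (hq'.trans (freq_mono fun b hb => hb.trans hcq.le)) (not_le.2 h)

theorem familywiseRate_eq_freq :
    familywiseRate t β = freq t fun z => ∃ l, critValue t β l < z l := rfl

/-- The empirical `1`-quantile is a maximum, which no replicate exceeds. Thus level `0` is always
admissible for the local level. -/
theorem familywiseRate_zero (hB : 0 < B) : familywiseRate t 0 = 0 := by
  rw [familywiseRate_eq_freq]
  refine freq_of_forall_not fun b ⟨l, hl⟩ => not_le.2 hl ?_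
  refine le_csInf ?_ fun q hq => ?_
  · obtain ⟨m, hm⟩ := (Set.finite_range fun b => t b l).bddAbove
    refine ⟨m, ?_⟩
    have h1 : (freq t fun z => z l ≤ m) = 1 := freq_of_forall hB fun b => hm ⟨b, rfl⟩
    change 1 - 0 ≤ freq t fun z => z l ≤ m
    rw [h1, sub_zero]
  · have hq' : 1 - 0 ≤ freq t fun z => z l ≤ q := hq
    rw [sub_zero] at hq'
    exact forall_of_one_le_freq hB hq' b

theorem finite_localLevel_candidates : {β : ℝ | (∃ k : ℕ, k < B ∧ β = (k : ℝ) / B) ∧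
    familywiseRate t β ≤ α}.Finite := by
  refine ((Finset.range B).finite_toSet.image fun k : ℕ => (k : ℝ) / B).subset ?_
  rintro β ⟨⟨k, hk, rfl⟩, -⟩
  exact ⟨k, by simpa using hk, rfl⟩

theorem localLevel_mem (hB : 0 < B) (hα : 0 ≤ α) :
    (∃ k : ℕ, k < B ∧ localLevel t α = (k : ℝ) / B) ∧
      familywiseRate t (localLevel t α) ≤ α := by
  have hne : {β : ℝ | (∃ k : ℕ, k < B ∧ β = (k : ℝ) / B) ∧ familywiseRate t β ≤ α}.Nonempty :=
    ⟨0, ⟨0, hB, by simp⟩, by rwa [familywiseRate_zero hB]⟩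
  exact hne.csSup_mem finite_localLevel_candidates

theorem localLevel_nonneg (hB : 0 < B) (hα : 0 ≤ α) : 0 ≤ localLevel t α := by
  obtain ⟨⟨k, -, hk⟩, -⟩ := localLevel_mem (t := t) hB hα
  rw [hk]
  positivity

theorem localLevel_lt_one (hB : 0 < B) (hα : 0 ≤ α) : localLevel t α < 1 := by
  obtain ⟨⟨k, hkB, hk⟩, -⟩ := localLevel_mem (t := t) hB hα
  rw [hk, div_lt_one (by exact_mod_cast hB)]
  exact_mod_cast hkB

/-- By `h₀` the critical values at level `k/B` are at least `c₀`, so the familywise rate there is at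
most `α` and `k/B ≤ β̃`. Raising the level to `β̃` lowers the quantile, which by `h₁` is at most
`c₁`. -/
theorem critValue_localLevel_le {k : ℕ} (hk : k < B) (hα : 0 ≤ α) {c₀ c₁ : ι → ℝ}
    (h₁ : ∀ l, 1 - (k : ℝ) / B ≤ freq t fun z => z l ≤ c₁ l)
    (h₀ : ∀ l, (freq t fun z => z l ≤ c₀ l) < 1 - (k : ℝ) / B)
    (hrate : (freq t fun z => ∃ l, c₀ l < z l) ≤ α) (l : ι) :
    critValue t (localLevel t α) l ≤ c₁ l := by
  have hB : 0 < B := (Nat.zero_le k).trans_lt hk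
  have hmem : (k : ℝ) / B ≤ localLevel t α := by
    refine le_csSup finite_localLevel_candidates.bddAbove ⟨⟨k, hk, rfl⟩, ?_⟩
    rw [familywiseRate_eq_freq]
    refine (freq_mono fun b ⟨l, hl⟩ => ⟨l, ?_⟩).trans hrate
    exact (le_critValue hB (by positivity) (h₀ l)).trans_lt hl
  refine critValue_le (localLevel_lt_one hB hα) (le_trans ?_ (h₁ l))
  linarith

/-- If one critical value at `β̃` were below `c₂`, then `1 - β̃ < 1 - b`. As `β̃` is common to all
coordinates, all critical values would be at most `c₃` and the familywise rate at `β̃` would exceed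
`α`. The level `b` need not lie on the grid. -/
theorem le_critValue_localLevel (hB : 0 < B) (hα : 0 ≤ α) {b : ℝ} {c₂ c₃ : ι → ℝ}
    (h₂ : ∀ l, (freq t fun z => z l ≤ c₂ l) < 1 - b)
    (h₃ : ∀ l, 1 - b ≤ freq t fun z => z l ≤ c₃ l)
    (hrate : α < freq t fun z => ∃ l, c₃ l < z l) (l : ι) :
    c₂ l ≤ critValue t (localLevel t α) l := by
  by_contra! hlt
  have h1 : 1 - localLevel t α ≤ freq t fun z => z l ≤ c₂ l := by
    by_contra! h
    exact absurd (le_critValue hB (localLevel_nonneg hB hα) h) (not_le.2 hlt)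
  have h4 := (localLevel_mem (t := t) hB hα).2
  rw [familywiseRate_eq_freq] at h4
  refine absurd (hrate.trans_le ((freq_mono fun b ⟨l', hl'⟩ => ⟨l', ?_⟩).trans h4)) (lt_irrefl _)
  refine lt_of_le_of_lt (critValue_le (localLevel_lt_one hB hα) (le_trans ?_ (h₃ l'))) hl'
  linarith [h₂ l]

end Quantile

end CombinedTest

namespace CombinedTest

/-! ### Continuity and strict monotonicity of distribution functions. -/

section Cdf

theorem cdf_sub_cdf (m : Measure ℝ) [IsProbabilityMeasure m] {s s' : ℝ} (h : s ≤ s') :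
    cdf m s' - cdf m s = m.real (Set.Ioc s s') := by
  rw [cdf_eq_real, cdf_eq_real, ← Set.Iic_union_Ioc_eq_Iic h,
    measureReal_union (Set.Iic_disjoint_Ioc le_rfl) measurableSet_Ioc]
  ring

theorem cdf_lt_cdf_of_Ioo_pos {m : Measure ℝ} [IsProbabilityMeasure m] {s s' : ℝ} (h : s < s')
    (hm : 0 < m (Set.Ioo s s')) : cdf m s < cdf m s' := by
  have h1 : 0 < m.real (Set.Ioc s s') := ENNReal.toReal_pos
    (hm.trans_le (measure_mono Set.Ioo_subset_Ioc_self)).ne' (measure_ne_top _ _)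
  linarith [cdf_sub_cdf m h.le]

theorem continuous_cdf_of_measure_singleton {m : Measure ℝ} [IsProbabilityMeasure m]
    (h : ∀ s, m {s} = 0) : Continuous (cdf m) := by
  refine continuous_iff_continuousAt.2 fun s => ?_
  rw [(monotone_cdf m).continuousAt_iff_leftLim_eq_rightLim, StieltjesFunction.rightLim_eq]
  refine le_antisymm ((monotone_cdf m).leftLim_le le_rfl) ?_
  have h1 := (cdf m).measure_singleton s
  rw [measure_cdf, h s] at h1
  linarith [ENNReal.ofReal_eq_zero.1 h1.symm]

instance isOpenPosMeasure_gaussianReal : (gaussianReal 0 1).IsOpenPosMeasure :=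
  (gaussianReal_absolutelyContinuous' 0 one_ne_zero).isOpenPosMeasure

theorem strictMono_cdf_gaussianReal : StrictMono (cdf (gaussianReal 0 1)) := fun _ _ h =>
  cdf_lt_cdf_of_Ioo_pos h (isOpen_Ioo.measure_pos _ (Set.nonempty_Ioo.2 h))

end Cdf

theorem isOpen_exists_lt {ι : Type*} (c : ι → ℝ) :
    IsOpen {z : EuclideanSpace ℝ ι | ∃ l, c l < z l} := by
  have : {z : EuclideanSpace ℝ ι | ∃ l, c l < z l} = ⋃ l, {z | c l < z l} := by
    ext z
    simp
  rw [this]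
  exact isOpen_iUnion fun l => isOpen_lt continuous_const (by fun_prop)

/-! ### The maximum of the standardized coordinates of a Gaussian vector. -/

section MaxRatio

variable {ι : Type*} [Fintype ι] [Nonempty ι]

/-- The largest standardized coordinate. -/
noncomputable def maxRatio (σ : ι → ℝ) (z : EuclideanSpace ℝ ι) : ℝ :=
  Finset.univ.sup' Finset.univ_nonempty fun l => z l / σ l

theorem continuous_maxRatio (σ : ι → ℝ) : Continuous (maxRatio σ) :=
  Continuous.finset_sup'_apply _ fun l _ => by fun_prop

theorem lt_maxRatio {σ : ι → ℝ} (hσ : ∀ l, 0 < σ l) {s : ℝ} {z : EuclideanSpace ℝ ι} :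
    s < maxRatio σ z ↔ ∃ l, σ l * s < z l := by
  simp only [maxRatio, Finset.lt_sup'_iff, Finset.mem_univ, true_and]
  exact exists_congr fun l => by rw [lt_div_iff₀ (hσ l), mul_comm]

end MaxRatio

section MaxGaussian

variable {ι : Type*} [Fintype ι] [DecidableEq ι] {S : Matrix ι ι ℝ}

/-- The source is connected and its measure charges every nonempty open set. This replaces a
density, which need not exist since `S` may be singular. -/
theorem exists_map_pi_gaussianReal (S : Matrix ι ι ℝ) :
    ∃ F : (Fin (Module.finrank ℝ (EuclideanSpace ℝ ι)) → ℝ) → EuclideanSpace ℝ ι,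
      Continuous F ∧ multivariateGaussian 0 S = (Measure.pi fun _ => gaussianReal 0 1).map F := by
  have h1 : Continuous fun x : Fin (Module.finrank ℝ (EuclideanSpace ℝ ι)) → ℝ =>
      ∑ i, x i • stdOrthonormalBasis ℝ (EuclideanSpace ℝ ι) i := by fun_prop
  rw [multivariateGaussian, stdGaussian, Measure.map_map (by fun_prop) h1.measurable]
  exact ⟨_, by fun_prop, rfl⟩

theorem multivariateGaussian_coord_eq (hS : S.PosSemidef) {l : ι} (hl : 0 < S l l) (c : ℝ) :
    multivariateGaussian 0 S {z | z l = c} = 0 := by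
  have h := (measurePreserving_eval_multivariateGaussian (μ := 0) hS (i := l)).measure_preimage
    (measurableSet_singleton c).nullMeasurableSet
  have : NullSingletonClass (gaussianReal ((0 : EuclideanSpace ℝ ι) l) (S l l).toNNReal) :=
    nullSingletonClass_gaussianReal (Real.toNNReal_pos.2 hl).ne'
  rw [measure_singleton] at h
  exact h

/-- The value does not depend on `l`: thresholds `√(S l l) * s` are marginal quantiles at one common
level, as the critical values `q_{ℓ, β}` are in the sample. -/
theorem multivariateGaussian_coord_le (hS : S.PosSemidef) {l : ι} (hl : 0 < S l l) (s : ℝ) :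
    (multivariateGaussian 0 S).real {z | z l ≤ √(S l l) * s} = cdf (gaussianReal 0 1) s := by
  have hσ : 0 < √(S l l) := Real.sqrt_pos.2 hl
  have h := (measurePreserving_eval_multivariateGaussian (μ := 0) hS (i := l)).measureReal_preimage
    (measurableSet_Iic (a := √(S l l) * s)).nullMeasurableSet
  refine h.trans ?_
  have hmap : gaussianReal ((0 : EuclideanSpace ℝ ι) l) (S l l).toNNReal
      = (gaussianReal 0 1).map (√(S l l) * ·) := by
    rw [gaussianReal_map_const_mul]
    congr 1
    · simp
    · ext
      simp [Real.sq_sqrt hl.le, hl.le]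
  rw [hmap, cdf_eq_real, map_measureReal_apply (by fun_prop) measurableSet_Iic]
  congr 1
  ext x
  exact mul_le_mul_iff_right₀ hσ

theorem multivariateGaussian_frontier_le (hS : S.PosSemidef) {l : ι} (hl : 0 < S l l) (c : ℝ) :
    multivariateGaussian 0 S (frontier {z | z l ≤ c}) = 0 :=
  measure_mono_null (frontier_le_subset_eq (by fun_prop) continuous_const)
    (multivariateGaussian_coord_eq hS hl c)

/-- A boundary point satisfies `z l = c l` for some `l`, and each of these finitely many hyperplanes
is a null set. -/
theorem multivariateGaussian_frontier_exists_lt (hS : S.PosSemidef) (hpos : ∀ l, 0 < S l l)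
    (c : ι → ℝ) : multivariateGaussian 0 S (frontier {z | ∃ l, c l < z l}) = 0 := by
  refine measure_mono_null (t := ⋃ l, {z | z l = c l}) ?_
    (measure_iUnion_null fun l => multivariateGaussian_coord_eq hS (hpos l) (c l))
  intro z hz
  rw [(isOpen_exists_lt c).frontier_eq] at hz
  obtain ⟨hz1, hz2⟩ := hz
  have hcl : closure {z : EuclideanSpace ℝ ι | ∃ l, c l < z l} ⊆ ⋃ l, {z | c l ≤ z l} := by
    refine closure_minimal (fun w hw => ?_)
      (isClosed_iUnion_of_finite fun l => isClosed_le continuous_const (by fun_prop))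
    obtain ⟨l, hl⟩ := hw
    exact Set.mem_iUnion.2 ⟨l, le_of_lt hl⟩
  obtain ⟨l, hl⟩ := Set.mem_iUnion.1 (hcl hz1)
  refine Set.mem_iUnion.2 ⟨l, le_antisymm ?_ hl⟩
  by_contra! hlt
  exact hz2 ⟨l, hlt⟩

variable [Nonempty ι]

theorem measure_maxRatio_eq (hS : S.PosSemidef) (hpos : ∀ l, 0 < S l l) (s : ℝ) :
    (multivariateGaussian 0 S).map (maxRatio fun l => √(S l l)) {s} = 0 := by
  rw [Measure.map_apply (continuous_maxRatio _).measurable (measurableSet_singleton s)]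
  refine measure_mono_null (t := ⋃ l, {z | z l = √(S l l) * s}) (fun z hz => ?_)
    (measure_iUnion_null fun l => multivariateGaussian_coord_eq hS (hpos l) _)
  obtain ⟨l, -, hl⟩ := Finset.exists_mem_eq_sup' (Finset.univ_nonempty (α := ι))
    fun l => z l / √(S l l)
  have hz' : maxRatio (fun l => √(S l l)) z = s := hz
  refine Set.mem_iUnion.2 ⟨l, ?_⟩
  have h1 : z l / √(S l l) = s := hl.symm.trans hz'
  change z l = _
  rw [← h1, mul_div_cancel₀ _ (Real.sqrt_pos.2 (hpos l)).ne']

instance : IsProbabilityMeasure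
    ((multivariateGaussian 0 S).map (maxRatio fun l => √(S l l))) :=
  Measure.isProbabilityMeasure_map (continuous_maxRatio _).measurable.aemeasurable

/-- The distribution function of the maximum increases strictly where it is not `0` or `1`. -/
theorem cdf_maxRatio_lt {s s' : ℝ} (h : s < s')
    (h0 : 0 < cdf ((multivariateGaussian 0 S).map (maxRatio fun l => √(S l l))) s)
    (h1 : cdf ((multivariateGaussian 0 S).map (maxRatio fun l => √(S l l))) s < 1) :
    cdf ((multivariateGaussian 0 S).map (maxRatio fun l => √(S l l))) s
      < cdf ((multivariateGaussian 0 S).map (maxRatio fun l => √(S l l))) s' := by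
  obtain ⟨F, hF, hmap⟩ := exists_map_pi_gaussianReal S
  set M : EuclideanSpace ℝ ι → ℝ := maxRatio fun l => √(S l l) with hM
  set m := (multivariateGaussian 0 S).map M with hm
  have hMF : Continuous fun x => M (F x) := (continuous_maxRatio _).comp hF
  have hm' : m = (Measure.pi fun _ => gaussianReal 0 1).map fun x => M (F x) := by
    rw [hm, hmap, Measure.map_map (continuous_maxRatio _).measurable hF.measurable]
    rfl
  by_contra! hle
  have heq : cdf m s' = cdf m s := le_antisymm hle (monotone_cdf m h.le)
  have hex : ∀ A : Set ℝ, MeasurableSet A → 0 < m.real A → ∃ x, M (F x) ∈ A := fun A hA hpos => by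
    have h2 : (m A) ≠ 0 := fun h3 => by simp [measureReal_def, h3] at hpos
    rw [hm', Measure.map_apply hMF.measurable hA] at h2
    obtain ⟨x, hx⟩ := nonempty_of_measure_ne_zero h2
    exact ⟨x, hx⟩
  obtain ⟨x, hx⟩ := hex (Set.Iic s) measurableSet_Iic (by rwa [← cdf_eq_real])
  obtain ⟨y, hy⟩ := hex (Set.Ioi s') measurableSet_Ioi (by
    rw [← Set.compl_Iic, measureReal_compl measurableSet_Iic, ← cdf_eq_real, heq]
    simpa using h1)
  have hx' : M (F x) ≤ s := hx
  have hy' : s' < M (F y) := hy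
  -- The continuous function `M ∘ F` takes values on both sides of the midpoint, hence the midpoint
  -- itself. The preimage of `(s, s')` is then open and nonempty and has positive mass.
  obtain ⟨w, hw⟩ := mem_range_of_exists_le_of_exists_ge (c := (s + s') / 2) hMF
    ⟨x, by linarith⟩ ⟨y, by linarith⟩
  have hw' : M (F w) = (s + s') / 2 := hw
  refine absurd (cdf_lt_cdf_of_Ioo_pos (m := m) h ?_) (not_lt.2 hle)
  rw [hm', Measure.map_apply hMF.measurable measurableSet_Ioo]
  refine (isOpen_Ioo.preimage hMF).measure_pos _ ⟨w, ?_⟩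
  change M (F w) ∈ Set.Ioo s s'
  rw [hw']
  constructor <;> linarith

/-- The equicoordinate critical level of a Gaussian vector. -/
theorem exists_critical_level (hS : S.PosSemidef) (hpos : ∀ l, 0 < S l l) {α : ℝ}
    (hα : α ∈ Set.Ioo (0 : ℝ) 1) : ∃ s₀ : ℝ,
      (∀ s < s₀, α < (multivariateGaussian 0 S).real {z | ∃ l, √(S l l) * s < z l}) ∧
      (∀ s > s₀, (multivariateGaussian 0 S).real {z | ∃ l, √(S l l) * s < z l} < α) ∧
      Tendsto (fun s => (multivariateGaussian 0 S).real {z | ∃ l, √(S l l) * s < z l})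
        (𝓝 s₀) (𝓝 α) := by
  set m := (multivariateGaussian 0 S).map (maxRatio fun l => √(S l l)) with hm
  have hσ : ∀ l, 0 < √(S l l) := fun l => Real.sqrt_pos.2 (hpos l)
  have hG : ∀ s, (multivariateGaussian 0 S).real {z | ∃ l, √(S l l) * s < z l} = 1 - cdf m s := by
    intro s
    have h1 : m.real (Set.Ioi s) = 1 - cdf m s := by
      rw [← Set.compl_Iic, measureReal_compl measurableSet_Iic, cdf_eq_real]
      simp
    rw [← h1, hm, map_measureReal_apply (continuous_maxRatio _).measurable measurableSet_Ioi]
    congr 1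
    ext z
    exact (lt_maxRatio hσ).symm
  have hcont : Continuous (cdf m) :=
    continuous_cdf_of_measure_singleton (measure_maxRatio_eq hS hpos)
  obtain ⟨s₀, hs₀⟩ : 1 - α ∈ Set.range (cdf m) :=
    mem_range_of_exists_le_of_exists_ge hcont
      ((tendsto_cdf_atBot m).eventually_le_const (sub_pos.2 hα.2)).exists
      ((tendsto_cdf_atTop m).eventually_const_le (by linarith [hα.1])).exists
  simp only [hG]
  refine ⟨s₀, fun s hs => ?_, fun s hs => ?_, ?_⟩
  · have h1 : cdf m s < cdf m s₀ := by
      -- Strict growth holds only where the distribution function is positive; where it is `0`,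
      -- compare directly with `1 - α > 0`.
      rcases (cdf_nonneg m s).eq_or_lt with h | h
      · rw [← h, hs₀]
        linarith [hα.2]
      · exact cdf_maxRatio_lt hs h ((monotone_cdf m hs.le).trans_lt (by linarith [hα.1]))
    linarith
  · have h1 : cdf m s₀ < cdf m s :=
      cdf_maxRatio_lt hs (by rw [← hm, hs₀]; linarith [hα.2]) (by rw [← hm, hs₀]; linarith [hα.1])
    linarith
  · have h1 := (hcont.tendsto s₀).const_sub 1
    rwa [hs₀, sub_sub_cancel] at h1

end MaxGaussian

end CombinedTest

namespace CombinedTest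

/-! ### Asymptotic level of the test. -/

section Test

variable {Ω : Type*} [MeasurableSpace Ω] {P : Measure Ω}

theorem tendsto_measure_not_of_tendstoInMeasure {X : ℕ → Ω → ℝ} {c : ℝ}
    (h : TendstoInMeasure P X atTop (fun _ => c)) {p : ℝ → Prop} (hp : ∀ᶠ x in 𝓝 c, p x) :
    Tendsto (fun t => P {ω | ¬ p (X t ω)}) atTop (𝓝 0) := by
  obtain ⟨δ, hδ, hsub⟩ := Metric.eventually_nhds_iff.1 hp
  refine tendsto_of_tendsto_of_tendsto_of_le_of_le tendsto_const_nhds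
    (tendstoInMeasure_iff_dist.1 h δ hδ) (fun _ => zero_le) fun t => measure_mono fun ω hω => ?_
  rw [Set.mem_ofPred_eq] at hω ⊢
  by_contra! hlt
  exact hω (hsub hlt)

theorem tendsto_measure_exists_not {κ : Type*} [Finite κ] {p : κ → ℕ → Ω → Prop}
    (h : ∀ l, Tendsto (fun t => P {ω | ¬ p l t ω}) atTop (𝓝 0)) :
    Tendsto (fun t => P {ω | ¬ ∀ l, p l t ω}) atTop (𝓝 0) := by
  have := Fintype.ofFinite κ
  have h0 : Tendsto (fun t => ∑ l, P {ω | ¬ p l t ω}) atTop (𝓝 0) := by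
    simpa using tendsto_finsetSum Finset.univ fun l _ => h l
  refine tendsto_of_tendsto_of_tendsto_of_le_of_le tendsto_const_nhds h0 (fun _ => zero_le)
    fun t => (measure_mono fun ω hω => ?_).trans (measure_iUnion_fintype_le P _)
  rw [Set.mem_ofPred_eq, not_forall] at hω
  obtain ⟨l, hl⟩ := hω
  exact Set.mem_iUnion.2 ⟨l, hl⟩

theorem tendsto_measure_not_and {p q : ℕ → Ω → Prop}
    (hp : Tendsto (fun t => P {ω | ¬ p t ω}) atTop (𝓝 0))
    (hq : Tendsto (fun t => P {ω | ¬ q t ω}) atTop (𝓝 0)) :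
    Tendsto (fun t => P {ω | ¬ (p t ω ∧ q t ω)}) atTop (𝓝 0) := by
  have h0 := hp.add hq
  rw [add_zero] at h0
  refine tendsto_of_tendsto_of_tendsto_of_le_of_le tendsto_const_nhds h0 (fun _ => zero_le)
    fun t => (measure_mono fun ω hω => ?_).trans (measure_union_le _ _)
  rw [Set.mem_ofPred_eq, not_and_or] at hω
  exact hω

/-- Eventually, an interval of positive length contains a multiple of `1 / B`. -/
theorem eventually_exists_grid {u v : ℝ} (hu : 0 ≤ u) (huv : u < v) {B : ℕ → ℕ}
    (hB : Tendsto B atTop atTop) :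
    ∀ᶠ t in atTop, ∃ k : ℕ, u ≤ (k : ℝ) / B t ∧ (k : ℝ) / B t ≤ v := by
  have h := (tendsto_natCast_atTop_atTop (R := ℝ)).comp hB
  filter_upwards [h.eventually_ge_atTop (v - u)⁻¹, hB.eventually_gt_atTop 0] with t ht ht0
  have ht0' : (0 : ℝ) < B t := by exact_mod_cast ht0
  have h1 : (1 : ℝ) ≤ (v - u) * B t := by
    rw [← mul_inv_cancel₀ (sub_pos.2 huv).ne']
    exact mul_le_mul_of_nonneg_left ht (sub_pos.2 huv).le
  refine ⟨⌈u * B t⌉₊, (le_div_iff₀ ht0').2 (Nat.le_ceil _), (div_le_iff₀ ht0').2 ?_⟩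
  have h2 := (Nat.ceil_lt_add_one (mul_nonneg hu ht0'.le)).le
  linarith

variable {ι : Type*} [Fintype ι] [DecidableEq ι] [IsProbabilityMeasure P]

theorem tendsto_measureReal_of_tendstoInDistribution {S : Matrix ι ι ℝ}
    {T : ℕ → Ω → EuclideanSpace ℝ ι} (hTm : ∀ t, Measurable (T t))
    (hT : TendstoInDistribution T atTop (id : EuclideanSpace ℝ ι → _) (fun _ => P)
      (multivariateGaussian 0 S)) {A : Set (EuclideanSpace ℝ ι)} (hAm : MeasurableSet A)
    (hA : multivariateGaussian 0 S (frontier A) = 0) :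
    Tendsto (fun t => P.real {ω | T t ω ∈ A}) atTop (𝓝 ((multivariateGaussian 0 S).real A)) := by
  have h := ProbabilityMeasure.tendsto_measure_of_null_frontier_of_tendsto' hT.tendsto
    (E := A) (by simpa using hA)
  simp only [ProbabilityMeasure.coe_mk, Measure.map_id] at h
  refine ((ENNReal.tendsto_toReal (measure_ne_top _ _)).comp h).congr fun t => ?_
  simp only [Function.comp_apply]
  rw [Measure.map_apply (hTm t) hAm]
  rfl

/-- The multiple contrast test with Monte-Carlo critical values has asymptotic level `α`, when the
statistic and the replicates have the same Gaussian limit. -/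
theorem tendsto_measureReal_rejects [Nonempty ι] {S : Matrix ι ι ℝ} (hS : S.PosSemidef)
    (hpos : ∀ l, 0 < S l l) {T : ℕ → Ω → EuclideanSpace ℝ ι} (hTm : ∀ t, Measurable (T t))
    (hT : TendstoInDistribution T atTop (id : EuclideanSpace ℝ ι → _) (fun _ => P)
      (multivariateGaussian 0 S)) {B : ℕ → ℕ} (hB : Tendsto B atTop atTop)
    {R : (t : ℕ) → Ω → Fin (B t) → EuclideanSpace ℝ ι}
    (hR : ∀ A : Set (EuclideanSpace ℝ ι), MeasurableSet A →
      multivariateGaussian 0 S (frontier A) = 0 → TendstoInMeasure P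
        (fun t ω => freq (R t ω) (· ∈ A)) atTop (fun _ => (multivariateGaussian 0 S).real A))
    {α : ℝ} (hα : α ∈ Set.Ioo (0 : ℝ) 1) :
    Tendsto (fun t => P.real {ω | Rejects (R t ω) α (T t ω)}) atTop (𝓝 α) := by
  obtain ⟨s₀, hs_lt, hs_gt, hs_lim⟩ := exists_critical_level hS hpos hα
  set ν := multivariateGaussian 0 S with hν
  set Φ := cdf (gaussianReal 0 1) with hΦ
  set G : ℝ → ℝ := fun s => ν.real {z | ∃ l, √(S l l) * s < z l} with hG
  have hΦ1 : ∀ s, Φ s ≤ 1 := cdf_le_one _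
  have hΦ0 : ∀ s, 0 ≤ Φ s := cdf_nonneg _
  have hmono : StrictMono Φ := strictMono_cdf_gaussianReal
  have hcoord : ∀ s l, TendstoInMeasure P (fun t ω => freq (R t ω) fun z => z l ≤ √(S l l) * s)
      atTop (fun _ => Φ s) := fun s l => by
    have h := hR {z | z l ≤ √(S l l) * s}
      (measurableSet_le (by fun_prop) measurable_const)
      (multivariateGaussian_frontier_le hS (hpos l) _)
    rw [hν, multivariateGaussian_coord_le hS (hpos l)] at h
    exact h
  have hexists : ∀ s, TendstoInMeasure P
      (fun t ω => freq (R t ω) fun z => ∃ l, √(S l l) * s < z l) atTop (fun _ => G s) := fun s =>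
    hR {z | ∃ l, √(S l l) * s < z l} (isOpen_exists_lt _).measurableSet
      (multivariateGaussian_frontier_exists_lt hS hpos _)
  have hTs : ∀ s, Tendsto (fun t => P.real {ω | ∃ l, √(S l l) * s < T t ω l}) atTop (𝓝 (G s)) :=
    fun s => tendsto_measureReal_of_tendstoInDistribution hTm hT
      (isOpen_exists_lt _).measurableSet (multivariateGaussian_frontier_exists_lt hS hpos _)
  have hupper : ∀ s₁ > s₀, Tendsto (fun t => P {ω | ¬ ∀ l,
      critValue (R t ω) (localLevel (R t ω) α) l ≤ √(S l l) * s₁}) atTop (𝓝 0) := by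
    intro s₁ hs₁
    -- Choose `s₀ < s < s₁` and `Φ s < v < u < Φ s₁`. For large `B` some `k/B` lies in `[1 - u, 1 -
    -- v]`, so `1 - k/B` separates the marginal fractions at `s` and `s₁`. The familywise fraction
    -- at `s` is below `α` because `s > s₀`.
    obtain ⟨s, hs, hss₁⟩ := exists_between hs₁
    obtain ⟨u, hu1, hu2⟩ := exists_between (hmono hss₁)
    obtain ⟨v, hv1, hv2⟩ := exists_between hu1
    have hbad := tendsto_measure_not_and (tendsto_measure_exists_not fun l =>
      tendsto_measure_not_of_tendstoInMeasure (hcoord s₁ l) (eventually_ge_nhds hu2))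
      (tendsto_measure_not_and (tendsto_measure_exists_not fun l =>
        tendsto_measure_not_of_tendstoInMeasure (hcoord s l) (eventually_lt_nhds hv1))
      (tendsto_measure_not_of_tendstoInMeasure (hexists s) (eventually_le_nhds (hs_gt s hs))))
    refine tendsto_of_tendsto_of_tendsto_of_le_of_le' tendsto_const_nhds hbad
      (Eventually.of_forall fun _ => zero_le) ?_
    filter_upwards [eventually_exists_grid (u := 1 - u) (v := 1 - v)
      (by linarith [hΦ1 s₁]) (by linarith) hB, hB.eventually_gt_atTop 0] with t ht ht0
    obtain ⟨k, hk1, hk2⟩ := ht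
    have hkB : k < B t := by
      have h0 : (0 : ℝ) < B t := by exact_mod_cast ht0
      have h1 : (k : ℝ) / B t < 1 := by linarith [hΦ0 s]
      exact_mod_cast (div_lt_one h0).1 h1
    refine measure_mono fun ω hω hgood => hω ?_
    obtain ⟨h1, h2, h3⟩ := hgood
    exact critValue_localLevel_le hkB hα.1.le (fun l => by linarith [h1 l])
      (c₀ := fun l => √(S l l) * s) (fun l => by linarith [h2 l]) h3
  have hlower : ∀ s₂ < s₀, Tendsto (fun t => P {ω | ¬ ∀ l,
      √(S l l) * s₂ ≤ critValue (R t ω) (localLevel (R t ω) α) l}) atTop (𝓝 0) := by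
    intro s₂ hs₂
    -- The mirror image, with `s₂ < s < s₀` and `Φ s₂ < u < Φ s`. No grid point is needed here, as
    -- `b = 1 - u` may be any real number.
    obtain ⟨s, hss₂, hs⟩ := exists_between hs₂
    obtain ⟨u, hu1, hu2⟩ := exists_between (hmono hss₂)
    have hbad := tendsto_measure_not_and (tendsto_measure_exists_not fun l =>
      tendsto_measure_not_of_tendstoInMeasure (hcoord s₂ l) (eventually_lt_nhds hu1))
      (tendsto_measure_not_and (tendsto_measure_exists_not fun l =>
        tendsto_measure_not_of_tendstoInMeasure (hcoord s l) (eventually_ge_nhds hu2))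
      (tendsto_measure_not_of_tendstoInMeasure (hexists s) (eventually_gt_nhds (hs_lt s hs))))
    refine tendsto_of_tendsto_of_tendsto_of_le_of_le' tendsto_const_nhds hbad
      (Eventually.of_forall fun _ => zero_le) ?_
    filter_upwards [hB.eventually_gt_atTop 0] with t ht0
    refine measure_mono fun ω hω hgood => hω ?_
    obtain ⟨h1, h2, h3⟩ := hgood
    exact le_critValue_localLevel ht0 hα.1.le (b := 1 - u) (fun l => by linarith [h1 l])
      (c₃ := fun l => √(S l l) * s) (fun l => by linarith [h2 l]) h3
  have htoReal : ∀ {a : ℕ → ENNReal}, Tendsto a atTop (𝓝 0) →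
      Tendsto (fun t => (a t).toReal) atTop (𝓝 0) := fun h => by
    simpa [Function.comp_def] using (ENNReal.tendsto_toReal ENNReal.zero_ne_top).comp h
  -- Up to a vanishing probability, rejection contains the event that `T` exceeds the constants at
  -- `s₁` in some coordinate, and is contained in the corresponding event at `s₂`. Continuity of `G`
  -- at `s₀`, with `G s₀ = α`, lets both bounds approach `α`.
  refine tendsto_order.2 ⟨fun a ha => ?_, fun a ha => ?_⟩
  · obtain ⟨s₁, hs₁a, hs₁⟩ := (((hs_lim.mono_left nhdsWithin_le_nhds).eventually_const_lt ha).and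
      (self_mem_nhdsWithin (a := s₀) (s := Set.Ioi s₀))).exists
    have hlim := (hTs s₁).sub (htoReal (hupper s₁ hs₁))
    rw [sub_zero] at hlim
    filter_upwards [hlim.eventually_const_lt hs₁a] with t ht
    refine ht.trans_le (sub_le_iff_le_add.2 ?_)
    refine (measureReal_mono (fun ω hω => ?_)).trans (measureReal_union_le _ _)
    by_cases hb : ∀ l, critValue (R t ω) (localLevel (R t ω) α) l ≤ √(S l l) * s₁
    · obtain ⟨l, hl⟩ := hω
      exact Or.inl ⟨l, (hb l).trans_lt hl⟩
    · exact Or.inr hb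
  · obtain ⟨s₂, hs₂a, hs₂⟩ := (((hs_lim.mono_left nhdsWithin_le_nhds).eventually_lt_const ha).and
      (self_mem_nhdsWithin (a := s₀) (s := Set.Iio s₀))).exists
    have hlim := (hTs s₂).add (htoReal (hlower s₂ hs₂))
    rw [add_zero] at hlim
    filter_upwards [hlim.eventually_lt_const hs₂a] with t ht
    refine lt_of_le_of_lt ?_ ht
    refine (measureReal_mono (fun ω hω => ?_)).trans (measureReal_union_le _ _)
    by_cases hb : ∀ l, √(S l l) * s₂ ≤ critValue (R t ω) (localLevel (R t ω) α) l
    · obtain ⟨l, hl⟩ := hω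
      exact Or.inl ⟨l, (hb l).trans_lt hl⟩
    · exact Or.inr hb

end Test

end CombinedTest

theorem mainTheorem7 {Ω : Type*} [MeasurableSpace Ω] (P : Measure Ω) [IsProbabilityMeasure P]
    (d : ℕ) (hd : 2 ≤ d)
    -- the model `X_{ik} = μ_i + ε_{ik}`
    (μ : Fin 2 → EuclideanSpace ℝ (Fin d))
    (ε : Fin 2 → ℕ → Ω → EuclideanSpace ℝ (Fin d))
    (X : Fin 2 → ℕ → Ω → EuclideanSpace ℝ (Fin d))
    (hX : ∀ i k ω, X i k ω = μ i + ε i k ω)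
    (hε_meas : ∀ i k, Measurable (ε i k))
    (hε_indep : iIndepFun (fun q : Fin 2 × ℕ => ε q.1 q.2) P)
    (hε_ident : ∀ i k, IdentDistrib (ε i k) (ε i 0) P P)
    (hε_mean : ∀ i, ∫ ω, ε i 0 ω ∂P = 0)
    (hε_four : ∀ i, MemLp (ε i 0) 4 P)
    (hε_var : ∀ i j, 0 < CombinedTest.popCov (ε i 0) P j j)
    -- the sample sizes
    (n : ℕ → Fin 2 → ℕ) (κ : Fin 2 → ℝ)
    (hn : ∀ i, Tendsto (fun t => n t i) atTop atTop)
    (hκ : ∀ i, κ i ∈ Set.Ioc (0 : ℝ) 1)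
    (hnκ : ∀ i, Tendsto (fun t => (n t i : ℝ) / ((n t 0 + n t 1 : ℕ) : ℝ)) atTop (𝓝 (κ i))) :
    -- `T` is asymptotically `N(0, Γ)` under the null hypothesis
    (CombinedTest.popCov (ε 0 0) P = CombinedTest.popCov (ε 1 0) P →
      TendstoInDistribution
        (fun t ω => CombinedTest.statT (CombinedTest.sampleOf X (n t) ω)) atTop
        (id : EuclideanSpace ℝ (CombinedTest.StackIdx d) → _) (fun _ => P)
        (multivariateGaussian 0 (CombinedTest.limitCov κ (fun i => ε i 0) P))) ∧
    -- the explicit estimators of `Σ_i` are consistent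
    (∀ i, CombinedTest.IsConsistentCovEstimator P (X i) (CombinedTest.popSigma (ε i 0) P)
      CombinedTest.empSigma) ∧
    -- the Monte-Carlo replicates, for these and all other consistent estimators of `Σ_i`
    (∀ (Shat : Fin 2 → (m : ℕ) → (Fin m → EuclideanSpace ℝ (Fin d)) →
          Matrix (CombinedTest.HalfIdx d) (CombinedTest.HalfIdx d) ℝ)
        (Y : ℕ → ℕ → Fin 2 → Ω → EuclideanSpace ℝ (CombinedTest.HalfIdx d))
        (TTay : ℕ → ℕ → Ω → EuclideanSpace ℝ (CombinedTest.StackIdx d)),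
      (∀ i, CombinedTest.IsConsistentCovEstimator P (X i)
        (CombinedTest.popSigma (ε i 0) P) (Shat i)) →
      (∀ t, CombinedTest.IsMonteCarlo P X (n t) Shat (Y t)) →
      (∀ t b ω, TTay t b ω =
        CombinedTest.taylorT (CombinedTest.sampleOf X (n t) ω) (fun i => Y t b i ω)) →
      -- the replicates are asymptotically `N(0, Γ)`, unconditionally
      (∀ b, TendstoInDistribution (fun t => TTay t b) atTop
        (id : EuclideanSpace ℝ (CombinedTest.StackIdx d) → _) (fun _ => P)
        (multivariateGaussian 0 (CombinedTest.limitCov κ (fun i => ε i 0) P))) ∧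
      -- and given the data: the conditional laws converge weakly in probability
      (∀ (b : ℕ) (g : EuclideanSpace ℝ (CombinedTest.StackIdx d) →ᵇ ℝ),
        TendstoInMeasure P
          (fun t ω => ∫ z, g z ∂(condDistrib (TTay t b) (CombinedTest.sampleOf X (n t)) P
            (CombinedTest.sampleOf X (n t) ω))) atTop
          (fun _ => ∫ z, g z
            ∂(multivariateGaussian 0 (CombinedTest.limitCov κ (fun i => ε i 0) P)))) ∧
      -- the multiple contrast test has asymptotic level `α` under the null hypothesis
      (CombinedTest.popCov (ε 0 0) P = CombinedTest.popCov (ε 1 0) P →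
        (∀ l, 0 < CombinedTest.limitCov κ (fun i => ε i 0) P l l) →
        ∀ α ∈ Set.Ioo (0 : ℝ) 1, ∀ B : ℕ → ℕ, Tendsto B atTop atTop →
          Tendsto (fun t => P.real {ω | CombinedTest.Rejects (fun b : Fin (B t) => TTay t b ω) α
            (CombinedTest.statT (CombinedTest.sampleOf X (n t) ω))}) atTop (𝓝 α))) := by
  have hκ0 : ∀ i, 0 < κ i := fun i => (hκ i).1
  obtain rfl : X = fun i k ω => μ i + ε i k ω := funext fun i => funext fun k => funext (hX i k)
  have hXm : ∀ i k, Measurable fun ω => μ i + ε i k ω := fun i k => (hε_meas i k).const_add _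
  have hindep : ∀ i, iIndepFun (ε i) P := fun i =>
    hε_indep.precomp (g := fun k : ℕ => ((i, k) : Fin 2 × ℕ)) fun a b h => (Prod.ext_iff.1 h).2
  -- The results on replicates have `replicateLaw` at the limit parameter as their limit; this
  -- identity turns it into `N(0, Γ)`.
  have hlaw := CombinedTest.replicateLaw_limitParam hε_four hκ0
  have hadm : CombinedTest.limitParam κ (fun i => ε i 0) P ∈ CombinedTest.admissibleParams d :=
    fun i => CombinedTest.posSemidef_popSigma (hε_four i)
  have hT := CombinedTest.tendstoInDistribution_statT (μ := μ) hε_meas hε_indep hε_ident hε_mean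
    hε_four hε_var hn hκ0 hnκ
  refine ⟨hT, fun i => CombinedTest.isConsistentCovEstimator_empSigma (hε_meas i) (hindep i)
    (hε_ident i) (hε_mean i) (hε_four i) (μ i), fun Shat Y TTay hShat hY hTTay => ?_⟩
  obtain rfl : TTay = fun t b ω => CombinedTest.taylorT
      (CombinedTest.sampleOf (fun i k ω => μ i + ε i k ω) (n t) ω) (fun i => Y t b i ω) :=
    funext fun t => funext fun b => funext (hTTay t b)
  have hpsd : ∀ i m x, (Shat i m x).PosSemidef := fun i => (hShat i).posSemidef
  have hθ := CombinedTest.tendstoInMeasure_sampleParam (e := fun i => ε i 0)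
    (X := fun i k ω => μ i + ε i k ω) (fun i j k => CombinedTest.tendstoInMeasure_empCov
      (hε_meas i) (hindep i) (hε_ident i) (hε_mean i) (hε_four i) (μ i) j k) hShat hn hκ0 hnκ
  refine ⟨fun b => ?_, fun b g => ?_, fun hV hΓ α hα B hB => ?_⟩
  · simpa only [hlaw] using
      CombinedTest.tendstoInDistribution_replicate hXm hε_var hadm hpsd hθ hY b
  · rw [← hlaw]
    exact CombinedTest.tendstoInMeasure_integral_condDistrib_replicate hXm hε_var hadm hpsd hθ
      hY b g
  · have : Nonempty (CombinedTest.StackIdx d) := ⟨Sum.inl ⟨0, by omega⟩⟩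
    refine CombinedTest.tendsto_measureReal_rejects (CombinedTest.posSemidef_limitCov hε_four hκ0)
      hΓ (fun t => (CombinedTest.measurable_statT (n t)).comp
        (CombinedTest.measurable_sampleOf hXm (n t))) (hT hV) hB (fun A hAm hA => ?_) hα
    rw [← hlaw] at hA ⊢
    exact CombinedTest.tendstoInMeasure_freq_replicates hXm hε_var hadm hpsd hθ hY hB hAm hA
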